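/- Let $W$ be an entire function with $W(z+1)=W(z)$ and $W_0:=\int_0^1 W(x)\,dx\neq 0$. Suppose that there is a Stokes loop for $W$, i.e. a closed smooth non-self-intersecting curve $\gamma:[0,1]\to\mathbb C/\mathbb Z$ with $\gamma'(t)\neq 0$, $\operatorname{Im}\big(\gamma'(t)W_0^{-1}W(\gamma(t))\big)=0$ and $W(\gamma(t))\neq 0$ for all $t\in[0,1]$. For $\alpha,\zeta\in\mathbb C$ let $P_\zeta(\alpha)=(D_x+\zeta)^2-\alpha^2W(x)^2:H^2(\mathbb R/\mathbb Z)\to L^2(\mathbb R/\mathbb Z)$, where $D_x=\frac1i\frac{d}{dx}$. Then for $|\alpha|\gg1$ and $|\operatorname{Re}\zeta|\le\pi$, the kernel of $P_\zeta(\alpha)$ is nontrivial if and only if $\alpha=W_0^{-1}(2\pi n\pm\zeta)+\mathcal O(|\alpha|^{-1})$ for some $n\in\mathbb Z$ and some choice of the sign, in the following sense. There are constants $C,R$ and maps $\alpha_+,\alpha_-:\mathbb Z\times\mathbb C\to\mathbb C$ such that, for all $n\in\mathbb Z$ and all $\zeta\in\mathbb C$ with $|\operatorname{Re}\zeta|\le\pi$,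 $$\big|\alpha_\pm(n,\zeta)-W_0^{-1}(2\pi n\pm\zeta)\big|\le \frac{C}{1+|\alpha_\pm(n,\zeta)|},$$ and such that, for all $\alpha,\zeta\in\mathbb C$ with $|\alpha|\ge R$ and $|\operatorname{Re}\zeta|\le\pi$, $$\ker P_\zeta(\alpha)\neq\{0\}\iff \exists\, n\in\mathbb Z:\ \alpha=\alpha_+(n,\zeta)\ \text{ or }\ \alpha=\alpha_-(n,\zeta).$$ -/

import Mathlib

open MeasureTheory
open scoped ContDiff

/-- The mean `W₀ = ∫₀¹ W(x) dx` of `W` over a period. -/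
noncomputable def meanValue (W : ℂ → ℂ) : ℂ := ∫ x in (0 : ℝ)..1, W (x : ℂ)

/-- `γ : ℝ → ℂ` is a lift of a closed smooth non-self-intersecting curve `ℝ / ℤ → ℂ / ℤ` with
nowhere vanishing derivative. -/
structure IsSimpleClosedCurveModZ (γ : ℝ → ℂ) : Prop where
  smooth : ContDiff ℝ ∞ γ
  closed : ∃ m : ℤ, ∀ t : ℝ, γ (t + 1) = γ t + m
  simple : ∀ s t : ℝ, (∃ k : ℤ, γ s = γ t + k) → ∃ j : ℤ, s = t + j
  deriv_ne_zero : ∀ t : ℝ, deriv γ t ≠ 0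

/-- A Stokes loop for `W`: a simple closed curve in `ℂ / ℤ`, given by a lift `γ`, along which
`Im (γ' W₀⁻¹ W(γ)) = 0` and `W(γ) ≠ 0`. -/
structure IsStokesLoop (W : ℂ → ℂ) (γ : ℝ → ℂ) : Prop extends IsSimpleClosedCurveModZ γ where
  im_eq_zero : ∀ t : ℝ, (deriv γ t * (meanValue W)⁻¹ * W (γ t)).im = 0
  ne_zero : ∀ t : ℝ, W (γ t) ≠ 0

/-- The Sobolev space `H²(ℝ / ℤ)`, each class being represented by its unique `C¹` representative:
1-periodic `C¹` functions whose derivative is absolutely continuous with (almost everywhere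
defined) derivative in `L²` over a period. -/
def sobolevH2 : Set (ℝ → ℂ) :=
  {u | Function.Periodic u 1 ∧ Differentiable ℝ u ∧
    (∀ a b : ℝ, AbsolutelyContinuousOnInterval (deriv u) a b) ∧
    MemLp (deriv (deriv u)) 2 (volume.restrict (Set.Ioc 0 1))}

/-- The operator `D_x + ζ`, where `D_x = -i d/dx`. -/
noncomputable def shiftedD (ζ : ℂ) (u : ℝ → ℂ) : ℝ → ℂ :=
  fun x => -Complex.I * deriv u x + ζ * u x

/-- The operator `P_ζ(α) = (D_x + ζ)² - α² W(x)²`. -/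
noncomputable def opP (W : ℂ → ℂ) (ζ α : ℂ) (u : ℝ → ℂ) : ℝ → ℂ :=
  fun x => shiftedD ζ (shiftedD ζ u) x - α ^ 2 * W (x : ℂ) ^ 2 * u x

/-- The kernel of `P_ζ(α) : H²(ℝ / ℤ) → L²(ℝ / ℤ)`. -/
def kerP (W : ℂ → ℂ) (ζ α : ℂ) : Set (ℝ → ℂ) :=
  {u | u ∈ sobolevH2 ∧ opP W ζ α u =ᵐ[volume] 0}

/-! Conjugation by `exp (iζx)` turns the kernel equation into `y'' = -α² W² y`, whose solutions are
entire in `x`. The kernel is nontrivial exactly when `exp (iζ)` is an eigenvalue of the monodromy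
over a period. The monodromy has determinant one, so this says that its half-trace equals `cos ζ`
(`exists_mem_kerP_ne_zero_iff`). The half-trace is an entire function `T` of `β = α W₀`.

On the real axis `W` may vanish or rotate, which spoils a direct WKB analysis. But the monodromy can
be computed from any base point and along any path from `z` to `z + 1`, in particular along the
Stokes loop. There the primitive of `W / W₀` has constant imaginary part, so its real part is a real
parameter. With `ρ² = W / W₀` along the loop, the Liouville transformation yields a Hill equation
`f'' = (Q - β²) f` with `Q = ρ'' / ρ` continuous. This has the same trace provided that the loop
goes once around the cylinder and that `ρ` is periodic, not antiperiodic. The first is the bound on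
the winding number of a simple closed curve (`IsSimpleClosedCurve.windingIntegral_zero`), the second
a version of Hopf's Umlaufsatz (`exists_periodic_sqrt_inv_deriv`).

Two Volterra iterations then give `T β = cos (β - q / β) + O(exp |Im β| / |β|²)` with `q = ½ ∫ Q`
(`IsStokesLoop.exists_isNearCos`). It remains to solve `T β = cos ζ` uniformly in `ζ`. The
difference of cosines is a product of two sines, so roots lie within `O(1 / |β|)` of the targets
`2πn ± ζ`. Counting zeros gives one root near a target away from `πℤ`, and one or two distinct roots
near a target almost on `πℤ`, where the two families meet. `exists_cos_root_labels` distributes the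
roots over the targets. -/

/-! ### Elementary estimates for the complex sine and cosine. -/

theorem normSq_sin_eq (w : ℂ) : ‖Complex.sin w‖ ^ 2 = Real.sin w.re ^ 2 + Real.sinh w.im ^ 2 := by
  rw [Complex.sq_norm]
  conv_lhs => rw [← Complex.re_add_im w, Complex.sin_add, Complex.cos_mul_I, Complex.sin_mul_I,
    ← Complex.ofReal_sin, ← Complex.ofReal_cos, ← Complex.ofReal_sinh, ← Complex.ofReal_cosh]
  simp only [Complex.normSq_apply, Complex.add_re, Complex.add_im, Complex.mul_re, Complex.mul_im,
    Complex.ofReal_re, Complex.ofReal_im, Complex.I_re, Complex.I_im]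
  nlinarith [Real.sin_sq_add_cos_sq w.re, Real.cosh_sq w.im]

theorem norm_cexp_mul_I_le (w : ℂ) : ‖Complex.exp (w * Complex.I)‖ ≤ Real.exp |w.im| := by
  rw [Complex.norm_exp]
  apply Real.exp_le_exp.2
  simpa using neg_le_abs w.im

theorem norm_sin_le_exp_abs_im (w : ℂ) : ‖Complex.sin w‖ ≤ Real.exp |w.im| := by
  have h1 := norm_cexp_mul_I_le w
  have h2 := norm_cexp_mul_I_le (-w)
  rw [Complex.neg_im, abs_neg] at h2
  have : ‖(Complex.exp (-w * Complex.I) - Complex.exp (w * Complex.I)) * Complex.I / 2‖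
      ≤ (Real.exp |w.im| + Real.exp |w.im|) / 2 := by
    rw [norm_div, norm_mul, Complex.norm_I, mul_one, Complex.norm_ofNat]
    gcongr
    exact (norm_sub_le _ _).trans (by gcongr)
  rw [Complex.sin]
  linarith

theorem norm_cos_le_exp_abs_im (w : ℂ) : ‖Complex.cos w‖ ≤ Real.exp |w.im| := by
  have h1 := norm_cexp_mul_I_le w
  have h2 := norm_cexp_mul_I_le (-w)
  rw [Complex.neg_im, abs_neg] at h2
  have : ‖(Complex.exp (w * Complex.I) + Complex.exp (-w * Complex.I)) / 2‖
      ≤ (Real.exp |w.im| + Real.exp |w.im|) / 2 := by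
    rw [norm_div, Complex.norm_ofNat]
    gcongr
    exact (norm_add_le _ _).trans (by gcongr)
  rw [Complex.cos]
  linarith

/-- Jordan's inequality controls the real part and `|sinh y| ≥ |y|` the imaginary part. -/
theorem norm_le_two_mul_norm_sin {w : ℂ} (hw : |w.re| ≤ Real.pi / 2) :
    ‖w‖ ≤ 2 * ‖Complex.sin w‖ := by
  have h1 := normSq_sin_eq w
  have h2 : ‖w‖ ^ 2 = w.re ^ 2 + w.im ^ 2 := by
    rw [Complex.sq_norm, Complex.normSq_apply]; ring
  have h3 : 2 / Real.pi * |w.re| ≤ |Real.sin w.re| := Real.mul_abs_le_abs_sin hw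
  have h4 : w.im ^ 2 ≤ Real.sinh w.im ^ 2 := by
    rw [sq_le_sq]
    rcases le_total 0 w.im with h | h
    · rw [abs_of_nonneg h, abs_of_nonneg (Real.sinh_nonneg_iff.2 h)]
      exact Real.self_le_sinh_iff.2 h
    · rw [abs_of_nonpos h, abs_of_nonpos (Real.sinh_nonpos_iff.2 h)]
      linarith [Real.sinh_le_self_iff.2 h]
  have h5 : |w.re| / 2 ≤ |Real.sin w.re| := by
    refine le_trans ?_ h3
    have : (1:ℝ) / 2 ≤ 2 / Real.pi := by
      rw [div_le_div_iff₀ (by norm_num) Real.pi_pos]; linarith [Real.pi_le_four]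
    nlinarith [abs_nonneg w.re]
  have h6 : w.re ^ 2 / 4 ≤ Real.sin w.re ^ 2 := by
    rw [← sq_abs w.re, ← sq_abs (Real.sin _)]
    nlinarith [abs_nonneg w.re]
  have : ‖w‖ ^ 2 ≤ (2 * ‖Complex.sin w‖) ^ 2 := by nlinarith [sq_nonneg w.im]
  exact (pow_le_pow_iff_left₀ (norm_nonneg _) (by positivity) (by norm_num)).1 this

theorem exists_int_abs_sub_pi_le (x : ℝ) : ∃ k : ℤ, |x - Real.pi * k| ≤ Real.pi / 2 := by
  refine ⟨round (x / Real.pi), ?_⟩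
  have h := abs_sub_round (x / Real.pi)
  have : x - Real.pi * round (x / Real.pi) = Real.pi * (x / Real.pi - round (x / Real.pi)) := by
    field_simp
  rw [this, abs_mul, abs_of_pos Real.pi_pos]
  nlinarith [Real.pi_pos]

theorem norm_sin_sub_int_mul_pi (w : ℂ) (k : ℤ) :
    ‖Complex.sin (w - Real.pi * k)‖ = ‖Complex.sin w‖ := by
  rw [mul_comm, Complex.sin_antiperiodic.sub_int_mul_eq, norm_mul]
  simp

/-- Away from its zeros, `sin` is comparable with `exp |Im|`. -/
theorem mul_exp_abs_im_le_norm_sin {w : ℂ} {δ : ℝ} (hδ : δ ≤ 1)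
    (h : ∀ k : ℤ, δ ≤ ‖w - Real.pi * k‖) :
    δ * Real.exp |w.im| ≤ 8 * ‖Complex.sin w‖ := by
  -- For `|Im w| ≥ 1`, `sinh |Im w|` alone is comparable with the exponential. Otherwise the
  -- exponential is at most `3`, and translation by the nearest multiple of `π` reduces to the
  -- linear bound.
  rcases le_or_gt 1 |w.im| with h1 | h1
  · have h2 : Real.sinh |w.im| ≤ ‖Complex.sin w‖ := by
      have : Real.sinh |w.im| ^ 2 ≤ ‖Complex.sin w‖ ^ 2 := by
        rw [normSq_sin_eq, ← Real.abs_sinh, sq_abs]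
        nlinarith [sq_nonneg (Real.sin w.re)]
      exact (pow_le_pow_iff_left₀ (Real.sinh_nonneg_iff.2 (abs_nonneg _)) (norm_nonneg _)
        (by norm_num)).1 this
    rw [Real.sinh_eq] at h2
    have h3 : Real.exp (-|w.im|) ≤ 1 := Real.exp_le_one_iff.2 (by linarith)
    have h4 : (2 : ℝ) ≤ Real.exp |w.im| := by
      linarith [Real.add_one_le_exp |w.im|]
    nlinarith [Real.exp_pos |w.im|]
  · obtain ⟨k, hk⟩ := exists_int_abs_sub_pi_le w.re
    have h2 : ‖w - Real.pi * k‖ ≤ 2 * ‖Complex.sin (w - Real.pi * k)‖ := by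
      apply norm_le_two_mul_norm_sin
      simpa using hk
    rw [norm_sin_sub_int_mul_pi] at h2
    have h3 : Real.exp |w.im| ≤ 3 :=
      (Real.exp_le_exp.2 h1.le).trans (by linarith [Real.exp_one_lt_d9])
    have h4 := h k
    nlinarith [Real.exp_pos |w.im|, norm_nonneg (Complex.sin w)]

theorem norm_sin_le_two_mul {w : ℂ} (hw : ‖w‖ ≤ 1) : ‖Complex.sin w‖ ≤ 2 * ‖w‖ := by
  have h := Complex.sin_bound hw
  have h1 : ‖Complex.sin w‖ ≤ ‖Complex.sin w - (w - w ^ 3 / 6)‖ + ‖w - w ^ 3 / 6‖ := by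
    have := norm_add_le (Complex.sin w - (w - w ^ 3 / 6)) (w - w ^ 3 / 6)
    rwa [sub_add_cancel] at this
  have h2 : ‖w - w ^ 3 / 6‖ ≤ ‖w‖ + ‖w‖ ^ 3 / 6 := by
    refine (norm_sub_le _ _).trans ?_
    simp
  have h0 := norm_nonneg w
  have h3 : ‖w‖ ^ 3 ≤ ‖w‖ := by
    simpa using pow_le_pow_of_le_one h0 hw (show 1 ≤ 3 by norm_num)
  have h4 : ‖w‖ ^ 5 ≤ ‖w‖ := by
    simpa using pow_le_pow_of_le_one h0 hw (show 1 ≤ 5 by norm_num)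
  linarith

theorem norm_le_two_mul_norm_sin_of_norm_le_one {w : ℂ} (hw : ‖w‖ ≤ 1) :
    ‖w‖ ≤ 2 * ‖Complex.sin w‖ :=
  norm_le_two_mul_norm_sin ((Complex.abs_re_le_norm w).trans (hw.trans
    (by linarith [Real.pi_gt_three])))

theorem norm_one_sub_cos_le {w : ℂ} (hw : ‖w‖ ≤ 1) : ‖1 - Complex.cos w‖ ≤ 2 * ‖w‖ := by
  have h1 : 1 - Complex.cos w = 2 * Complex.sin (w / 2) ^ 2 := by
    have := Complex.cos_sq_add_sin_sq (w / 2)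
    have h2 := Complex.cos_two_mul (w / 2)
    rw [mul_div_cancel₀ _ two_ne_zero] at h2
    rw [h2]; linear_combination (-2) * this
  have h2 : ‖w / 2‖ = ‖w‖ / 2 := by simp
  have h3 := norm_sin_le_two_mul (w := w / 2) (by rw [h2]; linarith [norm_nonneg w])
  rw [h1, norm_mul, norm_pow, Complex.norm_ofNat]
  rw [h2] at h3
  nlinarith [norm_nonneg w, norm_nonneg (Complex.sin (w / 2))]

theorem cos_sub_cos_eq (x y : ℂ) : Complex.cos x - Complex.cos y =
    -2 * Complex.sin ((x + y) / 2) * Complex.sin ((x - y) / 2) := Complex.cos_sub_cos x y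

/-- `sin` varies little near a point far from its zeros, relative to its size there. -/
theorem norm_sin_add_sub_sin_le {w x : ℂ} {δ : ℝ} (hδ : δ ≤ 1)
    (h : ∀ k : ℤ, δ ≤ ‖w - Real.pi * k‖) (hx : ‖x‖ ≤ δ / 64) :
    ‖Complex.sin (w + x) - Complex.sin w‖ ≤ ‖Complex.sin w‖ / 2 := by
  have h1 := mul_exp_abs_im_le_norm_sin hδ h
  have hx1 : ‖x‖ ≤ 1 := by linarith
  have h2 : Complex.sin (w + x) - Complex.sin w =
      -(Complex.sin w * (1 - Complex.cos x)) + Complex.cos w * Complex.sin x := by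
    rw [Complex.sin_add]; ring
  have h3 := norm_one_sub_cos_le hx1
  have h4 := norm_sin_le_two_mul hx1
  have h5 := norm_cos_le_exp_abs_im w
  calc _ ≤ ‖Complex.sin w‖ * ‖1 - Complex.cos x‖ + ‖Complex.cos w‖ * ‖Complex.sin x‖ := by
        rw [h2]; refine (norm_add_le _ _).trans ?_
        rw [norm_neg, norm_mul, norm_mul]
    _ ≤ ‖Complex.sin w‖ * (2 * ‖x‖) + Real.exp |w.im| * (2 * ‖x‖) := by gcongr
    _ ≤ ‖Complex.sin w‖ * (1 / 32) + Real.exp |w.im| * (δ / 32) := by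
        gcongr <;> linarith
    _ ≤ ‖Complex.sin w‖ / 2 := by linarith [norm_nonneg (Complex.sin w)]

/-! ### Counting zeros by the maximum principle, in place of Rouché's theorem. -/

/-- An entire function vanishing on a finite set is divisible by the corresponding polynomial. -/
theorem exists_eq_prod_mul_of_forall_eq_zero (s : Finset ℂ) {f : ℂ → ℂ} (hf : Differentiable ℂ f)
    (h : ∀ x ∈ s, f x = 0) :
    ∃ G : ℂ → ℂ, Differentiable ℂ G ∧ ∀ z, f z = (∏ x ∈ s, (z - x)) * G z := by
  classical
  induction s using Finset.induction_on generalizing f with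
  | empty => exact ⟨f, hf, by simp⟩
  | insert a s ha ih =>
    have hfa : f a = 0 := h a (Finset.mem_insert_self _ _)
    have hg : Differentiable ℂ (dslope f a) := by
      rw [← differentiableOn_univ] at hf ⊢
      exact (Complex.differentiableOn_dslope Filter.univ_mem).2 hf
    have hfz : ∀ z, f z = (z - a) * dslope f a z := fun z => by
      have := sub_smul_dslope f a z
      rw [smul_eq_mul, hfa, sub_zero] at this
      exact this.symm
    obtain ⟨G, hG, hGz⟩ := ih hg (fun x hx => by
      have h1 := h x (Finset.mem_insert_of_mem hx)
      rw [hfz] at h1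
      refine (mul_eq_zero.1 h1).resolve_left (sub_ne_zero.2 ?_)
      rintro rfl; exact ha hx)
    refine ⟨G, hG, fun z => ?_⟩
    rw [Finset.prod_insert ha, hfz, hGz]; ring

/-- Without a zero, `1 / f` would violate the maximum principle at the centre. -/
theorem exists_zero_of_lower_bound_on_sphere {f : ℂ → ℂ} (hf : Differentiable ℂ f) {a : ℂ}
    {r m : ℝ} (hr : 0 < r) (hm : 0 < m) (ha : ‖f a‖ < m)
    (hs : ∀ z, ‖z - a‖ = r → m ≤ ‖f z‖) : ∃ z, ‖z - a‖ ≤ r ∧ f z = 0 := by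
  by_contra! hne
  have hcl : closure (Metric.ball a r) = Metric.closedBall a r := closure_ball a hr.ne'
  have hfr : frontier (Metric.ball a r) = Metric.sphere a r := frontier_ball a hr.ne'
  have hd : DiffContOnCl ℂ (fun z => (f z)⁻¹) (Metric.ball a r) := by
    apply DiffContOnCl.inv hf.diffContOnCl
    intro z hz
    rw [hcl, mem_closedBall_iff_norm] at hz
    exact hne z hz
  have := Complex.norm_le_of_forall_mem_frontier_norm_le (C := m⁻¹) Metric.isBounded_ball hd
    (fun z hz => by
      rw [hfr, mem_sphere_iff_norm] at hz
      rw [norm_inv]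
      exact inv_anti₀ hm (hs z hz)) (subset_closure (Metric.mem_ball_self hr))
  rw [norm_inv] at this
  have h0 : 0 < ‖f a‖ := norm_pos_iff.2 (hne a (by simpa using hr.le))
  exact absurd ((inv_le_inv₀ h0 hm).1 this) (not_le.2 ha)

/-- An entire function which is comparable with `|z - a| ^ d` on a disc has at most `d` zeros
close to the centre. -/
theorem card_zeros_le (d : ℕ) : ∃ θ > (0 : ℝ), ∃ ε > (0 : ℝ), ∀ (f : ℂ → ℂ) (a : ℂ) (r S : ℝ),
    Differentiable ℂ f → 0 < r → 0 < S →
    (∀ u, ‖u‖ ≤ r → S * (‖u‖ ^ d / 8 - ε * r ^ d) ≤ ‖f (a + u)‖ ∧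
      ‖f (a + u)‖ ≤ S * (8 * ‖u‖ ^ d + ε * r ^ d)) →
    ∀ s : Finset ℂ, (∀ x ∈ s, f x = 0 ∧ ‖x - a‖ ≤ θ * r) → s.card ≤ d := by
  obtain ⟨θ, hθ0, hθ1, hθ⟩ : ∃ θ : ℝ, 0 < θ ∧ θ ≤ 1 / 2 ∧ 9 * 4 ^ (d + 1) * θ ≤ 1 / 32 := by
    refine ⟨1 / (288 * 4 ^ (d + 1)), by positivity, ?_, ?_⟩
    · rw [div_le_div_iff₀ (by positivity) (by norm_num)]
      have : (1 : ℝ) ≤ 4 ^ (d + 1) := one_le_pow₀ (by norm_num)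
      linarith
    · rw [mul_one_div, div_le_div_iff₀ (by positivity) (by norm_num)]; linarith
  refine ⟨θ, hθ0, θ ^ d / 16, by positivity, ?_⟩
  intro f a r S hf hr hS hb s hs
  -- With `d + 1` zeros in the small disc, divide them out. On the sphere of radius `r` each factor
  -- is at least `r / 2`, which bounds the quotient `G` in the whole disc. At distance `θ r` each
  -- factor is at most `2θr`, so `f` is smaller there than the lower bound by a factor of order `θ`.
  by_contra! hcard
  obtain ⟨t, hts, htc⟩ := Finset.exists_subset_card_eq hcard
  rw [Nat.succ_eq_add_one] at htc
  obtain ⟨G, hG, hGz⟩ := exists_eq_prod_mul_of_forall_eq_zero t hf fun x hx => (hs x (hts hx)).1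
  set ε := θ ^ d / 16 with hε
  have hε1 : ε ≤ 1 := by
    have : θ ^ d ≤ 1 := pow_le_one₀ hθ0.le (by linarith)
    rw [hε]; linarith
  have hθr : θ * r ≤ r / 2 := by nlinarith
  have hGs : ∀ z ∈ Metric.sphere a r, ‖G z‖ ≤ S * 9 * r ^ d / (r / 2) ^ (d + 1) := by
    intro z hz
    rw [mem_sphere_iff_norm] at hz
    have h1 := (hb (z - a) hz.le).2
    rw [add_sub_cancel, hz, hGz, norm_mul, norm_prod] at h1
    have h2 : (r / 2) ^ (d + 1) ≤ ∏ x ∈ t, ‖z - x‖ := by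
      rw [← htc, ← Finset.prod_const]
      apply Finset.prod_le_prod
      · intros; positivity
      · intro x hx
        have h3 := (hs x (hts hx)).2
        have h4 := norm_sub_norm_le (z - a) (x - a)
        rw [hz, sub_sub_sub_cancel_right] at h4
        linarith
    rw [le_div_iff₀ (by positivity)]
    calc ‖G z‖ * (r / 2) ^ (d + 1) ≤ ‖G z‖ * ∏ x ∈ t, ‖z - x‖ := by gcongr
      _ ≤ S * (8 * r ^ d + ε * r ^ d) := by rw [mul_comm]; exact h1
      _ ≤ S * (8 * r ^ d + 1 * r ^ d) := by gcongr
      _ = _ := by ring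
  have hGb : ‖G (a + (θ * r : ℝ))‖ ≤ S * 9 * r ^ d / (r / 2) ^ (d + 1) := by
    refine Complex.norm_le_of_forall_mem_frontier_norm_le (U := Metric.ball a r)
      Metric.isBounded_ball hG.diffContOnCl ?_ ?_
    · rw [frontier_ball a hr.ne']; exact hGs
    · rw [closure_ball a hr.ne', mem_closedBall_iff_norm, add_sub_cancel_left, Complex.norm_real,
        Real.norm_of_nonneg (by positivity)]
      linarith
  have hn : ‖((θ * r : ℝ) : ℂ)‖ = θ * r := by
    rw [Complex.norm_real, Real.norm_of_nonneg (by positivity)]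
  have h1 := (hb ((θ * r : ℝ) : ℂ) (by rw [hn]; linarith)).1
  rw [hn, hGz, norm_mul, norm_prod] at h1
  have h2 : ∏ x ∈ t, ‖a + ((θ * r : ℝ) : ℂ) - x‖ ≤ (2 * (θ * r)) ^ (d + 1) := by
    rw [← htc, ← Finset.prod_const]
    apply Finset.prod_le_prod
    · intros; positivity
    · intro x hx
      have h3 := (hs x (hts hx)).2
      have h4 := norm_sub_le (((θ * r : ℝ) : ℂ)) (x - a)
      rw [hn] at h4
      rw [show a + ((θ * r : ℝ) : ℂ) - x = ((θ * r : ℝ) : ℂ) - (x - a) by ring]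
      linarith
  have h3 : S * ((θ * r) ^ d / 8 - ε * r ^ d) ≤
      (2 * (θ * r)) ^ (d + 1) * (S * 9 * r ^ d / (r / 2) ^ (d + 1)) :=
    h1.trans (mul_le_mul h2 hGb (norm_nonneg _) (by positivity))
  have h4 : (2 * (θ * r)) ^ (d + 1) * (S * 9 * r ^ d / (r / 2) ^ (d + 1)) =
      S * r ^ d * θ ^ d * (9 * 4 ^ (d + 1) * θ) := by
    rw [div_pow, mul_pow, mul_pow, show (4 : ℝ) = 2 * 2 by norm_num, mul_pow 2 2, pow_succ θ]
    field_simp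
  have h5 : S * r ^ d * θ ^ d * (9 * 4 ^ (d + 1) * θ) ≤ S * r ^ d * θ ^ d * (1 / 32) := by gcongr
  have h6 : S * ((θ * r) ^ d / 8 - ε * r ^ d) = S * r ^ d * θ ^ d * (1 / 16) := by
    rw [hε, mul_pow]; ring
  have h7 : 0 < S * r ^ d * θ ^ d := by positivity
  linarith

/-- An entire function which is comparable with `|z - a| ^ d` on a disc has between `1` and `d`
zeros there. -/
theorem exists_zero_and_card_zeros_le {d : ℕ} (hd : d ≠ 0) :
    ∃ ε > (0 : ℝ), ∀ (f : ℂ → ℂ) (a : ℂ) (r S : ℝ),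
    Differentiable ℂ f → 0 < r → 0 < S →
    (∀ u, ‖u‖ ≤ r → S * (‖u‖ ^ d / 8 - ε * r ^ d) ≤ ‖f (a + u)‖ ∧
      ‖f (a + u)‖ ≤ S * (8 * ‖u‖ ^ d + ε * r ^ d)) →
    (∃ x, f x = 0 ∧ ‖x - a‖ ≤ r) ∧
      ∀ s : Finset ℂ, (∀ x ∈ s, f x = 0 ∧ ‖x - a‖ ≤ r) → s.card ≤ d := by
  obtain ⟨θ, hθ, ε, hε, H⟩ := card_zeros_le d
  -- `η ≤ ε` is for the count, `η ≤ θ ^ d / 8` forces every zero of the disc into the disc of radius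
  -- `θ r`, and `η ≤ 1 / 32` makes `f` smaller at the centre than on the sphere.
  obtain ⟨η, hη0, hη1, hη2, hη3⟩ : ∃ η : ℝ, 0 < η ∧ η ≤ ε ∧ η ≤ θ ^ d / 8 ∧ η ≤ 1 / 32 :=
    ⟨min ε (min (θ ^ d / 8) (1 / 32)), by positivity, min_le_left _ _,
      (min_le_right _ _).trans (min_le_left _ _), (min_le_right _ _).trans (min_le_right _ _)⟩
  refine ⟨η, hη0, fun f a r S hf hr hS hb => ⟨?_, fun s hs => ?_⟩⟩
  · have hrd : 0 < S * r ^ d := by positivity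
    obtain ⟨z, hz, hz0⟩ := exists_zero_of_lower_bound_on_sphere hf (a := a) hr
      (m := S * (r ^ d / 8 - η * r ^ d)) (by nlinarith) (by
        have := (hb 0 (by simpa using hr.le)).2
        rw [add_zero, norm_zero, zero_pow hd] at this
        nlinarith) (fun z hz => by
        have := (hb (z - a) hz.le).1
        rwa [add_sub_cancel, hz] at this)
    exact ⟨z, hz0, hz⟩
  · apply H f a r S hf hr hS
    · intro u hu
      have h1 : η * r ^ d ≤ ε * r ^ d := by gcongr
      obtain ⟨h2, h3⟩ := hb u hu
      exact ⟨le_trans (by gcongr) h2, h3.trans (by gcongr)⟩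
    · intro x hx
      obtain ⟨h1, h2⟩ := hs x hx
      refine ⟨h1, ?_⟩
      have h3 := (hb (x - a) h2).1
      rw [add_sub_cancel, h1, norm_zero] at h3
      have h4 : ‖x - a‖ ^ d / 8 - η * r ^ d ≤ 0 := by
        by_contra! h
        nlinarith
      have h5 : η * r ^ d ≤ θ ^ d / 8 * r ^ d := by gcongr
      have h6 : ‖x - a‖ ^ d ≤ (θ * r) ^ d := by rw [mul_pow]; linarith
      exact (pow_le_pow_iff_left₀ (norm_nonneg _) (by positivity) hd).1 h6

/-! ### Local analysis of the roots of `T β = cos τ`. -/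

section Roots

/-- `T` is close to `cos (β - q / β)`. -/
def IsNearCos (T : ℂ → ℂ) (q : ℂ) (C₀ R₀ : ℝ) : Prop :=
  Differentiable ℂ T ∧ 0 ≤ C₀ ∧ 1 ≤ R₀ ∧ ∀ β : ℂ, R₀ ≤ ‖β‖ →
    ‖T β - Complex.cos (β - q / β)‖ ≤ C₀ * Real.exp |β.im| / ‖β‖ ^ 2

variable {T : ℂ → ℂ} {q : ℂ} {C₀ R₀ : ℝ}

theorem exp_abs_im_le_three_mul {x y : ℂ} (h : ‖x - y‖ ≤ 1) :
    Real.exp |x.im| ≤ 3 * Real.exp |y.im| := by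
  have h1 : |x.im| ≤ 1 + |y.im| := by
    have h2 := Complex.abs_im_le_norm (x - y)
    rw [Complex.sub_im] at h2
    have := abs_sub_abs_le_abs_sub x.im y.im
    linarith
  refine (Real.exp_le_exp.2 h1).trans ?_
  rw [Real.exp_add]
  gcongr
  linarith [Real.exp_one_lt_d9]

/-- With `b = β - q / β`, the difference `cos b - cos ζ` is twice a product of sines of `(b ± ζ) /
2` up to sign. If both arguments stay `κ / |β|` away from `πℤ`, the product exceeds the error of
`T`. The exponentials multiply to at least `exp |Im b|`, so the bound is uniform in `ζ`. -/
theorem IsNearCos.exists_near_of_eq_cos (hT : IsNearCos T q C₀ R₀) :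
    ∃ K R : ℝ, 0 < K ∧ ∀ β ζ : ℂ, R ≤ ‖β‖ → T β = Complex.cos ζ →
      ∃ n : ℤ, ‖β - (2 * Real.pi * n + ζ)‖ ≤ K / ‖β‖ ∨ ‖β - (2 * Real.pi * n - ζ)‖ ≤ K / ‖β‖ := by
  obtain ⟨-, hC, hR, h⟩ := hT
  -- The contradiction needs `κ² > 96 C₀`. Here `96 = 8 · 8 · 3 / 2`: two sine bounds, the exchange
  -- of `Im b` for `Im β`, and the factor `2` of the product formula.
  set κ := 96 * C₀ + 1 with hκ
  have hκ1 : 1 ≤ κ := by linarith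
  refine ⟨2 * κ + ‖q‖, R₀ + κ + ‖q‖, by positivity, fun β ζ hβ hTβ => ?_⟩
  have hq0 := norm_nonneg q
  have hβ0 : 0 < ‖β‖ := by linarith
  have hqβ : ‖q / β‖ ≤ 1 := by
    rw [norm_div, div_le_one hβ0]; linarith
  set b := β - q / β with hb
  set δ := κ / ‖β‖ with hδ
  have hδ1 : δ ≤ 1 := by rw [hδ, div_le_one hβ0]; linarith
  have hδ0 : 0 < δ := by positivity
  have key : (∃ n : ℤ, ‖(b - ζ) / 2 - Real.pi * n‖ < δ) ∨
      (∃ n : ℤ, ‖(b + ζ) / 2 - Real.pi * n‖ < δ) := by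
    by_contra! hcon
    have h1 := mul_exp_abs_im_le_norm_sin hδ1 hcon.1
    have h2 := mul_exp_abs_im_le_norm_sin hδ1 hcon.2
    have h3 := h β (by linarith)
    rw [hTβ, norm_sub_rev, cos_sub_cos_eq, norm_mul, norm_mul] at h3
    simp only [norm_neg, Complex.norm_ofNat] at h3
    have h4 := exp_abs_im_le_three_mul (x := β) (y := b) (by rw [hb, sub_sub_cancel]; exact hqβ)
    have h5 : Real.exp |b.im| ≤ Real.exp |((b - ζ) / 2).im| * Real.exp |((b + ζ) / 2).im| := by
      rw [← Real.exp_add]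
      apply Real.exp_le_exp.2
      have : b.im = ((b - ζ) / 2).im + ((b + ζ) / 2).im := by
        rw [← Complex.add_im]; congr 1; ring
      rw [this]; exact abs_add_le _ _
    have h6 : (δ * Real.exp |((b - ζ) / 2).im|) * (δ * Real.exp |((b + ζ) / 2).im|) ≤
        (8 * ‖Complex.sin ((b - ζ) / 2)‖) * (8 * ‖Complex.sin ((b + ζ) / 2)‖) := by gcongr
    have h7 : δ ^ 2 * Real.exp |β.im| ≤ 96 * C₀ * Real.exp |β.im| / ‖β‖ ^ 2 := by
      have : δ ^ 2 * Real.exp |β.im| ≤ δ ^ 2 * (3 * (Real.exp |((b - ζ) / 2).im| *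
        Real.exp |((b + ζ) / 2).im|)) := by gcongr; linarith
      have h8 : 96 * C₀ * Real.exp |β.im| / ‖β‖ ^ 2 = 96 * (C₀ * Real.exp |β.im| / ‖β‖ ^ 2) := by
        ring
      rw [h8]
      nlinarith
    rw [hδ, div_pow, div_mul_eq_mul_div] at h7
    have h8 := (div_le_div_iff_of_pos_right (by positivity : 0 < ‖β‖ ^ 2)).1 h7
    have h9 := le_of_mul_le_mul_right h8 (Real.exp_pos _)
    nlinarith
  have fin : ∀ (n : ℤ) (x : ℂ), ‖x / 2 - Real.pi * n‖ < δ →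
      ‖x + q / β - 2 * Real.pi * n‖ ≤ (2 * κ + ‖q‖) / ‖β‖ := fun n x hx => by
    have : x + q / β - 2 * Real.pi * n = 2 * (x / 2 - Real.pi * n) + q / β := by ring
    rw [this]
    refine (norm_add_le _ _).trans ?_
    rw [norm_mul, Complex.norm_ofNat, norm_div, add_div, mul_div_assoc]
    gcongr
  rcases key with ⟨n, hn⟩ | ⟨n, hn⟩
  · refine ⟨n, Or.inl ?_⟩
    convert fin n _ hn using 2
    rw [hb]; ring
  · refine ⟨n, Or.inr ?_⟩
    convert fin n _ hn using 2
    rw [hb]; ring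

/-- The linear regime. On this disc the sine keeps the size of `sin τ`, so the difference grows like
`|sin τ| |u|`. Moreover `exp |Im τ|` is at most `8 |sin τ| |τ| / K`, which turns the `O(|τ|⁻²)`
error into `|sin τ| O(|τ|⁻¹)`. -/
theorem IsNearCos.bounds_away (hT : IsNearCos T q C₀ R₀) {K : ℝ} (hK1 : 1 ≤ K)
    (hKq : 128 * ‖q‖ ≤ K) {τ : ℂ} (hτ : 2 * R₀ + K + 2 * ‖q‖ + 2 ≤ ‖τ‖)
    (hk : ∀ k : ℤ, K / ‖τ‖ ≤ ‖τ - Real.pi * k‖) {u : ℂ} (hu : ‖u‖ ≤ K / ‖τ‖ / 64) :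
    ‖Complex.sin τ‖ * (‖u‖ / 4 - (6 * ‖q‖ + 96 * C₀) / ‖τ‖) ≤ ‖T (τ + u) - Complex.cos τ‖ ∧
      ‖T (τ + u) - Complex.cos τ‖ ≤
        ‖Complex.sin τ‖ * (3 * ‖u‖ + (6 * ‖q‖ + 96 * C₀) / ‖τ‖) := by
  obtain ⟨hd, hC, hR, h⟩ := hT
  have hq0 := norm_nonneg q
  set A := 6 * ‖q‖ + 96 * C₀ with hA
  have hK0 : 0 < K := by linarith
  have hτ0 : 0 < ‖τ‖ := by linarith
  set δ := K / ‖τ‖ with hδ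
  have hδ0 : 0 < δ := by positivity
  have hδ1 : δ ≤ 1 := by rw [hδ, div_le_one hτ0]; linarith
  set S := ‖Complex.sin τ‖ with hS
  have hSe := mul_exp_abs_im_le_norm_sin hδ1 hk
  have hS0 : 0 ≤ S := norm_nonneg _
  set β := τ + u with hβ
  have hβτ : ‖β - τ‖ ≤ 1 := by rw [hβ, add_sub_cancel_left]; linarith
  have hβn : ‖τ‖ / 2 ≤ ‖β‖ := by
    have := norm_sub_norm_le τ β
    rw [norm_sub_rev] at this; linarith
  have hβ0 : 0 < ‖β‖ := by linarith
  have hqβ : ‖q / β‖ ≤ 2 * ‖q‖ / ‖τ‖ := by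
    rw [norm_div, div_le_div_iff₀ hβ0 hτ0]; nlinarith
  have hqδ : 2 * ‖q‖ / ‖τ‖ ≤ δ / 64 := by
    rw [hδ, div_right_comm]; gcongr; linarith
  set x := (β - q / β - τ) / 2 with hx
  have hx2 : 2 * x = u - q / β := by rw [hx, hβ]; ring
  have hx2n : 2 * ‖x‖ = ‖u - q / β‖ := by rw [← hx2, norm_mul, Complex.norm_ofNat]
  have hxu : 2 * ‖x‖ ≤ ‖u‖ + 2 * ‖q‖ / ‖τ‖ := by
    rw [hx2n]; exact (norm_sub_le _ _).trans (by gcongr)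
  have hxl : ‖u‖ - 2 * ‖q‖ / ‖τ‖ ≤ 2 * ‖x‖ := by
    rw [hx2n]; exact le_trans (by gcongr) (norm_sub_norm_le _ _)
  have hx64 : ‖x‖ ≤ δ / 64 := by linarith
  have hx1 : ‖x‖ ≤ 1 := by linarith
  have h1 := norm_sin_add_sub_sin_le hδ1 hk hx64
  have h2 : S / 2 ≤ ‖Complex.sin (τ + x)‖ := by
    have := norm_sub_norm_le (Complex.sin τ) (Complex.sin (τ + x))
    rw [norm_sub_rev] at this; linarith
  have h3 : ‖Complex.sin (τ + x)‖ ≤ 3 / 2 * S := by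
    have := norm_sub_norm_le (Complex.sin (τ + x)) (Complex.sin τ)
    linarith
  have h4 := norm_sin_le_two_mul hx1
  have h5 := norm_le_two_mul_norm_sin_of_norm_le_one hx1
  have h6 : ‖Complex.cos (β - q / β) - Complex.cos τ‖ =
      2 * (‖Complex.sin (τ + x)‖ * ‖Complex.sin x‖) := by
    rw [cos_sub_cos_eq, show (β - q / β + τ) / 2 = τ + x by rw [hx]; ring, ← hx, norm_mul,
      norm_mul, norm_neg, Complex.norm_ofNat, mul_assoc]
  have h7 : ‖T β - Complex.cos (β - q / β)‖ ≤ S * (96 * C₀ / ‖τ‖) := by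
    refine (h β (by linarith)).trans ?_
    have h8 := exp_abs_im_le_three_mul hβτ
    have h9 : (‖τ‖ / 2) ^ 2 ≤ ‖β‖ ^ 2 := by gcongr
    have h10 : Real.exp |τ.im| ≤ 8 * S * ‖τ‖ / K := by
      rw [le_div_iff₀ hK0]
      rw [hδ, div_mul_eq_mul_div, div_le_iff₀ hτ0] at hSe
      linarith
    have h11 : 8 * S * ‖τ‖ / K ≤ 8 * S * ‖τ‖ := div_le_self (by positivity) hK1
    calc C₀ * Real.exp |β.im| / ‖β‖ ^ 2 ≤ C₀ * (3 * (8 * S * ‖τ‖)) / (‖τ‖ / 2) ^ 2 := by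
          gcongr; linarith
      _ = S * (96 * C₀ / ‖τ‖) := by field_simp; ring
  have hAτ : A / ‖τ‖ = 3 * (2 * ‖q‖ / ‖τ‖) + 96 * C₀ / ‖τ‖ := by rw [hA]; field_simp; ring
  have h12 : S * ‖x‖ / 2 ≤ 2 * (‖Complex.sin (τ + x)‖ * ‖Complex.sin x‖) := by
    have : S / 2 * (‖x‖ / 2) ≤ ‖Complex.sin (τ + x)‖ * ‖Complex.sin x‖ := by
      gcongr; linarith
    linarith
  have h13 : 2 * (‖Complex.sin (τ + x)‖ * ‖Complex.sin x‖) ≤ 6 * (S * ‖x‖) := by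
    have : ‖Complex.sin (τ + x)‖ * ‖Complex.sin x‖ ≤ 3 / 2 * S * (2 * ‖x‖) := by gcongr
    linarith
  have hqp : 0 ≤ 2 * ‖q‖ / ‖τ‖ := by positivity
  have hSq : 0 ≤ S * (2 * ‖q‖ / ‖τ‖) := by positivity
  rw [hAτ]
  constructor
  · have := norm_sub_norm_le (Complex.cos (β - q / β) - Complex.cos τ)
      (Complex.cos (β - q / β) - T β)
    rw [sub_sub_sub_cancel_left, norm_sub_rev _ (T β), h6] at this
    have h14 := mul_le_mul_of_nonneg_left hxl hS0
    rw [mul_sub] at h14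
    rw [mul_sub, mul_add]
    linarith
  · have := norm_add_le (T β - Complex.cos (β - q / β)) (Complex.cos (β - q / β) - Complex.cos τ)
    rw [sub_add_sub_cancel, h6] at this
    have h14 := mul_le_mul_of_nonneg_left hxu hS0
    rw [mul_add] at h14
    rw [mul_add, mul_add]
    linarith

/-- Existence and uniqueness of the root near a target that is not close to `πℤ`. -/
theorem IsNearCos.exists_unique_root (hT : IsNearCos T q C₀ R₀) :
    ∃ K₀ : ℝ, ∀ K ≥ K₀, ∃ C R : ℝ, ∀ τ : ℂ, R ≤ ‖τ‖ →
      (∀ k : ℤ, K / ‖τ‖ ≤ ‖τ - Real.pi * k‖) →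
      ∃ β, T β = Complex.cos τ ∧ ‖β - τ‖ ≤ C / ‖τ‖ ∧
        ∀ β', T β' = Complex.cos τ → ‖β' - τ‖ ≤ K / ‖τ‖ / 64 → β' = β := by
  obtain ⟨hd, hC, hR, h⟩ := hT
  obtain ⟨ε, hε, H⟩ := exists_zero_and_card_zeros_le one_ne_zero
  have hq0 := norm_nonneg q
  set A := 6 * ‖q‖ + 96 * C₀ with hA
  have hA0 : 0 ≤ A := by positivity
  -- `64 A / ε` makes the error `A / |τ|` at most `ε r` on the disc of radius `r = K / (64 |τ|)`;
  -- `128 ‖q‖` keeps the shift `q / β` within the same radius.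
  refine ⟨1 + 128 * ‖q‖ + 64 * A / ε, fun K hK => ⟨8 * A, 2 * R₀ + K + 2 * ‖q‖ + 2,
    fun τ hτ hk => ?_⟩⟩
  have hAε : 0 ≤ 64 * A / ε := by positivity
  have hK1 : 1 ≤ K := by linarith
  have hK0 : 0 < K := by linarith
  have hτ0 : 0 < ‖τ‖ := by linarith
  set δ := K / ‖τ‖ with hδ
  have hδ0 : 0 < δ := by positivity
  have hδ1 : δ ≤ 1 := by rw [hδ, div_le_one hτ0]; linarith
  set S := ‖Complex.sin τ‖ with hS
  have hSe := mul_exp_abs_im_le_norm_sin hδ1 hk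
  have hS0 : 0 < S := by
    have := mul_pos hδ0 (Real.exp_pos |τ.im|)
    linarith
  set r := δ / 64 with hr
  have hr0 : 0 < r := by positivity
  have hbound : ∀ u, ‖u‖ ≤ r → S * (‖u‖ / 4 - A / ‖τ‖) ≤ ‖T (τ + u) - Complex.cos τ‖ ∧
      ‖T (τ + u) - Complex.cos τ‖ ≤ S * (3 * ‖u‖ + A / ‖τ‖) := fun u hu =>
    IsNearCos.bounds_away ⟨hd, hC, hR, h⟩ hK1 (by linarith) hτ hk hu
  have hAr : A / ‖τ‖ ≤ ε * r := by
    rw [hr, hδ, div_div, ← mul_div_assoc, div_le_div_iff₀ hτ0 (by positivity)]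
    have : 64 * A ≤ ε * K := by
      have := (div_le_iff₀ hε).1 (show 64 * A / ε ≤ K by linarith)
      linarith
    nlinarith
  obtain ⟨⟨β, hβ0, hβr⟩, hcard⟩ := H (fun z => T z - Complex.cos τ) τ r S
    (hd.sub_const _) hr0 hS0 (fun u hu => by
      obtain ⟨h1, h2⟩ := hbound u hu
      simp only [pow_one]
      have := norm_nonneg u
      exact ⟨le_trans (by gcongr; linarith) h1, h2.trans (by gcongr; linarith)⟩)
  refine ⟨β, sub_eq_zero.1 hβ0, ?_, fun β' h1 h2 => ?_⟩
  · have h1 := (hbound (β - τ) hβr).1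
    rw [add_sub_cancel, hβ0, norm_zero] at h1
    have h4 : ‖β - τ‖ / 4 - A / ‖τ‖ ≤ 0 := by
      by_contra! h
      nlinarith
    rw [mul_div_assoc]
    have : 0 ≤ A / ‖τ‖ := by positivity
    linarith
  · by_contra hne
    have := hcard {β', β} (by
      intro x hx
      simp only [Finset.mem_insert, Finset.mem_singleton] at hx
      rcases hx with rfl | rfl
      · exact ⟨sub_eq_zero.2 h1, h2⟩
      · exact ⟨hβ0, hβr⟩)
    rw [Finset.card_pair hne] at this
    omega

/-- The quadratic regime: `πk` is a critical point of the cosine, and both sines in the product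
formula have small arguments modulo `π`. The difference therefore behaves like `|u|²`, up to
`O(k⁻²)`. -/
theorem IsNearCos.bounds_near_pi (hT : IsNearCos T q C₀ R₀) {K : ℝ} {k : ℤ} {τ : ℂ}
    (hk : R₀ + 2 * (|K| + ‖q‖) ≤ |(k : ℝ)|) (hτ : ‖τ - Real.pi * k‖ ≤ K / |(k : ℝ)|)
    {u : ℂ} (hu : ‖u‖ ≤ 1 / 2) :
    1 / 2 * (‖u‖ ^ 2 / 8 - (8 * (|K| + ‖q‖) ^ 2 + 12 * C₀) / |(k : ℝ)| ^ 2) ≤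
        ‖T (Real.pi * k + u) - Complex.cos τ‖ ∧
      ‖T (Real.pi * k + u) - Complex.cos τ‖ ≤
        1 / 2 * (8 * ‖u‖ ^ 2 + (8 * (|K| + ‖q‖) ^ 2 + 12 * C₀) / |(k : ℝ)| ^ 2) := by
  obtain ⟨hd, hC, hR, h⟩ := hT
  have hq0 := norm_nonneg q
  set E := |K| + ‖q‖ with hE
  have hE0 : 0 ≤ E := by positivity
  set A := 8 * E ^ 2 + 12 * C₀ with hA
  set κ := |(k : ℝ)| with hκ
  have hκ1 : 1 ≤ κ := by linarith
  have hκ0 : 0 < κ := by linarith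
  set β := Real.pi * k + u with hβ
  have hβn : κ ≤ ‖β‖ := by
    have h1 := norm_sub_norm_le (Real.pi * k : ℂ) (-u)
    rw [sub_neg_eq_add, norm_neg, norm_mul, Complex.norm_real, Complex.norm_intCast,
      Real.norm_of_nonneg Real.pi_pos.le] at h1
    nlinarith [Real.pi_gt_three]
  have hβ0 : 0 < ‖β‖ := by linarith
  set z := τ - Real.pi * k with hz
  set w := q / β with hw
  have hwn : ‖w‖ ≤ ‖q‖ / κ := by rw [hw, norm_div]; gcongr
  have hzn : ‖z‖ ≤ |K| / κ := hτ.trans (by gcongr; exact le_abs_self K)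
  set x := (u - z - w) / 2 with hx
  set y := (u + z - w) / 2 with hy
  set η := E / κ with hη
  have hη0 : 0 ≤ η := by positivity
  have hη1 : η ≤ 1 / 2 := by rw [hη, div_le_iff₀ hκ0]; linarith
  have hηs : η = |K| / κ + ‖q‖ / κ := by rw [hη, hE, add_div]
  have hx2 : 2 * ‖x‖ = ‖u - (z + w)‖ := by
    rw [show u - (z + w) = 2 * x by rw [hx]; ring, norm_mul, Complex.norm_ofNat]
  have hy2 : 2 * ‖y‖ = ‖u - (w - z)‖ := by
    rw [show u - (w - z) = 2 * y by rw [hy]; ring, norm_mul, Complex.norm_ofNat]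
  have hzw : ‖z + w‖ ≤ η := (norm_add_le _ _).trans (by linarith)
  have hwz : ‖w - z‖ ≤ η := (norm_sub_le _ _).trans (by linarith)
  have hxu : 2 * ‖x‖ ≤ ‖u‖ + η := by rw [hx2]; exact (norm_sub_le _ _).trans (by gcongr)
  have hyu : 2 * ‖y‖ ≤ ‖u‖ + η := by rw [hy2]; exact (norm_sub_le _ _).trans (by gcongr)
  have hxl : ‖u‖ - η ≤ 2 * ‖x‖ := by rw [hx2]; exact le_trans (by gcongr) (norm_sub_norm_le _ _)
  have hyl : ‖u‖ - η ≤ 2 * ‖y‖ := by rw [hy2]; exact le_trans (by gcongr) (norm_sub_norm_le _ _)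
  have hx1 : ‖x‖ ≤ 1 := by linarith
  have hy1 : ‖y‖ ≤ 1 := by linarith
  have h1 := norm_sin_le_two_mul hx1
  have h2 := norm_sin_le_two_mul hy1
  have h3 := norm_le_two_mul_norm_sin_of_norm_le_one hx1
  have h4 := norm_le_two_mul_norm_sin_of_norm_le_one hy1
  have h6 : ‖Complex.cos (β - w) - Complex.cos τ‖ =
      2 * (‖Complex.sin y‖ * ‖Complex.sin x‖) := by
    rw [cos_sub_cos_eq, norm_mul, norm_mul, ← norm_sin_sub_int_mul_pi ((β - w + τ) / 2) k,
      show (β - w + τ) / 2 - Real.pi * k = y by rw [hy, hz, hβ]; ring,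
      show (β - w - τ) / 2 = x by rw [hx, hz, hβ]; ring, norm_neg, Complex.norm_ofNat, mul_assoc]
  have h7 : ‖T β - Complex.cos (β - w)‖ ≤ 6 * C₀ / κ ^ 2 := by
    refine (h β (by linarith)).trans ?_
    have h8 : Real.exp |β.im| ≤ 3 * Real.exp |((Real.pi * k : ℝ) : ℂ).im| := by
      apply exp_abs_im_le_three_mul
      rw [hβ]
      push_cast
      rw [add_sub_cancel_left]
      linarith
    rw [Complex.ofReal_im, abs_zero, Real.exp_zero] at h8
    have : C₀ * Real.exp |β.im| ≤ 6 * C₀ := by nlinarith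
    gcongr
  have hAκ : A / κ ^ 2 = 8 * η ^ 2 + 12 * C₀ / κ ^ 2 := by rw [hA, hη]; field_simp
  have h12 : (2 * ‖y‖) * (2 * ‖x‖) ≤ 8 * (2 * (‖Complex.sin y‖ * ‖Complex.sin x‖)) := by
    have : ‖y‖ * ‖x‖ ≤ (2 * ‖Complex.sin y‖) * (2 * ‖Complex.sin x‖) := by gcongr
    linarith
  have h13 : 2 * (‖Complex.sin y‖ * ‖Complex.sin x‖) ≤ 2 * ((2 * ‖y‖) * (2 * ‖x‖)) := by
    have : ‖Complex.sin y‖ * ‖Complex.sin x‖ ≤ (2 * ‖y‖) * (2 * ‖x‖) := by gcongr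
    linarith
  have h14 : ‖u‖ ^ 2 / 2 - η ^ 2 ≤ (2 * ‖y‖) * (2 * ‖x‖) := by
    rcases le_total ‖u‖ η with hle | hle
    · have h1 : ‖u‖ ^ 2 ≤ η ^ 2 := by gcongr
      have h0 : 0 ≤ (2 * ‖y‖) * (2 * ‖x‖) := by positivity
      linarith [sq_nonneg ‖u‖]
    · have h1 : (‖u‖ - η) * (‖u‖ - η) ≤ (2 * ‖y‖) * (2 * ‖x‖) :=
        mul_le_mul hyl hxl (by linarith) (by positivity)
      refine le_trans ?_ h1
      have h2 := sq_nonneg (‖u‖ - 2 * η)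
      ring_nf at h2 ⊢
      linarith
  have h15 : (2 * ‖y‖) * (2 * ‖x‖) ≤ 2 * ‖u‖ ^ 2 + 2 * η ^ 2 := by
    have h1 : (2 * ‖y‖) * (2 * ‖x‖) ≤ (‖u‖ + η) * (‖u‖ + η) := by gcongr
    refine h1.trans ?_
    have h2 := sq_nonneg (‖u‖ - η)
    ring_nf at h2 ⊢
    linarith
  have h16 : 12 * C₀ / κ ^ 2 = 2 * (6 * C₀ / κ ^ 2) := by ring
  rw [hAκ]
  constructor
  · have := norm_sub_norm_le (Complex.cos (β - w) - Complex.cos τ) (Complex.cos (β - w) - T β)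
    rw [sub_sub_sub_cancel_left, norm_sub_rev _ (T β), h6] at this
    linarith [sq_nonneg η]
  · have := norm_add_le (T β - Complex.cos (β - w)) (Complex.cos (β - w) - Complex.cos τ)
    rw [sub_add_sub_cancel, h6] at this
    linarith [sq_nonneg ‖u‖]

/-- The two roots near a target close to `πℤ`. -/
theorem IsNearCos.exists_root_pair (hT : IsNearCos T q C₀ R₀) (K : ℝ) :
    ∃ C k₀ : ℝ, 0 ≤ C ∧ ∀ (k : ℤ) (τ : ℂ), k₀ ≤ |(k : ℝ)| →
      ‖τ - Real.pi * k‖ ≤ K / |(k : ℝ)| →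
      ∃ r₁ r₂ : ℂ, (T r₁ = Complex.cos τ ∧ ‖r₁ - Real.pi * k‖ ≤ C / |(k : ℝ)|) ∧
        (T r₂ = Complex.cos τ ∧ ‖r₂ - Real.pi * k‖ ≤ C / |(k : ℝ)|) ∧
        ∀ β, T β = Complex.cos τ → ‖β - Real.pi * k‖ ≤ 1 / 2 → β = r₁ ∨ β = r₂ := by
  obtain ⟨hd, hC, hR, h⟩ := hT
  obtain ⟨ε, hε, H⟩ := exists_zero_and_card_zeros_le two_ne_zero
  have hq0 := norm_nonneg q
  set E := |K| + ‖q‖ with hE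
  have hE0 : 0 ≤ E := by positivity
  set A := 8 * E ^ 2 + 12 * C₀ with hA
  have hA0 : 0 ≤ A := by positivity
  refine ⟨8 * A + 1, R₀ + 4 * A / ε + 2 * E, by positivity, fun k τ hk hτ => ?_⟩
  have hAε : 0 ≤ 4 * A / ε := by positivity
  set κ := |(k : ℝ)| with hκ
  have hκ1 : 1 ≤ κ := by linarith
  have hκ0 : 0 < κ := by linarith
  have hbound : ∀ u, ‖u‖ ≤ 1 / 2 →
      1 / 2 * (‖u‖ ^ 2 / 8 - A / κ ^ 2) ≤ ‖T (Real.pi * k + u) - Complex.cos τ‖ ∧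
      ‖T (Real.pi * k + u) - Complex.cos τ‖ ≤ 1 / 2 * (8 * ‖u‖ ^ 2 + A / κ ^ 2) := fun u hu =>
    IsNearCos.bounds_near_pi ⟨hd, hC, hR, h⟩ (by linarith) hτ hu
  have hAκ : A / κ ^ 2 ≤ ε * (1 / 2) ^ 2 := by
    have h1 : 4 * A / ε ≤ κ := by linarith
    rw [div_le_iff₀ hε] at h1
    rw [div_le_iff₀ (by positivity)]
    nlinarith
  obtain ⟨⟨r₁, hr₁, hr₁n⟩, hcard⟩ := H (fun z => T z - Complex.cos τ) (Real.pi * k) (1 / 2) (1 / 2)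
    (hd.sub_const _) (by norm_num) (by norm_num) (fun u hu => by
      obtain ⟨h1, h2⟩ := hbound u hu
      exact ⟨le_trans (by gcongr) h1, h2.trans (by gcongr)⟩)
  have hloc : ∀ β, T β - Complex.cos τ = 0 → ‖β - Real.pi * k‖ ≤ 1 / 2 →
      ‖β - Real.pi * k‖ ≤ (8 * A + 1) / κ := fun β h1 h2 => by
    have h3 := (hbound _ h2).1
    rw [add_sub_cancel, h1, norm_zero] at h3
    have h4 : ‖β - Real.pi * k‖ ^ 2 ≤ ((8 * A + 1) / κ) ^ 2 := by
      have h5 : 8 * (A / κ ^ 2) ≤ ((8 * A + 1) / κ) ^ 2 := by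
        rw [div_pow, ← mul_div_assoc]; gcongr; nlinarith
      linarith
    exact (pow_le_pow_iff_left₀ (norm_nonneg _) (by positivity) two_ne_zero).1 h4
  -- The count concerns distinct zeros, so if there is no second one `r₁` is listed twice.
  by_cases hex : ∃ r₂, r₂ ≠ r₁ ∧ T r₂ - Complex.cos τ = 0 ∧ ‖r₂ - Real.pi * k‖ ≤ 1 / 2
  · obtain ⟨r₂, hne, hr₂, hr₂n⟩ := hex
    refine ⟨r₁, r₂, ⟨sub_eq_zero.1 hr₁, hloc _ hr₁ hr₁n⟩, ⟨sub_eq_zero.1 hr₂, hloc _ hr₂ hr₂n⟩,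
      fun β h1 h2 => ?_⟩
    by_contra! hcon
    have := hcard {β, r₁, r₂} (by
      intro x hx
      simp only [Finset.mem_insert, Finset.mem_singleton] at hx
      rcases hx with rfl | rfl | rfl
      · exact ⟨sub_eq_zero.2 h1, h2⟩
      · exact ⟨hr₁, hr₁n⟩
      · exact ⟨hr₂, hr₂n⟩)
    rw [Finset.card_insert_of_notMem (by simp [hcon.1, hcon.2]), Finset.card_pair hne.symm] at this
    omega
  · push Not at hex
    refine ⟨r₁, r₁, ⟨sub_eq_zero.1 hr₁, hloc _ hr₁ hr₁n⟩, ⟨sub_eq_zero.1 hr₁, hloc _ hr₁ hr₁n⟩,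
      fun β h1 h2 => ?_⟩
    by_contra! hcon
    exact absurd h2 (not_le.2 (hex β hcon.1 (sub_eq_zero.2 h1)))

end Roots

/-! ### Global labelling of the roots by targets. -/

/-- A target near `πk` and its mirror `2πk - τ` have the same cosine and compete for the same roots.
The Boolean, exchanged under mirroring, ensures that each of the two is the label of one of them.
Away from `πℤ` both Booleans give the unique root. -/
theorem exists_cos_root_labels {T : ℂ → ℂ} {q : ℂ} {C₀ R₀ : ℝ} (hT : IsNearCos T q C₀ R₀)
    {K₁ : ℝ} (hK₁ : 0 < K₁) :
    ∃ (C R : ℝ) (L : Bool → ℂ → ℂ),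
      (∀ b τ, ‖L b τ - τ‖ ≤ C / (1 + ‖L b τ‖)) ∧
      (∀ b τ, R ≤ ‖L b τ‖ → T (L b τ) = Complex.cos τ) ∧
      ∀ b β τ, R ≤ ‖β‖ → T β = Complex.cos τ → ‖β - τ‖ ≤ K₁ / ‖β‖ →
        β = L b τ ∨ ∃ k : ℤ, β = L (!b) (2 * Real.pi * k - τ) := by
  classical
  obtain ⟨K₀, hA⟩ := hT.exists_unique_root
  set K := |K₀| + 256 * K₁ + 1 with hK
  have hKpos : 0 < K := by positivity
  obtain ⟨CA, RA, hA⟩ := hA K (by have := le_abs_self K₀; rw [ge_iff_le, hK]; linarith)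
  obtain ⟨CB, kB, hCB, hB⟩ := hT.exists_root_pair K
  set k₀ := |kB| + 4 * K + 4 with hk₀
  have hk₀4 : 4 ≤ k₀ := by have := abs_nonneg kB; rw [hk₀]; linarith
  have hk₀B : kB ≤ k₀ := by have := le_abs_self kB; rw [hk₀]; linarith
  have hk₀K : 4 * K ≤ k₀ := by have := abs_nonneg kB; rw [hk₀]; linarith
  set R₁ := |RA| + 4 * k₀ + K + 1 with hR₁
  have hR₁A : RA ≤ R₁ := by have := le_abs_self RA; rw [hR₁]; linarith
  have hR₁k : 4 * k₀ + K + 1 ≤ R₁ := by have := abs_nonneg RA; rw [hR₁]; linarith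
  let near : ℤ → ℂ → Prop := fun k τ => k₀ ≤ |(k : ℝ)| ∧ ‖τ - Real.pi * k‖ ≤ K / |(k : ℝ)|
  have hnear4 : ∀ {k τ}, near k τ → ‖τ - Real.pi * k‖ ≤ 1 / 4 := fun {k τ} h => by
    refine h.2.trans ?_
    rw [div_le_div_iff₀ (by linarith [h.1]) (by norm_num)]
    linarith [h.1]
  have huniq : ∀ {k k' τ}, near k τ → near k' τ → k = k' := fun {k k' τ} h h' => by
    have h1 := hnear4 h
    have h2 := hnear4 h'
    have h3 : ‖((Real.pi * (k - k' : ℤ) : ℝ) : ℂ)‖ ≤ 1 / 2 := by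
      have := norm_sub_le (τ - Real.pi * k') (τ - Real.pi * k)
      rw [sub_sub_sub_cancel_left] at this
      push_cast
      rw [mul_sub]
      linarith
    rw [Complex.norm_real, norm_mul, Real.norm_of_nonneg Real.pi_pos.le, Real.norm_eq_abs,
      ← Int.cast_abs] at h3
    by_contra hne
    have h4 : (1 : ℝ) ≤ (|k - k'| : ℤ) := by
      exact_mod_cast Int.one_le_abs (sub_ne_zero.2 hne)
    nlinarith [Real.pi_gt_three]
  have hmirror : ∀ {k τ}, near k τ → near k (2 * Real.pi * k - τ) := fun {k τ} h => by
    refine ⟨h.1, ?_⟩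
    rw [show (2 * Real.pi * k - τ - Real.pi * k : ℂ) = -(τ - Real.pi * k) by ring, norm_neg]
    exact h.2
  have hcosm : ∀ (k : ℤ) (τ : ℂ), Complex.cos (2 * Real.pi * k - τ) = Complex.cos τ := by
    intro k τ
    rw [show (2 * Real.pi * k - τ : ℂ) = k * (2 * Real.pi) - τ by ring,
      Complex.cos_int_mul_two_pi_sub]
  -- The pair is chosen from `k` and the value `v = cos τ` alone, so a target and its mirror draw
  -- from the same ordered pair.
  have hr : ∀ (k : ℤ) (v : ℂ), ∃ r : Bool → ℂ, ∀ τ, Complex.cos τ = v → near k τ →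
      (∀ b, T (r b) = v ∧ ‖r b - Real.pi * k‖ ≤ CB / |(k : ℝ)|) ∧
      ∀ β, T β = v → ‖β - Real.pi * k‖ ≤ 1 / 2 → ∀ b, β = r b ∨ β = r (!b) := by
    intro k v
    by_cases hex : ∃ τ, Complex.cos τ = v ∧ near k τ
    · obtain ⟨τ, rfl, hτ⟩ := hex
      obtain ⟨r₁, r₂, h1, h2, h3⟩ := hB k τ (hk₀B.trans hτ.1) hτ.2
      refine ⟨fun b => if b then r₁ else r₂, fun τ' _ _ => ⟨?_, fun β hβ hβk => ?_⟩⟩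
      · rintro (_ | _)
        · exact h2
        · exact h1
      · rintro (_ | _)
        · exact (h3 β hβ hβk).symm
        · exact h3 β hβ hβk
    · exact ⟨fun _ => 0, fun τ h1 h2 => absurd ⟨τ, h1, h2⟩ hex⟩
  choose r hr using hr
  have hρ : ∀ τ : ℂ, ∃ ρ : ℂ, R₁ ≤ ‖τ‖ → (¬ ∃ k, near k τ) → T ρ = Complex.cos τ ∧
      ‖ρ - τ‖ ≤ CA / ‖τ‖ ∧
        ∀ β', T β' = Complex.cos τ → ‖β' - τ‖ ≤ K / ‖τ‖ / 64 → β' = ρ := by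
    intro τ
    by_cases h : R₁ ≤ ‖τ‖ ∧ ¬ ∃ k, near k τ
    · obtain ⟨ρ, hρ⟩ := hA τ (hR₁A.trans h.1) (fun k => by
        have hτ0 : 0 < ‖τ‖ := by linarith [h.1]
        have hK1 : K / ‖τ‖ ≤ 1 := by rw [div_le_one hτ0]; linarith [h.1]
        have hkn : ‖(Real.pi * k : ℂ)‖ = Real.pi * |(k : ℝ)| := by
          rw [norm_mul, Complex.norm_real, Complex.norm_intCast,
            Real.norm_of_nonneg Real.pi_pos.le]
        have h1 := norm_sub_norm_le τ (Real.pi * k)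
        have h2 := norm_sub_norm_le (Real.pi * k : ℂ) τ
        rw [norm_sub_rev] at h2
        rw [hkn] at h1 h2
        have hk0 := abs_nonneg (k : ℝ)
        by_contra! hcon
        by_cases hk : k₀ ≤ |(k : ℝ)|
        · refine h.2 ⟨k, hk, hcon.le.trans ?_⟩
          have h3 : 3 * |(k : ℝ)| ≤ Real.pi * |(k : ℝ)| := by
            gcongr; exact Real.pi_gt_three.le
          exact div_le_div_of_nonneg_left hKpos.le (by linarith) (by linarith)
        · push Not at hk
          nlinarith [h.1, Real.pi_le_four])
      exact ⟨ρ, fun _ _ => hρ⟩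
    · exact ⟨0, fun h1 h2 => absurd ⟨h1, h2⟩ h⟩
  choose ρ hρ using hρ
  -- Small targets not near `πℤ` label themselves: the distance is then zero, and the root property
  -- is required only of large labels.
  let L : Bool → ℂ → ℂ := fun b τ =>
    if h : ∃ k, near k τ then r h.choose (Complex.cos τ) b
    else if R₁ ≤ ‖τ‖ then ρ τ else τ
  have hLnear : ∀ b {k τ}, near k τ → L b τ = r k (Complex.cos τ) b := fun b {k τ} h => by
    have hex : ∃ k, near k τ := ⟨k, h⟩
    have : hex.choose = k := huniq hex.choose_spec h
    simp only [L, dif_pos hex, this]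
  have hLfar : ∀ b {τ}, (¬ ∃ k, near k τ) → R₁ ≤ ‖τ‖ → L b τ = ρ τ := fun b {τ} h h' => by
    simp only [L, dif_neg h, if_pos h']
  have hLtriv : ∀ b {τ}, (¬ ∃ k, near k τ) → ¬ R₁ ≤ ‖τ‖ → L b τ = τ := fun b {τ} h h' => by
    simp only [L, dif_neg h, if_neg h']
  refine ⟨(6 + CB) * (CB + K) + |CA| * (2 + |CA|), R₁ + 4 * K₁ + 1, L, ?_, ?_, ?_⟩
  · intro b τ
    rw [le_div_iff₀ (by positivity)]
    by_cases h : ∃ k, near k τ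
    · obtain ⟨k, hk⟩ := h
      rw [hLnear b hk]
      obtain ⟨-, h2⟩ := (hr k _ τ rfl hk).1 b
      set x := r k (Complex.cos τ) b
      have hk1 := hk.1
      have hk0 : 0 < |(k : ℝ)| := by linarith
      have h3 : ‖x - τ‖ ≤ (CB + K) / |(k : ℝ)| := by
        have := norm_sub_le (x - Real.pi * k) (τ - Real.pi * k)
        rw [sub_sub_sub_cancel_right] at this
        rw [add_div]
        linarith [hk.2]
      have h4 : 1 + ‖x‖ ≤ (6 + CB) * |(k : ℝ)| := by
        have h5 := norm_sub_norm_le x (Real.pi * k)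
        rw [norm_mul, Complex.norm_real, Complex.norm_intCast,
            Real.norm_of_nonneg Real.pi_pos.le] at h5
        have h6 : CB / |(k : ℝ)| ≤ CB := div_le_self hCB (by linarith)
        nlinarith [Real.pi_le_four]
      calc ‖x - τ‖ * (1 + ‖x‖) ≤ (CB + K) / |(k : ℝ)| * ((6 + CB) * |(k : ℝ)|) := by gcongr
        _ = (6 + CB) * (CB + K) := by field_simp
        _ ≤ _ := le_add_of_nonneg_right (by positivity)
    · by_cases h' : R₁ ≤ ‖τ‖
      · rw [hLfar b h h']
        obtain ⟨-, h2, -⟩ := hρ τ h' h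
        have hτ1 : 1 ≤ ‖τ‖ := by linarith
        have h3 : ‖ρ τ - τ‖ ≤ |CA| / ‖τ‖ := h2.trans (by gcongr; exact le_abs_self _)
        have h4 : 1 + ‖ρ τ‖ ≤ (2 + |CA|) * ‖τ‖ := by
          have h5 := norm_sub_norm_le (ρ τ) τ
          have h6 : |CA| / ‖τ‖ ≤ |CA| := div_le_self (abs_nonneg _) hτ1
          nlinarith [abs_nonneg CA]
        calc ‖ρ τ - τ‖ * (1 + ‖ρ τ‖) ≤ |CA| / ‖τ‖ * ((2 + |CA|) * ‖τ‖) := by gcongr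
          _ = |CA| * (2 + |CA|) := by field_simp
          _ ≤ _ := le_add_of_nonneg_left (by positivity)
      · rw [hLtriv b h h', sub_self, norm_zero, zero_mul]
        positivity
  · intro b τ hR
    by_cases h : ∃ k, near k τ
    · obtain ⟨k, hk⟩ := h
      rw [hLnear b hk]
      exact ((hr k _ τ rfl hk).1 b).1
    · by_cases h' : R₁ ≤ ‖τ‖
      · rw [hLfar b h h']
        exact (hρ τ h' h).1
      · rw [hLtriv b h h'] at hR
        linarith
  · intro b β τ hR hβ hβτ
    have hβ0 : 0 < ‖β‖ := by linarith
    have h4 : K₁ / ‖β‖ ≤ 1 / 4 := by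
      rw [div_le_div_iff₀ hβ0 (by norm_num)]; linarith
    have hτβ := norm_sub_norm_le β τ
    have hβτ' := norm_sub_norm_le τ β
    rw [norm_sub_rev] at hβτ'
    by_cases h : ∃ k, near k τ
    · obtain ⟨k, hk⟩ := h
      have h5 : ‖β - Real.pi * k‖ ≤ 1 / 2 := by
        have := norm_add_le (β - τ) (τ - Real.pi * k)
        rw [sub_add_sub_cancel] at this
        linarith [hnear4 hk]
      rcases (hr k _ τ rfl hk).2 β hβ h5 b with h6 | h6
      · exact Or.inl (h6.trans (hLnear b hk).symm)
      · refine Or.inr ⟨k, ?_⟩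
        rw [hLnear (!b) (hmirror hk), hcosm]
        exact h6
    · left
      have hτ : R₁ ≤ ‖τ‖ := by linarith
      have hτ0 : 0 < ‖τ‖ := by linarith
      rw [hLfar b h hτ]
      refine (hρ τ hτ h).2.2 β hβ (hβτ.trans ?_)
      rw [div_div, div_le_div_iff₀ hβ0 (by positivity)]
      have : 256 * K₁ ≤ K := by have := abs_nonneg K₀; rw [hK]; linarith
      nlinarith

/-- The roots of `T β = cos ζ`, where `T β` is close to `cos (β - q / β)`, are labelled by
`2πn ± ζ`. -/
theorem IsNearCos.exists_labelling {T : ℂ → ℂ} {q : ℂ} {C₀ R₀ : ℝ} (hT : IsNearCos T q C₀ R₀) :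
    ∃ (C R : ℝ) (βp βm : ℤ → ℂ → ℂ),
      (∀ n ζ, ‖βp n ζ - (2 * Real.pi * n + ζ)‖ ≤ C / (1 + ‖βp n ζ‖) ∧
        ‖βm n ζ - (2 * Real.pi * n - ζ)‖ ≤ C / (1 + ‖βm n ζ‖)) ∧
      ∀ β ζ, R ≤ ‖β‖ → (T β = Complex.cos ζ ↔ ∃ n : ℤ, β = βp n ζ ∨ β = βm n ζ) := by
  obtain ⟨K₁, R₂, hK₁, hloc⟩ := hT.exists_near_of_eq_cos
  obtain ⟨C, R, L, h1, h2, h3⟩ := exists_cos_root_labels hT hK₁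
  have hcosp : ∀ (k : ℤ) (τ : ℂ), Complex.cos (2 * Real.pi * k + τ) = Complex.cos τ := by
    intro k τ
    rw [show (2 * Real.pi * k + τ : ℂ) = τ + k * (2 * Real.pi) by ring,
      Complex.cos_add_int_mul_two_pi]
  have hcosm : ∀ (k : ℤ) (τ : ℂ), Complex.cos (2 * Real.pi * k - τ) = Complex.cos τ := by
    intro k τ
    rw [show (2 * Real.pi * k - τ : ℂ) = k * (2 * Real.pi) - τ by ring,
      Complex.cos_int_mul_two_pi_sub]
  refine ⟨C, max R R₂, fun n ζ => L true (2 * Real.pi * n + ζ),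
    fun n ζ => L false (2 * Real.pi * n - ζ), fun n ζ => ⟨h1 _ _, h1 _ _⟩, fun β ζ hβ => ⟨?_, ?_⟩⟩
  · intro hroot
    have hR := (le_max_left _ _).trans hβ
    obtain ⟨n, hn | hn⟩ := hloc β ζ ((le_max_right _ _).trans hβ) hroot
    · rcases h3 true β _ hR (by rw [hcosp]; exact hroot) hn with h | ⟨k, h⟩
      · exact ⟨n, Or.inl h⟩
      -- The mirror of `2πn + ζ` is `2π(k - n) - ζ`, a target of the opposite family.
      · refine ⟨k - n, Or.inr ?_⟩
        rw [h]
        change L false _ = L false _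
        congr 1
        push_cast; ring
    · rcases h3 false β _ hR (by rw [hcosm]; exact hroot) hn with h | ⟨k, h⟩
      · exact ⟨n, Or.inr h⟩
      · refine ⟨k - n, Or.inl ?_⟩
        rw [h]
        change L true _ = L true _
        congr 1
        push_cast; ring
  · rintro ⟨n, rfl | rfl⟩
    · rw [h2 _ _ ((le_max_left _ _).trans hβ), hcosp]
    · rw [h2 _ _ ((le_max_left _ _).trans hβ), hcosm]

/-! ### Solutions of `y'' = c a y`, entire in `z` and in the parameter `c`. -/

theorem exists_entire_primitive {g : ℂ → ℂ} (hg : Differentiable ℂ g) :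
    ∃ G : ℂ → ℂ, G 0 = 0 ∧ ∀ z, HasDerivAt G (g z) z := by
  obtain ⟨G, h0, hG⟩ := (Complex.IsConservativeOn.isExactOn_univ hg.continuous
    hg.differentiableOn.isConservativeOn).with_val_at 0 0
  exact ⟨G, h0, fun z => hG z (Set.mem_univ z)⟩

/-- Integration along the ray from `0`. The gain `1 / (k + 1)` at each integration produces the
factorials in `exists_bound_solutionCoeff`. -/
theorem norm_le_of_hasDerivAt_of_norm_le_pow {G g : ℂ → ℂ} (h0 : G 0 = 0)
    (hG : ∀ z, HasDerivAt G (g z) z) {C r : ℝ} {k : ℕ}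
    (hb : ∀ z, ‖z‖ ≤ r → ‖g z‖ ≤ C * ‖z‖ ^ k) {z : ℂ} (hz : ‖z‖ ≤ r) :
    ‖G z‖ ≤ C * ‖z‖ ^ (k + 1) / (k + 1) := by
  have hd : ∀ t : ℝ, HasDerivAt (fun t : ℝ => G (t * z)) (g (t * z) * z) t := fun t => by
    have h1 : HasDerivAt (fun t : ℝ => (t : ℂ) * z) z t := by
      simpa using (Complex.ofRealCLM.hasDerivAt (x := t)).mul_const z
    exact (hG _).comp t h1
  have hB : ∀ t : ℝ, HasDerivAt (fun t : ℝ => C * ‖z‖ ^ (k + 1) * t ^ (k + 1) / (k + 1))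
      (C * ‖z‖ ^ (k + 1) * t ^ k) t := fun t => by
    convert! ((hasDerivAt_pow (k + 1) t).const_mul (C * ‖z‖ ^ (k + 1))).div_const ((k : ℝ) + 1)
      using 1
    have : (k : ℝ) + 1 ≠ 0 := by positivity
    push_cast
    field_simp
  have := image_norm_le_of_norm_deriv_right_le_deriv_boundary (a := 0) (b := 1)
    (f := fun t : ℝ => G (t * z)) (f' := fun t : ℝ => g (t * z) * z)
    (fun t _ => (hd t).continuousAt.continuousWithinAt) (fun t _ => (hd t).hasDerivWithinAt)
    (B := fun t : ℝ => C * ‖z‖ ^ (k + 1) * t ^ (k + 1) / (k + 1)) (by simp [h0]) hB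
    (fun t ht => by
      have hn : ‖(t : ℂ) * z‖ = t * ‖z‖ := by
        rw [norm_mul, Complex.norm_real, Real.norm_of_nonneg ht.1]
      have := hb (t * z) (by
        rw [hn]; nlinarith [norm_nonneg z, ht.1, ht.2])
      rw [norm_mul]
      rw [hn] at this
      calc _ ≤ C * (t * ‖z‖) ^ k * ‖z‖ := by gcongr
        _ = _ := by ring) (Set.right_mem_Icc.2 zero_le_one)
  simpa using this

section EntireODE

open Classical in
/-- The primitive vanishing at `0` of an entire function. -/
noncomputable def primitive (g : ℂ → ℂ) : ℂ → ℂ :=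
  if h : Differentiable ℂ g then (exists_entire_primitive h).choose else 0

theorem primitive_zero (g : ℂ → ℂ) : primitive g 0 = 0 := by
  unfold primitive
  split_ifs with h
  · exact (exists_entire_primitive h).choose_spec.1
  · rfl

theorem hasDerivAt_primitive {g : ℂ → ℂ} (hg : Differentiable ℂ g) (z : ℂ) :
    HasDerivAt (primitive g) (g z) z := by
  unfold primitive
  rw [dif_pos hg]
  exact (exists_entire_primitive hg).choose_spec.2 z

theorem differentiable_primitive {g : ℂ → ℂ} (hg : Differentiable ℂ g) :
    Differentiable ℂ (primitive g) := fun z => (hasDerivAt_primitive hg z).differentiableAt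

variable (a : ℂ → ℂ) (p s : ℂ)

/-- Coefficients of the expansion in powers of `c` of the solution of `y'' = c a y`, `y(0) = p`,
`y'(0) = s`. -/
noncomputable def solutionCoeff : ℕ → ℂ → ℂ
  | 0 => fun z => p + s * z
  | n + 1 => primitive (primitive fun z => a z * solutionCoeff n z)

/-- Derivatives of `solutionCoeff`. -/
noncomputable def solutionCoeffDeriv : ℕ → ℂ → ℂ
  | 0 => fun _ => s
  | n + 1 => primitive fun z => a z * solutionCoeff a p s n z

variable {a}

theorem differentiable_solutionCoeff (ha : Differentiable ℂ a) (n : ℕ) :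
    Differentiable ℂ (solutionCoeff a p s n) := by
  induction n with
  | zero => unfold solutionCoeff; fun_prop
  | succ n ih => exact differentiable_primitive (differentiable_primitive (ha.mul ih))

theorem hasDerivAt_solutionCoeff (ha : Differentiable ℂ a) (n : ℕ) (z : ℂ) :
    HasDerivAt (solutionCoeff a p s n) (solutionCoeffDeriv a p s n z) z := by
  cases n with
  | zero =>
    simpa [solutionCoeff, solutionCoeffDeriv] using
      ((hasDerivAt_id z).const_mul s).const_add p
  | succ n =>
    exact hasDerivAt_primitive
      (differentiable_primitive (ha.mul (differentiable_solutionCoeff p s ha n))) z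

theorem hasDerivAt_solutionCoeffDeriv_succ (ha : Differentiable ℂ a) (n : ℕ) (z : ℂ) :
    HasDerivAt (solutionCoeffDeriv a p s (n + 1)) (a z * solutionCoeff a p s n z) z :=
  hasDerivAt_primitive (ha.mul (differentiable_solutionCoeff p s ha n)) z

theorem differentiable_solutionCoeffDeriv (ha : Differentiable ℂ a) (n : ℕ) :
    Differentiable ℂ (solutionCoeffDeriv a p s n) := by
  cases n with
  | zero => exact differentiable_const s
  | succ n => exact fun z => (hasDerivAt_solutionCoeffDeriv_succ p s ha n z).differentiableAt

/-- Each step of the recursion integrates twice, which gives `(2n)!` in the denominator. The weaker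
`n!` already makes the power series in `c` converge everywhere. -/
theorem exists_bound_solutionCoeff (ha : Differentiable ℂ a) (r : ℝ) :
    ∃ B X : ℝ, 0 ≤ B ∧ 0 ≤ X ∧ ∀ n z, ‖z‖ ≤ r →
      ‖solutionCoeff a p s n z‖ ≤ B * X ^ n / n.factorial ∧
      ‖solutionCoeffDeriv a p s n z‖ ≤ B * X ^ n / n.factorial := by
  -- The odd power of `r` in the derivative bound is then below the next even one.
  wlog hr : 1 ≤ r generalizing r
  · obtain ⟨B, X, h1, h2, h3⟩ := this 1 le_rfl
    exact ⟨B, X, h1, h2, fun n z hz => h3 n z (by linarith)⟩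
  obtain ⟨A, hA⟩ := (isCompact_closedBall (0 : ℂ) r).exists_bound_of_continuousOn
    ha.continuous.continuousOn
  have hA' : ∀ z : ℂ, ‖z‖ ≤ r → ‖a z‖ ≤ |A| := fun z hz =>
    (hA z (by simpa using hz)).trans (le_abs_self A)
  set B := ‖p‖ + ‖s‖ * r with hB
  have hB0 : 0 ≤ B := by positivity
  have hd : ∀ n, (∀ z : ℂ, ‖z‖ ≤ r →
      ‖solutionCoeff a p s n z‖ ≤ B * |A| ^ n / (2 * n).factorial * ‖z‖ ^ (2 * n)) →
      ∀ z : ℂ, ‖z‖ ≤ r → ‖solutionCoeffDeriv a p s (n + 1) z‖ ≤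
        B * |A| ^ (n + 1) / (2 * n + 1).factorial * ‖z‖ ^ (2 * n + 1) := by
    intro n ih z hz
    have := norm_le_of_hasDerivAt_of_norm_le_pow (G := solutionCoeffDeriv a p s (n + 1))
      (primitive_zero _) (hasDerivAt_solutionCoeffDeriv_succ p s ha n)
      (C := |A| * (B * |A| ^ n / (2 * n).factorial)) (k := 2 * n) (fun w hw => by
        rw [norm_mul, mul_assoc |A|]
        exact mul_le_mul (hA' w hw) (ih w hw) (norm_nonneg _) (abs_nonneg _)) hz
    refine this.trans (le_of_eq ?_)
    rw [Nat.factorial_succ]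
    push_cast
    field_simp
    ring
  have hc : ∀ n, ∀ z : ℂ, ‖z‖ ≤ r →
      ‖solutionCoeff a p s n z‖ ≤ B * |A| ^ n / (2 * n).factorial * ‖z‖ ^ (2 * n) := by
    intro n
    induction n with
    | zero =>
      intro z hz
      simp only [solutionCoeff, pow_zero, mul_zero, Nat.factorial_zero, Nat.cast_one, mul_one,
        div_one]
      refine (norm_add_le _ _).trans ?_
      rw [norm_mul, hB]
      gcongr
    | succ n ih =>
      intro z hz
      have := norm_le_of_hasDerivAt_of_norm_le_pow (G := solutionCoeff a p s (n + 1))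
        (primitive_zero _) (hasDerivAt_solutionCoeff p s ha (n + 1)) (k := 2 * n + 1)
        (hd n ih) hz
      refine this.trans (le_of_eq ?_)
      rw [show 2 * (n + 1) = 2 * n + 1 + 1 by ring, Nat.factorial_succ (2 * n + 1)]
      push_cast
      field_simp
  refine ⟨B, |A| * r ^ 2, hB0, by positivity, fun n z hz => ⟨?_, ?_⟩⟩
  · refine (hc n z hz).trans ?_
    rw [mul_pow, ← pow_mul, ← mul_assoc, div_mul_eq_mul_div]
    have : n.factorial ≤ (2 * n).factorial := Nat.factorial_le (by omega)
    gcongr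
  · cases n with
    | zero =>
      simp only [solutionCoeffDeriv, pow_zero, Nat.factorial_zero, Nat.cast_one, mul_one, div_one,
        hB]
      nlinarith [norm_nonneg s, norm_nonneg p]
    | succ n =>
      refine (hd n (hc n) z hz).trans ?_
      rw [mul_pow, ← pow_mul, ← mul_assoc, div_mul_eq_mul_div]
      have h1 : (n + 1).factorial ≤ (2 * n + 1).factorial := Nat.factorial_le (by omega)
      have h2 : ‖z‖ ^ (2 * n + 1) ≤ r ^ (2 * (n + 1)) :=
        (pow_le_pow_left₀ (norm_nonneg _) hz _).trans (pow_le_pow_right₀ hr (by omega))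
      gcongr

theorem summable_mul_pow_div_factorial (B X : ℝ) :
    Summable fun n : ℕ => B * X ^ n / n.factorial := by
  simp_rw [mul_div_assoc]
  exact (Real.summable_pow_div_factorial X).mul_left B

theorem norm_pow_mul_le_pow_div_factorial {c x : ℂ} {B X ρ : ℝ} {n : ℕ}
    (hx : ‖x‖ ≤ B * X ^ n / n.factorial) (hc : ‖c‖ ≤ ρ) :
    ‖c ^ n * x‖ ≤ B * (ρ * X) ^ n / n.factorial := by
  have : B * (ρ * X) ^ n / n.factorial = ρ ^ n * (B * X ^ n / n.factorial) := by
    rw [mul_pow]; ring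
  rw [this, norm_mul, norm_pow]
  have := (norm_nonneg c).trans hc
  gcongr

/-- The solution of `y'' = c a y` with initial data `p`, `s`, entire in both variables. -/
theorem exists_entire_solution (ha : Differentiable ℂ a) :
    ∃ y y' : ℂ → ℂ → ℂ, (∀ c z, HasDerivAt (y c) (y' c z) z) ∧
      (∀ c z, HasDerivAt (y' c) (c * a z * y c z) z) ∧ (∀ c, y c 0 = p ∧ y' c 0 = s) ∧
      ∀ z, Differentiable ℂ (fun c => y c z) ∧ Differentiable ℂ (fun c => y' c z) := by
  set φ := solutionCoeff a p s with hφ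
  set ψ := solutionCoeffDeriv a p s with hψ
  have hball : ∀ z : ℂ, z ∈ Metric.ball (0 : ℂ) (‖z‖ + 1) := fun z => by simp
  have hle : ∀ {z w : ℂ}, w ∈ Metric.ball (0 : ℂ) (‖z‖ + 1) → ‖w‖ ≤ ‖z‖ + 1 := fun hw => by
    simpa using (mem_ball_zero_iff.1 hw).le
  have hsum : ∀ c z, HasSum (fun n => c ^ n * ψ n z) (deriv (fun w => ∑' n, c ^ n * φ n w) z) ∧
      DifferentiableAt ℂ (fun w => ∑' n, c ^ n * φ n w) z := by
    intro c z
    obtain ⟨B, X, hB, hX, hb⟩ := exists_bound_solutionCoeff p s ha (‖z‖ + 1)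
    have hbd : ∀ (n : ℕ) (w : ℂ), w ∈ Metric.ball (0 : ℂ) (‖z‖ + 1) →
      ‖c ^ n * φ n w‖ ≤ B * (‖c‖ * X) ^ n / n.factorial := fun n w hw =>
      norm_pow_mul_le_pow_div_factorial (hb n w (hle hw)).1 le_rfl
    have hdiff : ∀ n : ℕ, DifferentiableOn ℂ (fun w => c ^ n * φ n w)
        (Metric.ball (0 : ℂ) (‖z‖ + 1)) := fun n =>
      ((differentiable_solutionCoeff p s ha n).const_mul _).differentiableOn
    have h1 := Complex.hasSum_deriv_of_summable_norm (summable_mul_pow_div_factorial B (‖c‖ * X))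
      hdiff Metric.isOpen_ball hbd (hball z)
    refine ⟨?_, (Complex.differentiableOn_tsum_of_summable_norm
      (summable_mul_pow_div_factorial B (‖c‖ * X)) hdiff Metric.isOpen_ball hbd).differentiableAt
      (Metric.isOpen_ball.mem_nhds (hball z))⟩
    convert! h1 using 2 with n
    exact ((hasDerivAt_solutionCoeff p s ha n z).const_mul _).deriv.symm
  have hsum' : ∀ c z, HasSum (fun n => c ^ n * deriv (ψ n) z)
      (deriv (fun w => ∑' n, c ^ n * ψ n w) z) ∧
      DifferentiableAt ℂ (fun w => ∑' n, c ^ n * ψ n w) z := by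
    intro c z
    obtain ⟨B, X, hB, hX, hb⟩ := exists_bound_solutionCoeff p s ha (‖z‖ + 1)
    have hbd : ∀ (n : ℕ) (w : ℂ), w ∈ Metric.ball (0 : ℂ) (‖z‖ + 1) →
      ‖c ^ n * ψ n w‖ ≤ B * (‖c‖ * X) ^ n / n.factorial := fun n w hw =>
      norm_pow_mul_le_pow_div_factorial (hb n w (hle hw)).2 le_rfl
    have hdiff : ∀ n : ℕ, DifferentiableOn ℂ (fun w => c ^ n * ψ n w)
        (Metric.ball (0 : ℂ) (‖z‖ + 1)) := fun n =>
      ((differentiable_solutionCoeffDeriv p s ha n).const_mul _).differentiableOn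
    have h1 := Complex.hasSum_deriv_of_summable_norm (summable_mul_pow_div_factorial B (‖c‖ * X))
      hdiff Metric.isOpen_ball hbd (hball z)
    refine ⟨?_, (Complex.differentiableOn_tsum_of_summable_norm
      (summable_mul_pow_div_factorial B (‖c‖ * X)) hdiff Metric.isOpen_ball hbd).differentiableAt
      (Metric.isOpen_ball.mem_nhds (hball z))⟩
    convert! h1 using 2 with n
    exact ((differentiable_solutionCoeffDeriv p s ha n z).hasDerivAt.const_mul _).deriv.symm
  refine ⟨fun c z => ∑' n, c ^ n * φ n z, fun c z => ∑' n, c ^ n * ψ n z, fun c z => ?_,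
    fun c z => ?_, fun c => ⟨?_, ?_⟩, fun z => ⟨fun c => ?_, fun c => ?_⟩⟩
  · beta_reduce
    rw [(hsum c z).1.tsum_eq]
    exact (hsum c z).2.hasDerivAt
  · have h := (hsum' c z).2.hasDerivAt
    convert! h using 1
    -- The constant term has zero derivative; shifting the index by one releases the factor `c`.
    rw [← (hsum' c z).1.tsum_eq, (hsum' c z).1.summable.tsum_eq_zero_add]
    have h0 : deriv (ψ 0) z = 0 := by
      simp [hψ, solutionCoeffDeriv]
    rw [h0, mul_zero, zero_add, ← tsum_mul_left]
    congr 1 with n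
    rw [(hasDerivAt_solutionCoeffDeriv_succ p s ha n z).deriv, hφ]
    ring
  · beta_reduce
    rw [tsum_eq_single 0]
    · simp [hφ, solutionCoeff]
    · intro n hn
      obtain ⟨m, rfl⟩ := Nat.exists_eq_succ_of_ne_zero hn
      simp [hφ, solutionCoeff, primitive_zero]
  · beta_reduce
    rw [tsum_eq_single 0]
    · simp [hψ, solutionCoeffDeriv]
    · intro n hn
      obtain ⟨m, rfl⟩ := Nat.exists_eq_succ_of_ne_zero hn
      simp [hψ, solutionCoeffDeriv, primitive_zero]
  · obtain ⟨B, X, hB, hX, hb⟩ := exists_bound_solutionCoeff p s ha ‖z‖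
    exact (Complex.differentiableOn_tsum_of_summable_norm
      (summable_mul_pow_div_factorial B ((‖c‖ + 1) * X))
      (fun n => by fun_prop) Metric.isOpen_ball fun n w hw =>
        norm_pow_mul_le_pow_div_factorial (hb n z le_rfl).1 (hle hw)).differentiableAt
        (Metric.isOpen_ball.mem_nhds (hball c))
  · obtain ⟨B, X, hB, hX, hb⟩ := exists_bound_solutionCoeff p s ha ‖z‖
    exact (Complex.differentiableOn_tsum_of_summable_norm
      (summable_mul_pow_div_factorial B ((‖c‖ + 1) * X))
      (fun n => by fun_prop) Metric.isOpen_ball fun n w hw =>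
        norm_pow_mul_le_pow_div_factorial (hb n z le_rfl).2 (hle hw)).differentiableAt
        (Metric.isOpen_ball.mem_nhds (hball c))

end EntireODE

/-! ### Wronskians, fundamental systems and monodromy. -/

section Solutions

variable {𝕜 : Type*} [RCLike 𝕜] [NormedAlgebra 𝕜 ℂ]

/-- `u` solves `u'' = b u`, with derivative `u'`. -/
def IsSolution (b u u' : 𝕜 → ℂ) : Prop :=
  ∀ x, HasDerivAt u (u' x) x ∧ HasDerivAt u' (b x * u x) x

variable {b u u' v v' : 𝕜 → ℂ}

theorem IsSolution.wronskian_eq (hu : IsSolution b u u') (hv : IsSolution b v v') (x : 𝕜) :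
    u x * v' x - u' x * v x = u 0 * v' 0 - u' 0 * v 0 := by
  have hd : ∀ x, HasDerivAt (fun x => u x * v' x - u' x * v x) 0 x := fun x => by
    convert! ((hu x).1.mul (hv x).2).sub ((hu x).2.mul (hv x).1) using 1
    ring
  exact is_const_of_deriv_eq_zero (fun x => (hd x).differentiableAt) (fun x => (hd x).deriv) x 0

/-- Normalized fundamental systems of `u'' = b u`. -/
def IsFundamentalSystem (b u u' v v' : 𝕜 → ℂ) : Prop :=
  (IsSolution b u u' ∧ u 0 = 1 ∧ u' 0 = 0) ∧ (IsSolution b v v' ∧ v 0 = 0 ∧ v' 0 = 1)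

theorem IsFundamentalSystem.wronskian_eq_one (h : IsFundamentalSystem b u u' v v') (x : 𝕜) :
    u x * v' x - u' x * v x = 1 := by
  obtain ⟨⟨h1, h2, h3⟩, ⟨h4, h5, h6⟩⟩ := h
  rw [h1.wronskian_eq h4, h2, h3, h5, h6]; simp

/-- Cramer's rule: the Wronskians of `w` with `u` and `v` are constant. Uniqueness for the initial
value problem is contained in this. -/
theorem IsFundamentalSystem.eq_combination (h : IsFundamentalSystem b u u' v v') {w w' : 𝕜 → ℂ}
    (hw : IsSolution b w w') (x : 𝕜) :
    w x = w 0 * u x + w' 0 * v x ∧ w' x = w 0 * u' x + w' 0 * v' x := by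
  have h1 := h.wronskian_eq_one x
  have h2 := hw.wronskian_eq h.1.1 x
  have h3 := hw.wronskian_eq h.2.1 x
  rw [h.1.2.1, h.1.2.2] at h2
  rw [h.2.2.1, h.2.2.2] at h3
  constructor
  · linear_combination (-w x) * h1 - v x * h2 + u x * h3
  · linear_combination (-w' x) * h1 - v' x * h2 + u' x * h3

end Solutions

theorem IsSolution.comp_ofReal {b u u' : ℂ → ℂ} (h : IsSolution b u u') :
    IsSolution (fun x : ℝ => b x) (fun x : ℝ => u x) (fun x : ℝ => u' x) :=
  fun x => ⟨(h x).1.comp_ofReal, (h x).2.comp_ofReal⟩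

theorem IsFundamentalSystem.comp_ofReal {b u u' v v' : ℂ → ℂ}
    (h : IsFundamentalSystem b u u' v v') :
    IsFundamentalSystem (fun x : ℝ => b x) (fun x : ℝ => u x) (fun x : ℝ => u' x)
      (fun x : ℝ => v x) (fun x : ℝ => v' x) :=
  ⟨⟨h.1.1.comp_ofReal, by simpa using h.1.2⟩, ⟨h.2.1.comp_ofReal, by simpa using h.2.2⟩⟩

theorem IsSolution.shift {b u u' : ℂ → ℂ} (hb : ∀ z, b (z + 1) = b z) (h : IsSolution b u u') :
    IsSolution b (fun z => u (z + 1)) (fun z => u' (z + 1)) := fun z => by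
  refine ⟨(h (z + 1)).1.comp_add_const z 1, ?_⟩
  rw [← hb]
  exact (h (z + 1)).2.comp_add_const z 1

/-- The monodromy over the period, in a normalized fundamental system. -/
theorem IsFundamentalSystem.shift_eq {b u u' v v' : ℂ → ℂ} (hb : ∀ z, b (z + 1) = b z)
    (h : IsFundamentalSystem b u u' v v') (z : ℂ) :
    (u (z + 1) = u 1 * u z + u' 1 * v z ∧ u' (z + 1) = u 1 * u' z + u' 1 * v' z) ∧
    (v (z + 1) = v 1 * u z + v' 1 * v z ∧ v' (z + 1) = v 1 * u' z + v' 1 * v' z) := by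
  have h1 := h.eq_combination (h.1.1.shift hb) z
  have h2 := h.eq_combination (h.2.1.shift hb) z
  simp only [zero_add] at h1 h2
  exact ⟨h1, h2⟩

theorem exists_ne_zero_of_det_eq_zero {a b c d : ℂ} (h : a * d = b * c) :
    ∃ p s : ℂ, (p ≠ 0 ∨ s ≠ 0) ∧ a * p + b * s = 0 ∧ c * p + d * s = 0 := by
  by_cases h1 : b ≠ 0 ∨ -a ≠ 0
  · exact ⟨b, -a, h1, by ring, by linear_combination -h⟩
  · push Not at h1
    obtain ⟨rfl, h2⟩ := h1
    obtain rfl : a = 0 := neg_eq_zero.1 h2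
    by_cases h3 : d ≠ 0 ∨ -c ≠ 0
    · exact ⟨d, -c, h3, by ring, by ring⟩
    · push Not at h3
      obtain ⟨rfl, h4⟩ := h3
      exact ⟨1, 0, Or.inl one_ne_zero, by ring, by linear_combination -h4⟩

/-! ### The kernel as a Floquet problem. -/

/-- Subtracting the primitive of `g` leaves an absolutely continuous function with zero derivative
almost everywhere, hence a constant. This upgrades the almost everywhere equation on `H²` to a
classical one. -/
theorem hasDerivAt_of_absolutelyContinuous_of_ae {f g : ℝ → ℂ} (hg : Continuous g)
    (hf : ∀ a b : ℝ, AbsolutelyContinuousOnInterval f a b)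
    (h : ∀ᵐ x, DifferentiableAt ℝ f x → deriv f x = g x) (x : ℝ) : HasDerivAt f (g x) x := by
  set G : ℝ → ℂ := fun x => ∫ t in (0 : ℝ)..x, g t with hG
  have hGd : ∀ x, HasDerivAt G (g x) x := fun x =>
    intervalIntegral.integral_hasDerivAt_right (hg.intervalIntegrable _ _)
      hg.aestronglyMeasurable.stronglyMeasurableAtFilter hg.continuousAt
  have hG1 : ContDiff ℝ 1 G := contDiff_one_iff_deriv.2
    ⟨fun x => (hGd x).differentiableAt, by
      rwa [show deriv G = g from funext fun x => (hGd x).deriv]⟩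
  have hconst : ∀ y, (f - G) y = (f - G) x := fun y => by
    obtain ⟨C, hC⟩ := ((hf y x).sub
      hG1.contDiffOn.absolutelyContinuousOnInterval).const_of_ae_hasDerivAt_zero (by
        filter_upwards [h, (hf y x).boundedVariationOn.ae_differentiableAt_of_mem_uIcc]
          with t ht ht' hmem
        have h1 := (ht' hmem).hasDerivAt
        rw [ht (ht' hmem)] at h1
        simpa using h1.sub (hGd t))
    rw [hC y Set.left_mem_uIcc, hC x Set.right_mem_uIcc]
  have : f = fun y => G y + (f - G) x := by
    funext y
    rw [← hconst y]; simp
  rw [this]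
  exact (hGd x).add_const _

theorem shiftedD_shiftedD_eq {ζ : ℂ} {u : ℝ → ℂ} (hu : Differentiable ℝ u) {x : ℝ} {d : ℂ}
    (hd : HasDerivAt (deriv u) d x) :
    shiftedD ζ (shiftedD ζ u) x = -d - 2 * Complex.I * ζ * deriv u x + ζ ^ 2 * u x := by
  have h1 : HasDerivAt (shiftedD ζ u) (-Complex.I * d + ζ * deriv u x) x :=
    (hd.const_mul _).add ((hu x).hasDerivAt.const_mul _)
  rw [shiftedD, h1.deriv, shiftedD]
  linear_combination d * Complex.I_sq

section Kernel

variable {W : ℂ → ℂ} {ζ α : ℂ}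

theorem deriv_hasDerivAt_of_mem_kerP (hW : Differentiable ℂ W) {u : ℝ → ℂ}
    (hu : u ∈ kerP W ζ α) (x : ℝ) :
    HasDerivAt (deriv u) (-2 * Complex.I * ζ * deriv u x + (ζ ^ 2 - α ^ 2 * W x ^ 2) * u x) x := by
  obtain ⟨⟨hper, hdiff, hac, -⟩, hop⟩ := hu
  refine hasDerivAt_of_absolutelyContinuous_of_ae
    (g := fun x => -2 * Complex.I * ζ * deriv u x + (ζ ^ 2 - α ^ 2 * W x ^ 2) * u x) ?_ hac ?_ x
  · have h1 : Continuous (deriv u) := continuous_iff_continuousAt.2 fun y =>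
      ((hac (y - 1) (y + 1)).continuousOn).continuousAt (by
        rw [Set.uIcc_of_le (by linarith)]
        exact Icc_mem_nhds (by linarith) (by linarith))
    have h2 := hdiff.continuous
    have h3 : Continuous fun x : ℝ => W x := hW.continuous.comp Complex.continuous_ofReal
    exact (continuous_const.mul h1).add
      ((continuous_const.sub (continuous_const.mul (h3.pow 2))).mul h2)
  · filter_upwards [hop] with y hy hd
    rw [opP, shiftedD_shiftedD_eq hdiff hd.hasDerivAt, Pi.zero_apply] at hy
    linear_combination -hy

theorem hasDerivAt_cexp_mul_ofReal (c : ℂ) (x : ℝ) :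
    HasDerivAt (fun x : ℝ => Complex.exp (c * x)) (c * Complex.exp (c * x)) x := by
  have h : HasDerivAt (fun z : ℂ => Complex.exp (c * z)) (c * Complex.exp (c * x)) (x : ℂ) := by
    convert! ((hasDerivAt_id (x : ℂ)).const_mul c).cexp using 1
    simp [mul_comm]
  exact h.comp_ofReal

/-- Multiplication by `exp (iζx)` turns the elements of the kernel into solutions of
`v'' = -α² W² v`. -/
theorem isSolution_of_mem_kerP (hW : Differentiable ℂ W) {u : ℝ → ℂ} (hu : u ∈ kerP W ζ α) :
    IsSolution (fun x : ℝ => -α ^ 2 * W x ^ 2)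
      (fun x => Complex.exp (Complex.I * ζ * x) * u x)
      (fun x => Complex.exp (Complex.I * ζ * x) * (deriv u x + Complex.I * ζ * u x)) := by
  intro x
  have h1 := hasDerivAt_cexp_mul_ofReal (Complex.I * ζ) x
  have h2 := (hu.1.2.1 x).hasDerivAt
  have h3 := deriv_hasDerivAt_of_mem_kerP hW hu x
  constructor
  · convert! h1.mul h2 using 1
    ring
  · convert! h1.mul (h3.add (h2.const_mul (Complex.I * ζ))) using 1
    simp only [Pi.add_apply]
    linear_combination -(Complex.exp (Complex.I * ζ * x) * ζ ^ 2 * u x) * Complex.I_sq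

/-- The factor `exp (-iζx)` cancels the Floquet multiplier, and the resulting periodic function is
smooth enough for `H²`. -/
theorem mem_kerP_of_isSolution (hW : Differentiable ℂ W) {v v' : ℂ → ℂ}
    (hv : IsSolution (fun z => -α ^ 2 * W z ^ 2) v v')
    (hper : ∀ z, v (z + 1) = Complex.exp (Complex.I * ζ) * v z) :
    (fun x : ℝ => Complex.exp (-(Complex.I * ζ) * x) * v x) ∈ kerP W ζ α := by
  set u : ℝ → ℂ := fun x => Complex.exp (-(Complex.I * ζ) * x) * v x with hu
  have he := hasDerivAt_cexp_mul_ofReal (-(Complex.I * ζ))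
  have hv1 := fun x : ℝ => (hv.comp_ofReal x).1
  have hv2 := fun x : ℝ => (hv.comp_ofReal x).2
  have hec : Continuous fun x : ℝ => Complex.exp (-(Complex.I * ζ) * x) :=
    continuous_iff_continuousAt.2 fun x => (he x).continuousAt
  have hvc : Continuous fun x : ℝ => v x := continuous_iff_continuousAt.2 fun x =>
    (hv1 x).continuousAt
  have hvc' : Continuous fun x : ℝ => v' x := continuous_iff_continuousAt.2 fun x =>
    (hv2 x).continuousAt
  have hWc : Continuous fun x : ℝ => W x := hW.continuous.comp Complex.continuous_ofReal
  have hd : ∀ x : ℝ, HasDerivAt u (Complex.exp (-(Complex.I * ζ) * x) *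
      (v' x - Complex.I * ζ * v x)) x := fun x => by
    convert! (he x).mul (hv1 x) using 1
    ring
  have hd1 : deriv u = fun x : ℝ => Complex.exp (-(Complex.I * ζ) * x) *
      (v' x - Complex.I * ζ * v x) := funext fun x => (hd x).deriv
  have hd2 : ∀ x : ℝ, HasDerivAt (deriv u) (Complex.exp (-(Complex.I * ζ) * x) *
      (-α ^ 2 * W x ^ 2 * v x - 2 * Complex.I * ζ * v' x - ζ ^ 2 * v x)) x := fun x => by
    rw [hd1]
    convert! (he x).mul ((hv2 x).sub ((hv1 x).const_mul (Complex.I * ζ))) using 1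
    simp only [Pi.sub_apply]
    linear_combination -(Complex.exp (-(Complex.I * ζ) * x) * ζ ^ 2 * v x) * Complex.I_sq
  have hd3 : deriv (deriv u) = fun x : ℝ => Complex.exp (-(Complex.I * ζ) * x) *
      (-α ^ 2 * W x ^ 2 * v x - 2 * Complex.I * ζ * v' x - ζ ^ 2 * v x) :=
    funext fun x => (hd2 x).deriv
  have hc3 : Continuous (deriv (deriv u)) := by
    rw [hd3]
    exact hec.mul ((((continuous_const.mul (hWc.pow 2)).mul hvc).sub
      (continuous_const.mul hvc')).sub (continuous_const.mul hvc))
  refine ⟨⟨fun x => ?_, fun x => (hd x).differentiableAt, fun a b => ?_, ?_⟩, ?_⟩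
  · simp only [hu]
    push_cast
    rw [hper, mul_add, mul_one, Complex.exp_add, Complex.exp_neg (Complex.I * ζ)]
    field_simp [Complex.exp_ne_zero]
  · exact (contDiff_one_iff_deriv.2
      ⟨fun x => (hd2 x).differentiableAt, hc3⟩).contDiffOn.absolutelyContinuousOnInterval
  · obtain ⟨C, hC⟩ := (isCompact_Icc (a := (0 : ℝ)) (b := 1)).exists_bound_of_continuousOn
      hc3.continuousOn
    refine MemLp.of_bound hc3.aestronglyMeasurable C ?_
    filter_upwards [ae_restrict_mem measurableSet_Ioc] with x hx
    exact hC x (Set.Ioc_subset_Icc_self hx)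
  · refine Filter.Eventually.of_forall fun x => ?_
    rw [opP, shiftedD_shiftedD_eq (fun x => (hd x).differentiableAt) (hd2 x), hd1, Pi.zero_apply]
    simp only [hu]
    linear_combination (2 * Complex.exp (-(Complex.I * ζ) * x) * ζ ^ 2 * v x) * Complex.I_sq

/-- The kernel is nontrivial iff `exp (iζ)` is a Floquet multiplier. -/
theorem exists_mem_kerP_ne_zero_iff (hW : Differentiable ℂ W) (hper : ∀ z, W (z + 1) = W z)
    {y₁ y₁' y₂ y₂' : ℂ → ℂ}
    (h : IsFundamentalSystem (fun z => -α ^ 2 * W z ^ 2) y₁ y₁' y₂ y₂') :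
    (∃ u ∈ kerP W ζ α, u ≠ 0) ↔ y₁ 1 + y₂' 1 = 2 * Complex.cos ζ := by
  set μ := Complex.exp (Complex.I * ζ) with hμ
  have hμ0 : μ ≠ 0 := Complex.exp_ne_zero _
  have hcos : 2 * Complex.cos ζ = μ + μ⁻¹ := by
    rw [Complex.cos, hμ, ← Complex.exp_neg]
    ring_nf
  have hwr := h.wronskian_eq_one 1
  -- As the Wronskian is one, the characteristic equation is `μ² - (trace) μ + 1 = 0`; dividing by
  -- `μ` gives `trace = μ + μ⁻¹`.
  have hcos' : y₁ 1 + y₂' 1 = 2 * Complex.cos ζ ↔ (y₁ 1 - μ) * (y₂' 1 - μ) = y₂ 1 * y₁' 1 := by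
    rw [hcos]
    constructor
    · intro h
      have h2 : μ * μ⁻¹ = 1 := mul_inv_cancel₀ hμ0
      linear_combination hwr - μ * h - h2
    · intro h
      have : (y₁ 1 + y₂' 1) * μ = μ ^ 2 + 1 := by linear_combination hwr - h
      field_simp
      linear_combination this
  rw [hcos']
  have hb : ∀ z, -α ^ 2 * W (z + 1) ^ 2 = -α ^ 2 * W z ^ 2 := fun z => by rw [hper]
  constructor
  · rintro ⟨u, hu, hu0⟩
    have hv := isSolution_of_mem_kerP hW hu
    have h1 := h.comp_ofReal.eq_combination hv
    obtain ⟨⟨huper, -⟩, -⟩ := hu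
    have hdper : deriv u 1 = deriv u 0 := by
      have : (fun x => u (x + 1)) = u := funext huper
      have h2 := deriv_comp_add_const (f := u) 1 0
      rw [this, zero_add] at h2
      exact h2.symm
    have h10 := (h1 1)
    have hu1 : u 1 = u 0 := by simpa using huper 0
    simp only [Complex.ofReal_one, Complex.ofReal_zero, mul_one, mul_zero, Complex.exp_zero,
      one_mul, hdper, hu1, ← hμ] at h10
    set p := u 0
    set s := deriv u 0 + Complex.I * ζ * p with hs
    obtain ⟨e1, e2⟩ := h10
    have hp : ((y₁ 1 - μ) * (y₂' 1 - μ) - y₂ 1 * y₁' 1) * p = 0 := by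
      linear_combination -(y₂' 1 - μ) * e1 + y₂ 1 * e2
    have hs : ((y₁ 1 - μ) * (y₂' 1 - μ) - y₂ 1 * y₁' 1) * s = 0 := by
      linear_combination y₁' 1 * e1 - (y₁ 1 - μ) * e2
    by_contra hne
    have hne' := sub_ne_zero.2 hne
    have hp0 := (mul_eq_zero.1 hp).resolve_left hne'
    have hs0 := (mul_eq_zero.1 hs).resolve_left hne'
    apply hu0
    funext x
    have h2 := (h1 x).1
    simp only [Complex.ofReal_zero, mul_zero, Complex.exp_zero, one_mul] at h2
    change _ = p * y₁ x + s * y₂ x at h2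
    rw [hp0, hs0] at h2
    simpa [Complex.exp_ne_zero] using h2
  · intro hdet
    obtain ⟨p, s, hne, e1, e2⟩ := exists_ne_zero_of_det_eq_zero hdet
    have hv : IsSolution (fun z => -α ^ 2 * W z ^ 2) (fun z => p * y₁ z + s * y₂ z)
        (fun z => p * y₁' z + s * y₂' z) := fun z => by
      refine ⟨((h.1.1 z).1.const_mul p).add ((h.2.1 z).1.const_mul s), ?_⟩
      convert! ((h.1.1 z).2.const_mul p).add ((h.2.1 z).2.const_mul s) using 1
      ring
    refine ⟨_, mem_kerP_of_isSolution (ζ := ζ) hW hv (fun z => ?_), fun h0 => ?_⟩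
    · obtain ⟨⟨h1, -⟩, ⟨h2, -⟩⟩ := h.shift_eq hb z
      simp only [h1, h2, ← hμ]
      linear_combination y₁ z * e1 + y₂ z * e2
    · have hv0 : ∀ x : ℝ, p * y₁ x + s * y₂ x = 0 := fun x => by
        have := congrFun h0 x
        simpa [Complex.exp_ne_zero] using this
      have hp : p = 0 := by
        have := hv0 0
        rw [Complex.ofReal_zero, h.1.2.1, h.2.2.1] at this
        simpa using this
      have hs : s = 0 := by
        have h3 : HasDerivAt (fun x : ℝ => p * y₁ x + s * y₂ x)
          (p * y₁' (0 : ℝ) + s * y₂' (0 : ℝ)) 0 := (hv.comp_ofReal 0).1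
        have h4 : (fun x : ℝ => p * y₁ x + s * y₂ x) = fun _ => 0 := funext hv0
        rw [h4] at h3
        have := h3.unique (hasDerivAt_const 0 0)
        rw [Complex.ofReal_zero, h.1.2.2, h.2.2.2] at this
        simpa using this
      exact hne.elim (· hp) (· hs)

end Kernel

/-! ### Winding numbers of simple closed curves. -/

/-- Two different values would force a half-integral one in between. It serves both winding
integrals and branches of logarithms. -/
theorem IsPreconnected.eq_of_forall_exists_int {X : Type*} [TopologicalSpace X] {s : Set X}
    (hs : IsPreconnected s) {f : X → ℂ} (hf : ContinuousOn f s)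
    (h : ∀ x ∈ s, ∃ k : ℤ, f x = 2 * Real.pi * Complex.I * k) {x y : X} (hx : x ∈ s)
    (hy : y ∈ s) : f x = f y := by
  wlog hle : (f x).im ≤ (f y).im generalizing x y
  · exact (this hy hx (le_of_not_ge hle)).symm
  have him : ∀ k : ℤ, (2 * Real.pi * Complex.I * k : ℂ).im = 2 * Real.pi * k := fun k => by simp
  obtain ⟨j, hj⟩ := h x hx
  obtain ⟨k, hk⟩ := h y hy
  have hpi := Real.pi_pos
  have hg : ContinuousOn (fun x => (f x).im) s := Complex.continuous_im.comp_continuousOn hf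
  rw [hj, hk, him, him] at hle
  have hjk : j ≤ k := by
    have := le_of_mul_le_mul_left hle (by positivity)
    exact_mod_cast this
  rcases hjk.eq_or_lt with rfl | hlt
  · rw [hj, hk]
  exfalso
  have hlt' : (j : ℝ) + 1 ≤ k := by exact_mod_cast hlt
  obtain ⟨z, hz, hzj⟩ := hs.intermediate_value hx hy hg
    (show 2 * Real.pi * (j + 1 / 2) ∈ _ by
      rw [hj, hk, him, him]
      constructor
      · gcongr; linarith
      · gcongr; linarith)
  obtain ⟨l, hl⟩ := h z hz
  simp only [hl, him] at hzj
  have h1 := mul_left_cancel₀ (by positivity) hzj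
  have h2 : (2 * l : ℝ) = 2 * j + 1 := by linarith
  have h3 : 2 * l = 2 * j + 1 := by exact_mod_cast h2
  omega

/-- A simple closed regular `C¹` curve of period `1`, with derivative `E'`. -/
structure IsSimpleClosedCurve (E E' : ℝ → ℂ) : Prop where
  hasDerivAt : ∀ t, HasDerivAt E (E' t) t
  continuous_deriv : Continuous E'
  periodic : Function.Periodic E 1
  injective : ∀ s t, E s = E t → ∃ j : ℤ, s = t + j
  deriv_ne_zero : ∀ t, E' t ≠ 0

/-- `2πi` times the winding number of the curve `E` around `p`. -/
noncomputable def windingIntegral (E E' : ℝ → ℂ) (p : ℂ) : ℂ :=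
  ∫ t in (0 : ℝ)..1, E' t / (E t - p)

namespace IsSimpleClosedCurve

variable {E E' : ℝ → ℂ} (hE : IsSimpleClosedCurve E E')
include hE

theorem continuous : Continuous E :=
  continuous_iff_continuousAt.2 fun t => (hE.hasDerivAt t).continuousAt

theorem add_int (t : ℝ) (n : ℤ) : E (t + n) = E t := by
  simpa using hE.periodic.int_mul n t

theorem deriv_add_int (t : ℝ) (n : ℤ) : E' (t + n) = E' t := by
  have h1 := (hE.hasDerivAt (t + n)).comp_add_const t n
  rw [funext fun t => hE.add_int t n] at h1
  exact h1.unique (hE.hasDerivAt t)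

theorem exists_bound : ∃ M > 0, ∀ t, ‖E' t‖ ≤ M := by
  obtain ⟨M, hM⟩ := (isCompact_Icc (a := (0 : ℝ)) (b := 1)).exists_bound_of_continuousOn
    hE.continuous_deriv.continuousOn
  refine ⟨|M| + 1, by positivity, fun t => ?_⟩
  have h := hM (Int.fract t) ⟨Int.fract_nonneg t, (Int.fract_lt_one t).le⟩
  have h2 := hE.deriv_add_int (Int.fract t) ⌊t⌋
  rw [Int.fract_add_floor] at h2
  rw [h2]
  linarith [le_abs_self M]

theorem exists_lower_bound : ∃ m > 0, ∀ t, m ≤ ‖E' t‖ := by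
  obtain ⟨s, -, hs⟩ := (isCompact_Icc (a := (0 : ℝ)) (b := 1)).exists_isMinOn
    ⟨0, by simp⟩ (f := fun t => ‖E' t‖) hE.continuous_deriv.norm.continuousOn
  refine ⟨‖E' s‖, norm_pos_iff.2 (hE.deriv_ne_zero s), fun t => ?_⟩
  have h2 := hE.deriv_add_int (Int.fract t) ⌊t⌋
  rw [Int.fract_add_floor] at h2
  rw [h2]
  exact hs ⟨Int.fract_nonneg t, (Int.fract_lt_one t).le⟩

theorem continuous_integrand {p : ℂ} (hp : ∀ t, E t ≠ p) :
    Continuous fun t => E' t / (E t - p) :=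
  hE.continuous_deriv.div (hE.continuous.sub continuous_const) fun t => sub_ne_zero.2 (hp t)

/-- With `G` the primitive of the integrand, `exp (-G) (E - p)` is constant; since `E` closes up,
`exp (G 1) = 1`. -/
theorem windingIntegral_mem {p : ℂ} (hp : ∀ t, E t ≠ p) :
    ∃ k : ℤ, windingIntegral E E' p = 2 * Real.pi * Complex.I * k := by
  have hc := hE.continuous_integrand hp
  set G : ℝ → ℂ := fun x => ∫ t in (0 : ℝ)..x, E' t / (E t - p) with hG
  have hGd : ∀ x, HasDerivAt G (E' x / (E x - p)) x := fun x =>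
    intervalIntegral.integral_hasDerivAt_right (hc.intervalIntegrable _ _)
      hc.aestronglyMeasurable.stronglyMeasurableAtFilter hc.continuousAt
  have hd : ∀ x, HasDerivAt (fun x => Complex.exp (-G x) * (E x - p)) 0 x := fun x => by
    have h0 := sub_ne_zero.2 (hp x)
    convert! (hGd x).neg.cexp.mul ((hE.hasDerivAt x).sub_const p) using 1
    simp only [Pi.neg_apply]
    field_simp
    ring
  have h1 := is_const_of_deriv_eq_zero (fun x => (hd x).differentiableAt)
    (fun x => (hd x).deriv) 1 0
  have hE1 : E 1 = E 0 := by simpa using hE.periodic 0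
  have hG0 : G 0 = 0 := by simp [hG]
  simp only [hE1, hG0, neg_zero, Complex.exp_zero] at h1
  have h2 := mul_right_cancel₀ (sub_ne_zero.2 (hp 0)) h1
  obtain ⟨n, hn⟩ := Complex.exp_eq_one_iff.1 h2
  refine ⟨-n, ?_⟩
  change G 1 = _
  push_cast
  linear_combination -hn

theorem windingIntegral_const {s : Set ℝ} (hs : IsPreconnected s) {p : ℝ → ℂ}
    (hp : ContinuousOn p s) (hne : ∀ x ∈ s, ∀ t, E t ≠ p x) {x y : ℝ} (hx : x ∈ s) (hy : y ∈ s) :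
    windingIntegral E E' (p x) = windingIntegral E E' (p y) := by
  refine hs.eq_of_forall_exists_int (f := fun x => windingIntegral E E' (p x)) ?_
    (fun x hx => hE.windingIntegral_mem (hne x hx)) hx hy
  rw [continuousOn_iff_continuous_domRestrict] at hp ⊢
  refine intervalIntegral.continuous_parametric_intervalIntegral_of_continuous'
    (f := fun (x : s) t => E' t / (E t - p x)) ?_ 0 1
  refine (hE.continuous_deriv.comp continuous_snd).div
    ((hE.continuous.comp continuous_snd).sub (hp.comp continuous_fst)) fun q => ?_
  exact sub_ne_zero.2 (hne q.1 q.1.2 q.2)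

theorem exists_norm_sub_sub_le {η : ℝ} (hη : 0 < η) : ∃ h > 0, ∀ s t : ℝ, |t - s| ≤ h →
    ‖E t - E s - (t - s) * E' s‖ ≤ η * |t - s| ∧ ‖E' t - E' s‖ ≤ η := by
  have hu := (isCompact_Icc (a := (-1 : ℝ)) (b := 2)).uniformContinuousOn_of_continuous
    hE.continuous_deriv.continuousOn
  obtain ⟨h, hh, H⟩ := Metric.uniformContinuousOn_iff_le.1 hu η hη
  have key : ∀ s ∈ Set.Icc (0 : ℝ) 1, ∀ t, |t - s| ≤ min h 1 → ‖E' t - E' s‖ ≤ η := by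
    intro s hs t ht
    have h1 := abs_le.1 (ht.trans (min_le_right _ _))
    have := H t ⟨by linarith [hs.1], by linarith [hs.2]⟩ s ⟨by linarith [hs.1], by linarith [hs.2]⟩
      (by rw [Real.dist_eq]; exact ht.trans (min_le_left _ _))
    rwa [dist_eq_norm] at this
  have key' : ∀ s t : ℝ, |t - s| ≤ min h 1 → ‖E' t - E' s‖ ≤ η := fun s t ht => by
    have h1 := hE.deriv_add_int (Int.fract s) ⌊s⌋
    rw [Int.fract_add_floor] at h1
    have h2 := hE.deriv_add_int (t - ⌊s⌋) ⌊s⌋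
    rw [sub_add_cancel] at h2
    rw [h1, h2]
    apply key _ ⟨Int.fract_nonneg s, (Int.fract_lt_one s).le⟩
    rw [Int.fract]
    convert ht using 2
    ring
  refine ⟨min h 1, by positivity, fun s t ht => ⟨?_, key' s t ht⟩⟩
  have hd : ∀ x : ℝ, HasDerivAt (fun x : ℝ => E x - x * E' s) (E' x - E' s) x := fun x => by
    convert! (hE.hasDerivAt x).sub ((Complex.ofRealCLM.hasDerivAt (x := x)).mul_const (E' s))
      using 1
    simp
  have := (convex_uIcc s t).norm_image_sub_le_of_norm_hasDerivWithin_le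
    (fun x _ => (hd x).hasDerivWithinAt) (fun x hx => key' s x
      ((Set.abs_sub_left_of_mem_uIcc hx).trans ht)) Set.left_mem_uIcc Set.right_mem_uIcc
  rw [Real.norm_eq_abs] at this
  refine le_trans (le_of_eq ?_) this
  congr 1
  ring

/-- Compactness of the pairs of parameters in a period that are not close modulo `ℤ`, together with
injectivity modulo `ℤ`. -/
theorem exists_separation {h : ℝ} (hh : 0 < h) : ∃ c > 0, ∀ s t : ℝ,
    (∀ j : ℤ, h ≤ |t - s - j|) → c ≤ ‖E t - E s‖ := by
  set K : Set (ℝ × ℝ) := (Set.Icc 0 1 ×ˢ Set.Icc 0 1) ∩ {q | ∀ j : ℤ, h ≤ |q.2 - q.1 - j|} with hK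
  have hKc : IsCompact K := by
    refine (isCompact_Icc.prod isCompact_Icc).inter_right ?_
    rw [Set.ofPred_forall]
    exact isClosed_iInter fun j => isClosed_le continuous_const (by fun_prop)
  have hred : ∀ s t : ℝ, (∀ j : ℤ, h ≤ |t - s - j|) → (Int.fract s, Int.fract t) ∈ K ∧
      E (Int.fract s) = E s ∧ E (Int.fract t) = E t := fun s t hst => by
    refine ⟨⟨⟨⟨Int.fract_nonneg s, (Int.fract_lt_one s).le⟩,
      ⟨Int.fract_nonneg t, (Int.fract_lt_one t).le⟩⟩, fun j => ?_⟩, ?_, ?_⟩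
    · have := hst (j + ⌊t⌋ - ⌊s⌋)
      simp only [Int.fract]
      convert this using 2
      push_cast; ring
    · rw [← hE.add_int (Int.fract s) ⌊s⌋, Int.fract_add_floor]
    · rw [← hE.add_int (Int.fract t) ⌊t⌋, Int.fract_add_floor]
  rcases K.eq_empty_or_nonempty with he | hne
  · refine ⟨1, one_pos, fun s t hst => ?_⟩
    have := (hred s t hst).1
    rw [he] at this
    exact absurd this (Set.notMem_empty _)
  · have hc := hE.continuous
    obtain ⟨q, hq, hmin⟩ := hKc.exists_isMinOn hne
      (f := fun q : ℝ × ℝ => ‖E q.2 - E q.1‖) (by fun_prop)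
    refine ⟨‖E q.2 - E q.1‖, norm_pos_iff.2 (sub_ne_zero.2 fun he => ?_), fun s t hst => ?_⟩
    · obtain ⟨j, hj⟩ := hE.injective _ _ he
      have := hq.2 j
      rw [hj, show q.1 + j - q.1 - j = 0 by ring, abs_zero] at this
      linarith
    · obtain ⟨h1, h2, h3⟩ := hred s t hst
      rw [← h2, ← h3]
      exact hmin h1

/-- Points pushed off along the normal miss the curve. Parameters far from `s` are excluded by
`exists_separation`. For nearby ones `|iδ - x| ≥ |x|`, while the curve deviates from its tangent by
at most `(m / 2) |x|`. -/
theorem exists_tube : ∃ δ₀ > 0, ∀ s δ : ℝ, δ ≠ 0 → |δ| ≤ δ₀ → ∀ t,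
    E t ≠ E s + Complex.I * δ * E' s := by
  obtain ⟨m, hm, hmE⟩ := hE.exists_lower_bound
  obtain ⟨M, hM, hME⟩ := hE.exists_bound
  obtain ⟨h, hh, H⟩ := hE.exists_norm_sub_sub_le (η := m / 2) (by positivity)
  obtain ⟨c, hc, hsep⟩ := hE.exists_separation hh
  refine ⟨c / (2 * M), by positivity, fun s δ hδ hδ0 t ht => ?_⟩
  by_cases hfar : ∀ j : ℤ, h ≤ |t - s - j|
  · have h1 := hsep s t hfar
    rw [ht, add_sub_cancel_left, norm_mul, norm_mul, Complex.norm_I, one_mul, Complex.norm_real,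
      Real.norm_eq_abs] at h1
    have h2 : |δ| * ‖E' s‖ ≤ c / (2 * M) * M := by gcongr; exact hME s
    have h3 : c / (2 * M) * M = c / 2 := by field_simp
    linarith
  · push Not at hfar
    obtain ⟨j, hj⟩ := hfar
    have h1 := hE.add_int (t - j) j
    rw [sub_add_cancel] at h1
    set x := t - s - j with hx
    have h2 := (H s (t - j) (by rw [show t - j - s = x by rw [hx]; ring]; exact hj.le)).1
    rw [← h1, ht, add_sub_cancel_left] at h2
    rw [show ((t - j : ℝ) : ℂ) - s = (x : ℂ) by rw [hx]; push_cast; ring,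
      show t - j - s = x by rw [hx]; ring, ← sub_mul, norm_mul] at h2
    have h3 : |x| ≤ ‖Complex.I * δ - x‖ := by
      have := Complex.abs_re_le_norm (Complex.I * δ - x)
      simpa using this
    have h4 : |δ| ≤ ‖Complex.I * δ - x‖ := by
      have := Complex.abs_im_le_norm (Complex.I * δ - x)
      simpa using this
    have h5 : ‖Complex.I * δ - x‖ * m ≤ ‖Complex.I * δ - x‖ * ‖E' s‖ := by
      gcongr; exact hmE s
    have h6 : 0 < |δ| := abs_pos.2 hδ
    nlinarith

/-- Crossing the curve should change the integral by one unit `2π`; a bound below two units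
suffices. Near the base point the difference of the integrands is dominated by a multiple of the
Poisson kernel `δ / (t² + δ²)`, whose integral is less than `π`. -/
theorem exists_jump_lt : ∃ δ₁ > 0, ∀ δ : ℝ, 0 < δ → δ ≤ δ₁ →
    (∀ t, E t ≠ E 0 + Complex.I * δ * E' 0) →
    (∀ t, E t ≠ E 0 + Complex.I * (-δ : ℝ) * E' 0) →
    ‖windingIntegral E E' (E 0 + Complex.I * δ * E' 0) -
      windingIntegral E E' (E 0 + Complex.I * (-δ : ℝ) * E' 0)‖ < 4 * Real.pi := by
  set m := ‖E' 0‖ with hm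
  have hm0 : 0 < m := norm_pos_iff.2 (hE.deriv_ne_zero 0)
  obtain ⟨M, hM, hME⟩ := hE.exists_bound
  obtain ⟨h₀, hh₀, H⟩ := hE.exists_norm_sub_sub_le (η := m / 10) (by positivity)
  set h := min h₀ (1 / 2) with hh
  have hhpos : 0 < h := by positivity
  obtain ⟨c, hc, hsep⟩ := hE.exists_separation hhpos
  set K := M * (2 * m) / (c / 2) ^ 2 with hK
  have hKpos : 0 < K := by positivity
  -- The first bound keeps both points at distance `c / 2` from the far part of the curve, the
  -- second makes the far contribution at most `1`. The total is below `(14 / 5) π + 1 < 4π`.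
  refine ⟨min (c / (2 * m)) (1 / K), by positivity, fun δ hδ hδ1 hp hp' => ?_⟩
  have hδc : δ * m ≤ c / 2 := by
    have : δ * m ≤ c / (2 * m) * m := by gcongr; exact hδ1.trans (min_le_left _ _)
    have h3 : c / (2 * m) * m = c / 2 := by field_simp
    linarith
  have hδK : K * δ ≤ 1 := by
    have := (le_div_iff₀ hKpos).1 (hδ1.trans (min_le_right _ _))
    linarith
  set p := E 0 + Complex.I * δ * E' 0 with hpdef
  set p' := E 0 + Complex.I * (-δ : ℝ) * E' 0 with hpdef'
  have hpp : ‖p - p'‖ = δ * (2 * m) := by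
    rw [show p - p' = (2 * δ : ℝ) * (Complex.I * E' 0) by rw [hpdef, hpdef']; push_cast; ring,
      norm_mul, norm_mul, Complex.norm_I, Complex.norm_real, Real.norm_of_nonneg (by positivity)]
    ring
  have hper : Function.Periodic (fun t => E' t / (E t - p) - E' t / (E t - p')) 1 := fun t => by
    have h1 := hE.add_int t 1
    have h2 := hE.deriv_add_int t 1
    push_cast at h1 h2
    simp only [h1, h2]
  have hc1 := hE.continuous_integrand hp
  have hc2 := hE.continuous_integrand hp'
  have hint : windingIntegral E E' p - windingIntegral E E' p' =
      ∫ t in (-(1 / 2) : ℝ)..(1 / 2), (E' t / (E t - p) - E' t / (E t - p')) := by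
    rw [windingIntegral, windingIntegral, ← intervalIntegral.integral_sub
      (hc1.intervalIntegrable _ _) (hc2.intervalIntegrable _ _)]
    have := hper.intervalIntegral_add_eq 0 (-(1 / 2))
    rw [zero_add, show (-(1 / 2) + 1 : ℝ) = 1 / 2 by norm_num] at this
    exact this
  -- lower bound for the denominators near the base point
  have hnear : ∀ t : ℝ, |t| ≤ h₀ → ∀ σ : ℝ, |σ| = δ →
      9 / 10 * m * Real.sqrt (t ^ 2 + δ ^ 2) ≤ ‖E t - (E 0 + Complex.I * σ * E' 0)‖ := by
    intro t ht σ hσ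
    have h1 := (H 0 t (by simpa using ht)).1
    simp only [Complex.ofReal_zero, sub_zero] at h1
    have h2 : ‖(t - Complex.I * σ : ℂ)‖ = Real.sqrt (t ^ 2 + δ ^ 2) := by
      rw [Complex.norm_eq_sqrt_sq_add_sq]
      simp [← hσ]
    have h3 : |t| ≤ Real.sqrt (t ^ 2 + δ ^ 2) := Real.abs_le_sqrt (by nlinarith)
    have h4 := norm_sub_norm_le ((t - Complex.I * σ) * E' 0) (-(E t - E 0 - t * E' 0))
    rw [norm_neg, norm_mul, h2, show (t - Complex.I * σ) * E' 0 - -(E t - E 0 - t * E' 0) =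
      E t - (E 0 + Complex.I * σ * E' 0) by ring] at h4
    rw [← hm] at h4
    nlinarith
  have hbound : ∀ t : ℝ, |t| ≤ 1 / 2 → ‖E' t / (E t - p) - E' t / (E t - p')‖ ≤
      14 / 5 * (δ / (t ^ 2 + δ ^ 2)) + K * δ := by
    intro t ht
    have h1 : E' t / (E t - p) - E' t / (E t - p') = E' t * (p - p') / ((E t - p) * (E t - p')) := by
      rw [div_sub_div _ _ (sub_ne_zero.2 (hp t)) (sub_ne_zero.2 (hp' t))]
      ring
    rw [h1, norm_div, norm_mul, norm_mul, hpp]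
    have htd : 0 < t ^ 2 + δ ^ 2 := by positivity
    by_cases hth : |t| ≤ h₀
    · have h2 := hnear t hth δ (abs_of_pos hδ)
      have h3 := hnear t hth (-δ) (by rw [abs_neg, abs_of_pos hδ])
      have h4 : ‖E' t‖ ≤ 11 / 10 * m := by
        have := (H 0 t (by simpa using hth)).2
        have h5 := norm_sub_norm_le (E' t) (E' 0)
        linarith
      have h5 : (81 / 100) * m ^ 2 * (t ^ 2 + δ ^ 2) ≤ ‖E t - p‖ * ‖E t - p'‖ := by
        have := mul_le_mul h2 h3 (by positivity) (norm_nonneg _)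
        have h6 := Real.mul_self_sqrt htd.le
        calc _ = (9 / 10 * m * Real.sqrt (t ^ 2 + δ ^ 2)) *
              (9 / 10 * m * Real.sqrt (t ^ 2 + δ ^ 2)) := by
                linear_combination (-(81 / 100) * m ^ 2) * h6
          _ ≤ _ := this
      calc ‖E' t‖ * (δ * (2 * m)) / (‖E t - p‖ * ‖E t - p'‖)
          ≤ (11 / 10 * m) * (δ * (2 * m)) / ((81 / 100) * m ^ 2 * (t ^ 2 + δ ^ 2)) := by gcongr
        _ = 220 / 81 * (δ / (t ^ 2 + δ ^ 2)) := by field_simp; norm_num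
        _ ≤ 14 / 5 * (δ / (t ^ 2 + δ ^ 2)) :=
            mul_le_mul_of_nonneg_right (by norm_num) (by positivity)
        _ ≤ _ := le_add_of_nonneg_right (by positivity)
    · push Not at hth
      have h2 : c ≤ ‖E t - E 0‖ := hsep 0 t fun j => by
        rw [sub_zero]
        rcases eq_or_ne j 0 with rfl | hj
        · rw [Int.cast_zero, sub_zero]
          exact (min_le_left _ _).trans hth.le
        · have h3 : (1 : ℝ) ≤ |(j : ℝ)| := by exact_mod_cast Int.one_le_abs hj
          have h4 := abs_sub_abs_le_abs_sub (j : ℝ) t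
          rw [abs_sub_comm] at h4
          exact (min_le_right _ _).trans (by linarith)
      have h3 : ∀ σ : ℝ, |σ| = δ → c / 2 ≤ ‖E t - (E 0 + Complex.I * σ * E' 0)‖ := fun σ hσ => by
        have h4 := norm_sub_norm_le (E t - E 0) (Complex.I * σ * E' 0)
        rw [sub_sub, norm_mul, norm_mul, Complex.norm_I, one_mul, Complex.norm_real,
          Real.norm_eq_abs, hσ] at h4
        linarith
      have h4 := h3 δ (abs_of_pos hδ)
      have h5 := h3 (-δ) (by rw [abs_neg, abs_of_pos hδ])
      calc ‖E' t‖ * (δ * (2 * m)) / (‖E t - p‖ * ‖E t - p'‖)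
          ≤ M * (δ * (2 * m)) / (c / 2 * (c / 2)) := by gcongr; exact hME t
        _ = K * δ := by rw [hK]; ring
        _ ≤ _ := le_add_of_nonneg_left (by positivity)
  have harctan : ∀ t : ℝ, HasDerivAt (fun t => 14 / 5 * Real.arctan (t / δ) + K * δ * t)
      (14 / 5 * (δ / (t ^ 2 + δ ^ 2)) + K * δ) t := fun t => by
    convert! ((((hasDerivAt_id t).div_const δ).arctan).const_mul (14 / 5)).add
      ((hasDerivAt_id t).const_mul (K * δ)) using 1
    simp only [id_eq]
    field_simp
    ring
  have hgc : Continuous fun t : ℝ => 14 / 5 * (δ / (t ^ 2 + δ ^ 2)) + K * δ := by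
    have : ∀ t : ℝ, t ^ 2 + δ ^ 2 ≠ 0 := fun t => by positivity
    fun_prop (disch := exact this _)
  rw [hint]
  refine (intervalIntegral.norm_integral_le_of_norm_le (by norm_num)
    (Filter.Eventually.of_forall fun t ht => hbound t (abs_le.2 ⟨ht.1.le, ht.2⟩))
    (hgc.intervalIntegrable _ _)).trans_lt ?_
  rw [intervalIntegral.integral_eq_sub_of_hasDerivAt (fun t _ => harctan t)
    (hgc.intervalIntegrable _ _)]
  have h1 := Real.arctan_lt_pi_div_two (1 / 2 / δ)
  have h2 := Real.neg_pi_div_two_lt_arctan (-(1 / 2) / δ)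
  linarith [Real.pi_gt_three]

/-- At an extremal point of the modulus the curve is tangent to a circle around `0`. -/
theorem exists_eq_of_isLocalExtr {s : ℝ} (h : IsLocalExtr (fun t => ‖E t‖ ^ 2) s)
    (h0 : E s ≠ 0) : ∃ r : ℝ, r ≠ 0 ∧ E' s = Complex.I * r * E s := by
  have h1 := h.hasDerivAt_eq_zero (hE.hasDerivAt s).norm_sq
  rw [Complex.inner] at h1
  have h2 : (E' s / E s).re = 0 := by
    rw [Complex.div_re]
    simp only [Complex.mul_re, Complex.conj_re, Complex.conj_im] at h1
    rw [← add_div]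
    rw [show (E' s).re * (E s).re + (E' s).im * (E s).im = 0 by linarith, zero_div]
  have h3 : E' s = Complex.I * (E' s / E s).im * E s := by
    have h4 := Complex.re_add_im (E' s / E s)
    rw [h2, Complex.ofReal_zero, zero_add] at h4
    rw [mul_comm Complex.I, h4, div_mul_cancel₀ _ h0]
  refine ⟨(E' s / E s).im, fun hr => hE.deriv_ne_zero s ?_, h3⟩
  rw [h3, hr]; simp

/-- The winding number of a simple closed curve around a point is `0` or `±1`. -/
theorem windingIntegral_zero (h0 : ∀ t, E t ≠ 0) :
    ∃ k : ℤ, |k| ≤ 1 ∧ windingIntegral E E' 0 = 2 * Real.pi * Complex.I * k := by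
  -- Sliding along the curve shows that all points just off it have only two winding values, one per
  -- side. The origin is joined radially to the point of minimal modulus and infinity to the one of
  -- maximal modulus, where the normal is radial. So the value at `0` and the value `0` at infinity
  -- are both among these two, which differ by less than `4π`.
  obtain ⟨δ₀, hδ₀, htube⟩ := hE.exists_tube
  obtain ⟨δ₁, hδ₁, hjump⟩ := hE.exists_jump_lt
  set ε := min δ₀ δ₁ with hε
  have hεpos : 0 < ε := by positivity
  set N : ℝ → ℝ → ℂ := fun s δ => windingIntegral E E' (E s + Complex.I * δ * E' s) with hN
  have hshift : ∀ s δ, δ ≠ 0 → |δ| ≤ ε → N s δ = N 0 δ := fun s δ hδ hδε =>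
    hE.windingIntegral_const (s := Set.univ) isPreconnected_univ
      (p := fun s => E s + Complex.I * δ * E' s)
      (hE.continuous.add (continuous_const.mul hE.continuous_deriv)).continuousOn
      (fun x _ t => htube x δ hδ (hδε.trans (min_le_left _ _)) t) (Set.mem_univ _) (Set.mem_univ _)
  have hpos : ∀ δ, 0 < δ → δ ≤ ε → N 0 δ = N 0 ε := fun δ h1 h2 =>
    hE.windingIntegral_const (s := Set.Ioc 0 ε) isPreconnected_Ioc
      (p := fun δ => E 0 + Complex.I * δ * E' 0) (by fun_prop)
      (fun x hx t => htube 0 x hx.1.ne' (by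
        rw [abs_of_pos hx.1]; exact hx.2.trans (min_le_left _ _)) t) ⟨h1, h2⟩ ⟨hεpos, le_rfl⟩
  have hneg : ∀ δ, δ < 0 → -ε ≤ δ → N 0 δ = N 0 (-ε) := fun δ h1 h2 =>
    hE.windingIntegral_const (s := Set.Ico (-ε) 0) isPreconnected_Ico
      (p := fun δ => E 0 + Complex.I * δ * E' 0) (by fun_prop)
      (fun x hx t => htube 0 x hx.2.ne (by
        rw [abs_of_neg hx.2]; linarith [hx.1, min_le_left δ₀ δ₁]) t)
      ⟨h2, h1⟩ ⟨le_rfl, by linarith⟩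
  have hside : ∀ s δ, δ ≠ 0 → |δ| ≤ ε → N s δ = N 0 ε ∨ N s δ = N 0 (-ε) := fun s δ h1 h2 => by
    rw [hshift s δ h1 h2]
    rcases lt_or_gt_of_ne h1 with h3 | h3
    · exact Or.inr (hneg δ h3 (by linarith [neg_abs_le δ]))
    · exact Or.inl (hpos δ h3 (by linarith [le_abs_self δ]))
  have hj : ‖N 0 ε - N 0 (-ε)‖ < 4 * Real.pi :=
    hjump ε hεpos (min_le_right _ _)
      (htube 0 ε hεpos.ne' (by rw [abs_of_pos hεpos]; exact min_le_left _ _))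
      (htube 0 (-ε) (by linarith) (by rw [abs_neg, abs_of_pos hεpos]; exact min_le_left _ _))
  have hcn : ContinuousOn (fun t => ‖E t‖ ^ 2) (Set.Icc 0 1) :=
    (hE.continuous.norm.pow 2).continuousOn
  have hfr : ∀ t, E (Int.fract t) = E t := fun t => by
    rw [← hE.add_int (Int.fract t) ⌊t⌋, Int.fract_add_floor]
  -- radial points next to an extremal point
  have hradial : ∀ s, IsLocalExtr (fun t => ‖E t‖ ^ 2) s → ∀ σ : ℝ, |σ| = 1 →
      ∃ x : ℝ, 0 < x ∧ x ≤ 1 ∧ (windingIntegral E E' ((1 + σ * x : ℝ) * E s) = N 0 ε ∨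
        windingIntegral E E' ((1 + σ * x : ℝ) * E s) = N 0 (-ε)) := by
    intro s hs σ hσ
    obtain ⟨r, hr, hrE⟩ := hE.exists_eq_of_isLocalExtr hs (h0 s)
    have hr0 : 0 < |r| := abs_pos.2 hr
    set x := min 1 (ε * |r|) with hx
    have hx0 : 0 < x := by positivity
    refine ⟨x, hx0, min_le_left _ _, ?_⟩
    have hσ0 : σ ≠ 0 := by rintro rfl; simp at hσ
    have h1 := hside s (-(σ * x / r)) (neg_ne_zero.2 (div_ne_zero (mul_ne_zero hσ0 hx0.ne') hr)) (by
      rw [abs_neg, abs_div, abs_mul, hσ, one_mul, abs_of_pos hx0, div_le_iff₀ hr0]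
      exact min_le_right _ _)
    have h2 : E s + Complex.I * (-(σ * x / r) : ℝ) * E' s = (1 + σ * x : ℝ) * E s := by
      have hrc : (r : ℂ) ≠ 0 := Complex.ofReal_ne_zero.2 hr
      rw [hrE]
      push_cast
      field_simp
      linear_combination (-(σ * x * E s) : ℂ) * Complex.I_sq
    simp only [hN] at h1
    rwa [h2] at h1
  have hzero : windingIntegral E E' 0 = N 0 ε ∨ windingIntegral E E' 0 = N 0 (-ε) := by
    obtain ⟨s, -, hs⟩ := isCompact_Icc.exists_isMinOn ⟨0, by simp⟩ hcn
    have hmin : ∀ t, ‖E s‖ ≤ ‖E t‖ := fun t => by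
      have h1 : ‖E s‖ ^ 2 ≤ ‖E (Int.fract t)‖ ^ 2 :=
        hs ⟨Int.fract_nonneg t, (Int.fract_lt_one t).le⟩
      rw [hfr] at h1
      exact (pow_le_pow_iff_left₀ (norm_nonneg _) (norm_nonneg _) two_ne_zero).1 h1
    obtain ⟨x, hx0, hx1, hx⟩ := hradial s (Or.inl (Filter.Eventually.of_forall fun t => by
      simp only; gcongr; exact hmin t)) (-1) (by simp)
    have h1 : windingIntegral E E' ((0 : ℝ) * E s) =
        windingIntegral E E' ((1 + -1 * x : ℝ) * E s) := by
      refine hE.windingIntegral_const (s := Set.Ico 0 1) isPreconnected_Ico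
        (p := fun τ : ℝ => (τ : ℂ) * E s) (by fun_prop) (fun τ hτ t ht => ?_)
        ⟨le_rfl, one_pos⟩ ⟨by linarith, by linarith⟩
      have h2 := hmin t
      rw [ht, norm_mul, Complex.norm_real, Real.norm_of_nonneg hτ.1] at h2
      nlinarith [hτ.2, norm_pos_iff.2 (h0 s)]
    rw [Complex.ofReal_zero, zero_mul] at h1
    rwa [h1]
  have hinf : 0 = N 0 ε ∨ 0 = N 0 (-ε) := by
    obtain ⟨s, -, hs⟩ := isCompact_Icc.exists_isMaxOn ⟨0, by simp⟩ hcn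
    have hmax : ∀ t, ‖E t‖ ≤ ‖E s‖ := fun t => by
      have h1 : ‖E (Int.fract t)‖ ^ 2 ≤ ‖E s‖ ^ 2 :=
        hs ⟨Int.fract_nonneg t, (Int.fract_lt_one t).le⟩
      rw [hfr] at h1
      exact (pow_le_pow_iff_left₀ (norm_nonneg _) (norm_nonneg _) two_ne_zero).1 h1
    have hs0 : 0 < ‖E s‖ := norm_pos_iff.2 (h0 s)
    obtain ⟨x, hx0, hx1, hx⟩ := hradial s (Or.inr (Filter.Eventually.of_forall fun t => by
      simp only; gcongr; exact hmax t)) 1 (by simp)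
    obtain ⟨M, hM, hME⟩ := hE.exists_bound
    -- At this distance the integrand is bounded by `1`, so the integral, a multiple of `2πi`,
    -- vanishes.
    set τ₀ := 1 + M / ‖E s‖ with hτ₀
    have hτ₀1 : 1 < τ₀ := by rw [hτ₀]; linarith [div_pos hM hs0]
    have hne : ∀ τ ∈ Set.Ioi (1 : ℝ), ∀ t, E t ≠ (τ : ℂ) * E s := fun τ hτ t ht => by
      have hτ' : 1 < τ := hτ
      have h2 := hmax t
      rw [ht, norm_mul, Complex.norm_real, Real.norm_of_nonneg (by linarith)] at h2
      nlinarith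
    have h1 : windingIntegral E E' ((τ₀ : ℝ) * E s) =
        windingIntegral E E' ((1 + 1 * x : ℝ) * E s) :=
      hE.windingIntegral_const (s := Set.Ioi 1) isPreconnected_Ioi
        (p := fun τ : ℝ => (τ : ℂ) * E s) (by fun_prop) hne hτ₀1
        (show (1 : ℝ) < 1 + 1 * x by linarith)
    have h2 : ‖windingIntegral E E' ((τ₀ : ℝ) * E s)‖ ≤ 1 * |(1 : ℝ) - 0| := by
      refine intervalIntegral.norm_integral_le_of_norm_le_const fun t _ => ?_
      rw [norm_div]
      have h3 := norm_sub_norm_le ((τ₀ : ℂ) * E s) (E t)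
      rw [norm_mul, Complex.norm_real, Real.norm_of_nonneg (by linarith), norm_sub_rev] at h3
      have h4 : τ₀ * ‖E s‖ = ‖E s‖ + M := by rw [hτ₀]; field_simp
      have h5 : M ≤ ‖E t - τ₀ * E s‖ := by linarith [hmax t]
      rw [div_le_one (by linarith)]
      exact (hME t).trans h5
    obtain ⟨k, hk⟩ := hE.windingIntegral_mem (hne τ₀ hτ₀1)
    have hk0 : k = 0 := by
      rw [hk] at h2
      simp only [norm_mul, Complex.norm_ofNat, Complex.norm_real, Complex.norm_I,
        Complex.norm_intCast, Real.norm_of_nonneg Real.pi_pos.le] at h2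
      by_contra hne
      have h3 : (1 : ℝ) ≤ |(k : ℝ)| := by exact_mod_cast Int.one_le_abs hne
      norm_num at h2
      nlinarith [Real.pi_gt_three]
    rw [← h1, hk, hk0] at hx
    simpa using hx
  obtain ⟨k, hk⟩ := hE.windingIntegral_mem h0
  refine ⟨k, ?_, hk⟩
  have hlt : ‖windingIntegral E E' 0‖ < 4 * Real.pi := by
    have hp4 : (0 : ℝ) < 4 * Real.pi := by positivity
    rcases hzero with h1 | h1 <;> rcases hinf with h2 | h2
    · rw [h1, ← h2, norm_zero]; exact hp4
    · rw [h1]; rw [← h2, sub_zero] at hj; exact hj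
    · rw [h1]; rw [← h2, zero_sub, norm_neg] at hj; exact hj
    · rw [h1, ← h2, norm_zero]; exact hp4
  rw [hk] at hlt
  simp only [norm_mul, Complex.norm_ofNat, Complex.norm_real, Complex.norm_I,
    Complex.norm_intCast, Real.norm_of_nonneg Real.pi_pos.le] at hlt
  have h3 : |(k : ℝ)| < 2 := by nlinarith [Real.pi_pos]
  have h4 : |k| < 2 := by exact_mod_cast h3
  omega

end IsSimpleClosedCurve

/-! ### Stokes loops go around the cylinder once. -/

theorem IsSimpleClosedCurveModZ.add_int_mul {γ : ℝ → ℂ} {m : ℤ} (hm : ∀ t, γ (t + 1) = γ t + m)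
    (t : ℝ) (j : ℤ) : γ (t + j) = γ t + j * m := by
  have h : Function.Periodic (fun t : ℝ => γ t - t * m) 1 := fun t => by
    simp only [hm]
    push_cast
    ring
  have h1 := h.int_mul j t
  rw [mul_one] at h1
  push_cast at h1
  linear_combination h1

/-- The map `exp (2πiz)` embeds the cylinder in the plane, and `m` becomes the winding number around
`0` of a simple closed curve. -/
theorem IsSimpleClosedCurveModZ.abs_le_one {γ : ℝ → ℂ} (h : IsSimpleClosedCurveModZ γ) {m : ℤ}
    (hm : ∀ t, γ (t + 1) = γ t + m) : |m| ≤ 1 := by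
  have hdiff : ∀ t, HasDerivAt γ (deriv γ t) t := fun t =>
    (h.smooth.differentiable (by simp) t).hasDerivAt
  have hcont : Continuous (deriv γ) := h.smooth.continuous_deriv (by simp)
  have hE : IsSimpleClosedCurve (fun t => Complex.exp (2 * Real.pi * Complex.I * γ t))
      (fun t => Complex.exp (2 * Real.pi * Complex.I * γ t) *
        (2 * Real.pi * Complex.I * deriv γ t)) :=
    { hasDerivAt := fun t => ((hdiff t).const_mul _).cexp
      continuous_deriv := by
        have := h.smooth.continuous
        fun_prop
      periodic := fun t => by
        simp only [hm]
        rw [Complex.exp_eq_exp_iff_exists_int]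
        exact ⟨m, by ring⟩
      injective := fun s t hst => by
        obtain ⟨k, hk⟩ := Complex.exp_eq_exp_iff_exists_int.1 hst
        refine h.simple s t ⟨k, mul_left_cancel₀ Complex.two_pi_I_ne_zero ?_⟩
        rw [hk]
        ring
      deriv_ne_zero := fun t => mul_ne_zero (Complex.exp_ne_zero _)
        (mul_ne_zero Complex.two_pi_I_ne_zero (h.deriv_ne_zero t)) }
  obtain ⟨k, hk, hk'⟩ := hE.windingIntegral_zero fun t => Complex.exp_ne_zero _
  have h1 : ∫ t in (0 : ℝ)..1, deriv γ t = m := by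
    rw [intervalIntegral.integral_eq_sub_of_hasDerivAt (fun t _ => hdiff t)
      (hcont.intervalIntegrable _ _)]
    have := hm 0
    rw [zero_add] at this
    rw [this]
    ring
  have h2 : (2 * Real.pi * Complex.I : ℂ) * m = 2 * Real.pi * Complex.I * k := by
    rw [← hk', windingIntegral, ← h1, ← intervalIntegral.integral_const_mul]
    refine intervalIntegral.integral_congr fun t _ => ?_
    have := Complex.exp_ne_zero (2 * Real.pi * Complex.I * γ t)
    simp only [sub_zero]
    field_simp
  have h3 : m = k := by exact_mod_cast mul_left_cancel₀ Complex.two_pi_I_ne_zero h2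
  rwa [h3]

/-- Along a Stokes loop this `F` has real derivative, so it supplies the new real parameter;
division by the mean makes it commute with the unit translation. -/
theorem exists_normalized_primitive {W : ℂ → ℂ} (hW : Differentiable ℂ W)
    (hper : ∀ z : ℂ, W (z + 1) = W z) (hW₀ : meanValue W ≠ 0) :
    ∃ F : ℂ → ℂ, (∀ z, HasDerivAt F ((meanValue W)⁻¹ * W z) z) ∧ ∀ z, F (z + 1) = F z + 1 := by
  obtain ⟨G, hG⟩ : ∃ G : ℂ → ℂ, ∀ z, HasDerivAt G (W z) z :=
    ⟨primitive W, hasDerivAt_primitive hW⟩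
  refine ⟨fun z => (meanValue W)⁻¹ * G z, fun z => (hG z).const_mul _, fun z => ?_⟩
  have h1 : ∀ z, HasDerivAt (fun z => G (z + 1) - G z) 0 z := fun z => by
    have := ((hG (z + 1)).comp_add_const z 1).sub (hG z)
    rwa [hper, sub_self] at this
  have h2 := is_const_of_deriv_eq_zero (fun z => (h1 z).differentiableAt)
    (fun z => (h1 z).deriv) z 0
  have h3 : meanValue W = G 1 - G 0 := by
    have := intervalIntegral.integral_eq_sub_of_hasDerivAt (a := 0) (b := 1)
      (fun x _ => (hG (x : ℝ)).comp_ofReal)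
      ((hW.continuous.comp Complex.continuous_ofReal).intervalIntegrable _ _)
    simpa [meanValue] using this
  simp only [zero_add] at h2
  rw [← h3] at h2
  simp only
  rw [show G (z + 1) = meanValue W + G z by linear_combination h2]
  field_simp
  ring

/-- A Stokes loop is an integral curve of `W₀ / W`, parametrized over `ℝ` with period one. -/
theorem IsStokesLoop.exists_parametrization {W : ℂ → ℂ} (hW : Differentiable ℂ W)
    (hper : ∀ z : ℂ, W (z + 1) = W z) (hW₀ : meanValue W ≠ 0) {γ : ℝ → ℂ}
    (h : IsStokesLoop W γ) :
    ∃ σ : ℝ → ℂ, (∀ s, W (σ s) ≠ 0) ∧ (∀ s, HasDerivAt σ (meanValue W / W (σ s)) s) ∧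
      (∀ s, σ (s + 1) = σ s + 1) ∧ Function.Injective σ := by
  obtain ⟨F, hF, hF1⟩ := exists_normalized_primitive hW hper hW₀
  obtain ⟨m, hm⟩ := h.closed
  have hFint : ∀ z (j : ℤ), F (z + j) = F z + j := fun z j => by
    have h1 : Function.Periodic (fun z => F z - z) 1 := fun z => by
      simp only [hF1]
      ring
    have h2 := h1.int_mul j z
    rw [mul_one] at h2
    linear_combination h2
  have hdiff : ∀ t, HasDerivAt γ (deriv γ t) t := fun t =>
    (h.smooth.differentiable (by simp) t).hasDerivAt
  have hFγ : ∀ t, HasDerivAt (fun t => F (γ t)) ((meanValue W)⁻¹ * W (γ t) * deriv γ t) t :=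
    fun t => (hF (γ t)).comp t (hdiff t)
  have hreal : ∀ t, (meanValue W)⁻¹ * W (γ t) * deriv γ t =
      (((meanValue W)⁻¹ * W (γ t) * deriv γ t).re : ℂ) := fun t => by
    have h1 := h.im_eq_zero t
    rw [mul_assoc, mul_comm] at h1
    exact Complex.ext rfl (by rw [h1, Complex.ofReal_im])
  set r : ℝ → ℝ := fun t => (F (γ t)).re with hr
  have hr' : ∀ t, HasDerivAt r ((meanValue W)⁻¹ * W (γ t) * deriv γ t).re t := fun t =>
    Complex.reCLM.hasFDerivAt.comp_hasDerivAt t (hFγ t)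
  have hr'0 : ∀ t, ((meanValue W)⁻¹ * W (γ t) * deriv γ t).re ≠ 0 := fun t h0 => by
    have h1 := hreal t
    rw [h0, Complex.ofReal_zero] at h1
    exact mul_ne_zero (mul_ne_zero (inv_ne_zero hW₀) (h.ne_zero t)) (h.deriv_ne_zero t) h1
  have hrinj : Function.Injective r := by
    have key : ∀ s t, s < t → r s ≠ r t := fun s t hst heq => by
      obtain ⟨c, _, hc⟩ := exists_hasDerivAt_eq_zero hst
        (fun x _ => (hr' x).continuousAt.continuousWithinAt) heq fun x _ => hr' x
      exact hr'0 c hc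
    intro s t hst
    by_contra hne
    rcases lt_or_gt_of_ne hne with h1 | h1
    exacts [key s t h1 hst, key t s h1 hst.symm]
  have hrint : ∀ t (j : ℤ), r (t + j) = r t + j * m := fun t j => by
    simp only [hr]
    rw [IsSimpleClosedCurveModZ.add_int_mul hm, ← Int.cast_mul, hFint, Complex.add_re,
      Complex.intCast_re]
    push_cast
    ring
  -- A contractible loop would return `r` to its initial value, although `r` is injective.
  have hm0 : m ≠ 0 := fun h0 => by
    have h1 := hrint 0 1
    rw [h0, Int.cast_zero, mul_zero, add_zero] at h1
    simpa using hrinj h1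
  have hmm : m * m = 1 := by
    have h1 := h.abs_le_one hm
    rw [abs_le] at h1
    have : m = 1 ∨ m = -1 := by omega
    rcases this with rfl | rfl <;> norm_num
  have hmmR : (m : ℝ) * m = 1 := by exact_mod_cast hmm
  have hmmC : (m : ℂ) * m = 1 := by exact_mod_cast hmm
  have hrcont : Continuous r := continuous_iff_continuousAt.2 fun t => (hr' t).continuousAt
  have hrsurj : Function.Surjective r := fun y => by
    refine mem_range_of_exists_le_of_exists_ge hrcont ?_ ?_
    · refine ⟨0 + ((⌊y - r 0⌋ * m : ℤ) : ℝ), ?_⟩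
      rw [hrint, Int.cast_mul, mul_assoc, hmmR, mul_one]
      linarith [Int.floor_le (y - r 0)]
    · refine ⟨0 + ((⌈y - r 0⌉ * m : ℤ) : ℝ), ?_⟩
      rw [hrint, Int.cast_mul, mul_assoc, hmmR, mul_one]
      linarith [Int.le_ceil (y - r 0)]
  obtain ⟨g, hgl, hgr⟩ := Function.bijective_iff_has_inverse.1 ⟨hrinj, hrsurj⟩
  have hFdiff : Differentiable ℂ F := fun z => (hF z).differentiableAt
  have hrsmooth : ContDiff ℝ 1 r :=
    Complex.reCLM.contDiff.comp
      ((hFdiff.contDiff.restrict_scalars ℝ).comp (h.smooth.of_le (by simp)))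
  have hg' : ∀ s, HasDerivAt g (((meanValue W)⁻¹ * W (γ (g s)) * deriv γ (g s)).re)⁻¹ s := by
    intro s
    have h1 : HasStrictDerivAt r _ (g s) :=
      (hrsmooth.contDiffAt).hasStrictDerivAt' (hr' (g s)) (by simp)
    have h2 := h1.to_local_left_inverse (hr'0 _) (Filter.Eventually.of_forall hgl)
    rw [hgr] at h2
    exact h2.hasDerivAt
  refine ⟨fun s => γ (g s), fun s => h.ne_zero _, fun s => ?_, fun s => ?_, fun s t hst => ?_⟩
  · have h1 := (hdiff (g s)).scomp s (hg' s)
    have h2 := h.ne_zero (g s)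
    have h3 := h.deriv_ne_zero (g s)
    rw [Complex.real_smul, Complex.ofReal_inv, ← hreal,
      show ((meanValue W)⁻¹ * W (γ (g s)) * deriv γ (g s))⁻¹ * deriv γ (g s) =
        meanValue W / W (γ (g s)) by field_simp] at h1
    exact h1
  · have h1 : g (s + 1) = g s + m := hrinj (by rw [hgr, hrint, hgr, hmmR])
    simp only [h1]
    rw [IsSimpleClosedCurveModZ.add_int_mul hm, hmmC]
  · have h1 : r (g s) = r (g t) := congrArg (fun z => (F z).re) hst
    rwa [hgr, hgr] at h1

/-! ### Periodic square root of the tangent and Liouville data. -/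

theorem exists_continuous_log {X : Type*} [TopologicalSpace X] [LocallyPathConnectedSpace X]
    [SimplyConnectedSpace X] {h : X → ℂ} (hc : Continuous h) (h0 : ∀ x, h x ≠ 0) :
    ∃ l : X → ℂ, Continuous l ∧ ∀ x, Complex.exp (l x) = h x := by
  have hU : IsSimplyConnected (Set.univ : Set X) :=
    (Homeomorph.Set.univ X).toHomotopyEquiv.simplyConnectedSpace
  obtain ⟨l, hl, hl'⟩ := Complex.exists_continuousOn_eqOn_exp_comp hU isOpen_univ hc.continuousOn
    (by rintro ⟨x, -, hx⟩; exact h0 x hx)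
  exact ⟨l, continuousOn_univ.1 hl, fun x => hl' (Set.mem_univ x)⟩

/-- The tangent of an injective curve in `ℂ` which is invariant under the unit translation has
winding number zero; in particular it has a periodic inverse square root. -/
theorem exists_periodic_sqrt_inv_deriv {σ σ' : ℝ → ℂ} (hσ : ∀ s, HasDerivAt σ (σ' s) s)
    (hσ' : Continuous σ') (h0 : ∀ s, σ' s ≠ 0) (hinj : Function.Injective σ)
    (h1 : ∀ s, σ (s + 1) = σ s + 1) :
    ∃ ρ : ℝ → ℂ, Continuous ρ ∧ (∀ s, ρ (s + 1) = ρ s) ∧ ∀ s, ρ s ^ 2 = (σ' s)⁻¹ := by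
  have hper : ∀ s, σ' (s + 1) = σ' s := fun s => by
    have h2 := (hσ (s + 1)).comp_add_const s 1
    have h3 := (hσ s).add_const 1
    simp only [h1] at h2
    exact h2.unique h3
  -- Hopf's device: the secant slope `(σ s - σ t) / (s - t)`, extended by `σ'` across the diagonal.
  -- Injectivity makes it nonzero on the whole plane, which is simply connected, so it has a
  -- logarithm.
  set h : ℝ × ℝ → ℂ := fun p => ∫ u in (0 : ℝ)..1, σ' (p.2 + (p.1 - p.2) * u) with hh
  have hcont : Continuous h :=
    intervalIntegral.continuous_parametric_intervalIntegral_of_continuous' (by fun_prop) _ _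
  have hmul : ∀ s t : ℝ, ((s - t : ℝ) : ℂ) * h (s, t) = σ s - σ t := fun s t => by
    have := intervalIntegral.smul_integral_comp_add_mul (a := 0) (b := 1) σ' (s - t) t
    rw [mul_zero, add_zero, mul_one, add_sub_cancel,
      intervalIntegral.integral_eq_sub_of_hasDerivAt (fun x _ => hσ x)
        (hσ'.intervalIntegrable _ _)] at this
    rw [← this, Complex.real_smul]
  have hdiag : ∀ s, h (s, s) = σ' s := fun s => by simp [hh]
  have hne : ∀ p, h p ≠ 0 := by
    rintro ⟨s, t⟩ hst
    rcases eq_or_ne s t with rfl | hne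
    · rw [hdiag] at hst
      exact h0 s hst
    · have h2 := hmul s t
      rw [hst, mul_zero] at h2
      exact hne (hinj (sub_eq_zero.1 h2.symm))
  obtain ⟨l, hl, hexp⟩ := exists_continuous_log hcont hne
  have hshift : ∀ s t : ℝ, h (s + 1, t + 1) = h (s, t) := fun s t => by
    refine intervalIntegral.integral_congr fun u _ => ?_
    simp only
    rw [show t + 1 + (s + 1 - (t + 1)) * u = t + (s - t) * u + 1 by ring, hper]
  have hone : ∀ t : ℝ, h (t + 1, t) = 1 := fun t => by
    have h2 := hmul (t + 1) t
    rw [h1, add_sub_cancel_left, add_sub_cancel_left, Complex.ofReal_one, one_mul] at h2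
    exact h2
  have hB : ∀ s t : ℝ, l (s + 1, s) = l (t + 1, t) := fun s t => by
    refine isPreconnected_univ.eq_of_forall_exists_int (f := fun t : ℝ => l (t + 1, t))
      (by fun_prop) (fun t _ => ?_) (Set.mem_univ s) (Set.mem_univ t)
    have h2 := hexp (t + 1, t)
    rw [hone, Complex.exp_eq_one_iff] at h2
    obtain ⟨n, hn⟩ := h2
    exact ⟨n, by rw [hn]; ring⟩
  have hD : ∀ p q : ℝ × ℝ, l (p.1 + 1, p.2 + 1) - l p = l (q.1 + 1, q.2 + 1) - l q :=
    fun p q => by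
    refine isPreconnected_univ.eq_of_forall_exists_int
      (f := fun p : ℝ × ℝ => l (p.1 + 1, p.2 + 1) - l p)
      (by fun_prop) (fun p _ => ?_) (Set.mem_univ p) (Set.mem_univ q)
    have h2 := hexp (p.1 + 1, p.2 + 1)
    rw [hshift, ← hexp p, Complex.exp_eq_exp_iff_exists_int] at h2
    obtain ⟨n, hn⟩ := h2
    exact ⟨n, by simp only [hn]; ring⟩
  -- The increment of `l` under the diagonal translation is the same everywhere, and it vanishes on
  -- the line `s = t + 1`, where the slope is `1` and `l` is constant.
  have hperl : ∀ s, l (s + 1, s + 1) = l (s, s) := fun s => by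
    have h2 := hD (s, s) (0 + 1, 0)
    rw [hB (0 + 1) 0] at h2
    simpa [sub_eq_zero] using h2
  refine ⟨fun s => Complex.exp (-(l (s, s) / 2)), by fun_prop, fun s => by simp only [hperl],
    fun s => ?_⟩
  rw [← Complex.exp_nat_mul, ← hdiag, ← hexp, ← Complex.exp_neg]
  congr 1
  push_cast
  ring

/-- The slope of the square is the slope of `f` times `f y + f x`. It differentiates the square root
`ρ`, so far only known to be continuous. -/
theorem HasDerivAt.of_sq {f : ℝ → ℂ} {g' : ℂ} {x : ℝ} (hf : ContinuousAt f x) (h0 : f x ≠ 0)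
    (h : HasDerivAt (fun y => f y ^ 2) g' x) : HasDerivAt f (g' / (2 * f x)) x := by
  rw [hasDerivAt_iff_tendsto_slope] at h ⊢
  have h1 : Filter.Tendsto (fun y => f y + f x) (nhdsWithin x {x}ᶜ) (nhds (f x + f x)) :=
    (hf.tendsto.mono_left nhdsWithin_le_nhds).add_const _
  have h2 : f x + f x ≠ 0 := by
    rw [← two_mul]
    exact mul_ne_zero two_ne_zero h0
  rw [two_mul]
  refine (h.div h1 h2).congr' ?_
  filter_upwards [h1.eventually_ne h2] with y hy
  simp only [Pi.div_apply, slope_def_module, Complex.real_smul]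
  field_simp
  ring

/-- The data of the Liouville transformation along a Stokes loop. -/
theorem IsStokesLoop.exists_liouville {W : ℂ → ℂ} (hW : Differentiable ℂ W)
    (hper : ∀ z : ℂ, W (z + 1) = W z) (hW₀ : meanValue W ≠ 0) {γ : ℝ → ℂ}
    (h : IsStokesLoop W γ) :
    ∃ σ ρ ρ' ρ'' : ℝ → ℂ, (∀ s, HasDerivAt σ (ρ s ^ 2)⁻¹ s) ∧ (∀ s, HasDerivAt ρ (ρ' s) s) ∧
      (∀ s, HasDerivAt ρ' (ρ'' s) s) ∧ Continuous ρ'' ∧ (∀ s, ρ s ≠ 0) ∧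
      (∀ s, W (σ s) = meanValue W * ρ s ^ 2) ∧ (∀ s, σ (s + 1) = σ s + 1) ∧
      ∀ s, ρ (s + 1) = ρ s := by
  obtain ⟨σ, hWσ, hσ, hσ1, hinj⟩ := h.exists_parametrization hW hper hW₀
  have hσc : Continuous σ := continuous_iff_continuousAt.2 fun s => (hσ s).continuousAt
  have hWσc : Continuous fun s => W (σ s) := hW.continuous.comp hσc
  obtain ⟨ρ, hρc, hρ1, hρ⟩ := exists_periodic_sqrt_inv_deriv hσ
    (continuous_const.div hWσc hWσ) (fun s => div_ne_zero hW₀ (hWσ s)) hinj hσ1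
  have hρ2 : ∀ s, ρ s ^ 2 = W (σ s) / meanValue W := fun s => by rw [hρ, inv_div]
  have hρ0 : ∀ s, ρ s ≠ 0 := fun s h0 => by
    have h2 := hρ2 s
    rw [h0, zero_pow two_ne_zero] at h2
    exact div_ne_zero (hWσ s) hW₀ h2.symm
  have hWρ : ∀ s, W (σ s) = meanValue W * ρ s ^ 2 := fun s => by
    rw [hρ2, mul_div_cancel₀ _ hW₀]
  have hσ' : ∀ s, HasDerivAt σ (ρ s ^ 2)⁻¹ s := fun s => by
    rw [hρ, inv_inv]
    exact hσ s
  have hW' : Differentiable ℂ (deriv W) := fun z =>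
    (hW.analyticAt z).deriv.differentiableAt
  have hW'' : Continuous (deriv (deriv W)) := Differentiable.continuous fun z =>
    (hW'.analyticAt z).deriv.differentiableAt
  have hρ' : ∀ s, HasDerivAt ρ (deriv W (σ s) / (2 * meanValue W * ρ s ^ 3)) s := fun s => by
    have h2 : HasDerivAt (fun s => ρ s ^ 2) (deriv W (σ s) * (ρ s ^ 2)⁻¹ / meanValue W) s := by
      simp only [hρ2 _]
      rw [← hρ2]
      exact ((hW (σ s)).hasDerivAt.comp s (hσ' s)).div_const _
    convert HasDerivAt.of_sq hρc.continuousAt (hρ0 s) h2 using 1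
    have := hρ0 s
    field_simp
  have hd : ∀ s, 2 * meanValue W * ρ s ^ 3 ≠ 0 := fun s =>
    mul_ne_zero (mul_ne_zero two_ne_zero hW₀) (pow_ne_zero _ (hρ0 s))
  have hρ'' := fun s => (((hW' (σ s)).hasDerivAt.comp s (hσ' s)).div
    (((hρ' s).pow 3).const_mul (2 * meanValue W)) (hd s))
  refine ⟨σ, ρ, _, _, hσ', hρ', hρ'', ?_, hρ0, hWρ, hσ1, hρ1⟩
  have hW'c := hW'.continuous
  simp only [Function.comp_def]
  refine Continuous.div ?_ (by fun_prop) fun s => pow_ne_zero _ (hd s)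
  have hc1 : Continuous fun s => (ρ s ^ 2)⁻¹ := (hρc.pow 2).inv₀ fun s => pow_ne_zero _ (hρ0 s)
  have hc2 : Continuous fun s => deriv W (σ s) / (2 * meanValue W * ρ s ^ 3) :=
    Continuous.div (by fun_prop) (by fun_prop) hd
  have hc3 : Continuous fun s => deriv (deriv W) (σ s) := hW''.comp hσc
  have hc4 : Continuous fun s => deriv W (σ s) := hW'c.comp hσc
  simp only [Pi.pow_apply]
  fun_prop

/-! ### Large-parameter asymptotics for Hill's equation. -/

section Hill

variable {Q f f' : ℝ → ℂ} {β : ℂ}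

theorem hasDerivAt_mul_sub_ofReal (β : ℂ) (s t : ℝ) :
    HasDerivAt (fun t : ℝ => β * (s - t)) (-β) t := by
  simpa using ((hasDerivAt_id (t : ℂ)).comp_ofReal.const_sub (s : ℂ)).const_mul β

theorem hasDerivAt_sin_mul_sub_ofReal (β : ℂ) (s t : ℝ) :
    HasDerivAt (fun t : ℝ => Complex.sin (β * (s - t))) (Complex.cos (β * (s - t)) * -β) t :=
  (Complex.hasDerivAt_sin _).comp t (hasDerivAt_mul_sub_ofReal β s t)

theorem hasDerivAt_cos_mul_sub_ofReal (β : ℂ) (s t : ℝ) :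
    HasDerivAt (fun t : ℝ => Complex.cos (β * (s - t))) (-Complex.sin (β * (s - t)) * -β) t :=
  (Complex.hasDerivAt_cos _).comp t (hasDerivAt_mul_sub_ofReal β s t)

/-- Each integrand is an exact `t`-derivative, for instance of `f t cos β(s - t) + f' t sin β(s - t)
/ β`. -/
theorem IsSolution.variation_of_constants (hQ : Continuous Q) (hβ : β ≠ 0)
    (hf : IsSolution (fun x => Q x - β ^ 2) f f') (s : ℝ) :
    f s = f 0 * Complex.cos (β * s) + f' 0 * (Complex.sin (β * s) / β) +
        ∫ t in (0 : ℝ)..s, Complex.sin (β * (s - t)) / β * (Q t * f t) ∧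
      f' s = -(β * f 0 * Complex.sin (β * s)) + f' 0 * Complex.cos (β * s) +
        ∫ t in (0 : ℝ)..s, Complex.cos (β * (s - t)) * (Q t * f t) := by
  have hfc : Continuous f := continuous_iff_continuousAt.2 fun t => (hf t).1.continuousAt
  constructor
  · have h1 : ∀ t : ℝ, HasDerivAt (fun t : ℝ => f t * Complex.cos (β * (s - t)) +
        f' t * (Complex.sin (β * (s - t)) / β))
        (Complex.sin (β * (s - t)) / β * (Q t * f t)) t := fun t => by
      convert! ((hf t).1.mul (hasDerivAt_cos_mul_sub_ofReal β s t)).add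
        ((hf t).2.mul ((hasDerivAt_sin_mul_sub_ofReal β s t).div_const β)) using 1
      field_simp
      ring
    rw [intervalIntegral.integral_eq_sub_of_hasDerivAt (fun t _ => h1 t)
      (Continuous.intervalIntegrable (by fun_prop) _ _)]
    simp
  · have h1 : ∀ t : ℝ, HasDerivAt (fun t : ℝ => -(β * f t * Complex.sin (β * (s - t))) +
        f' t * Complex.cos (β * (s - t)))
        (Complex.cos (β * (s - t)) * (Q t * f t)) t := fun t => by
      convert! (((hf t).1.const_mul β).mul (hasDerivAt_sin_mul_sub_ofReal β s t)).neg.add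
        ((hf t).2.mul (hasDerivAt_cos_mul_sub_ofReal β s t)) using 1
      ring
    rw [intervalIntegral.integral_eq_sub_of_hasDerivAt (fun t _ => h1 t)
      (Continuous.intervalIntegrable (by fun_prop) _ _)]
    simp

theorem abs_im_mul_ofReal (β : ℂ) {s : ℝ} (hs : 0 ≤ s) : |(β * s).im| = |β.im| * s := by
  rw [Complex.im_mul_ofReal, abs_mul, abs_of_nonneg hs]

/-- An oscillatory integral with kernel of exponential type. -/
theorem norm_integral_kernel_le {k A B K : ℝ} {s : ℝ} (hs0 : 0 ≤ s) (hs1 : s ≤ 1)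
    {κ g : ℝ → ℂ} (hA : 0 ≤ A) (hB : 0 ≤ B)
    (hκ : ∀ t, 0 ≤ t → t ≤ s → ‖κ t‖ ≤ A * Real.exp (k * (s - t)))
    (hQ : ∀ t, 0 ≤ t → t ≤ 1 → ‖Q t‖ ≤ K)
    (hg : ∀ t, 0 ≤ t → t ≤ s → ‖g t‖ ≤ B * Real.exp (k * t)) :
    ‖∫ t in (0 : ℝ)..s, κ t * (Q t * g t)‖ ≤ A * K * B * Real.exp (k * s) := by
  have hK : 0 ≤ K := (norm_nonneg _).trans (hQ 0 le_rfl zero_le_one)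
  have h1 : ∀ t ∈ Set.uIoc 0 s, ‖κ t * (Q t * g t)‖ ≤ A * K * B * Real.exp (k * s) := by
    intro t ht
    rw [Set.uIoc_of_le hs0] at ht
    rw [norm_mul, norm_mul]
    calc ‖κ t‖ * (‖Q t‖ * ‖g t‖)
        ≤ A * Real.exp (k * (s - t)) * (K * (B * Real.exp (k * t))) := by
          gcongr
          exacts [hκ t ht.1.le ht.2, hQ t ht.1.le (ht.2.trans hs1), hg t ht.1.le ht.2]
      _ = A * K * B * (Real.exp (k * (s - t)) * Real.exp (k * t)) := by ring
      _ = _ := by rw [← Real.exp_add]; ring_nf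
  refine (intervalIntegral.norm_integral_le_of_norm_le_const h1).trans ?_
  rw [sub_zero, abs_of_nonneg hs0]
  exact mul_le_of_le_one_right (by positivity) hs1

theorem norm_sin_kernel_le (β : ℂ) {s t : ℝ} (h : t ≤ s) :
    ‖Complex.sin (β * (s - t))‖ ≤ Real.exp (|β.im| * (s - t)) := by
  rw [← abs_im_mul_ofReal β (sub_nonneg.2 h), Complex.ofReal_sub]
  exact norm_sin_le_exp_abs_im _

theorem norm_cos_kernel_le (β : ℂ) {s t : ℝ} (h : t ≤ s) :
    ‖Complex.cos (β * (s - t))‖ ≤ Real.exp (|β.im| * (s - t)) := by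
  rw [← abs_im_mul_ofReal β (sub_nonneg.2 h), Complex.ofReal_sub]
  exact norm_cos_le_exp_abs_im _

/-- Let `M` be the maximum of `|f s| exp (-|Im β| s)` on the period. The integral term contributes
at most `K M / |β| ≤ M / 2`, hence `M ≤ 2A`; reinserting this bounds the remainder. -/
theorem IsSolution.norm_le {K A : ℝ} (hQ : Continuous Q)
    (hK : ∀ t, 0 ≤ t → t ≤ 1 → ‖Q t‖ ≤ K) (hβ : β ≠ 0) (hKβ : 2 * K ≤ ‖β‖)
    (hf : IsSolution (fun x => Q x - β ^ 2) f f') (hA : ‖f 0‖ + ‖f' 0‖ / ‖β‖ ≤ A) :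
    (∀ s, 0 ≤ s → s ≤ 1 → ‖f s‖ ≤ 2 * A * Real.exp (|β.im| * s)) ∧
    ∀ s, 0 ≤ s → s ≤ 1 →
      ‖f s - (f 0 * Complex.cos (β * s) + f' 0 * (Complex.sin (β * s) / β))‖ ≤
        2 * A * K / ‖β‖ * Real.exp (|β.im| * s) := by
  have hK0 : 0 ≤ K := (norm_nonneg _).trans (hK 0 le_rfl zero_le_one)
  have hβ0 : 0 < ‖β‖ := norm_pos_iff.2 hβ
  have hfc : Continuous f := continuous_iff_continuousAt.2 fun t => (hf t).1.continuousAt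
  set k := |β.im| with hk
  have hrem : ∀ M, 0 ≤ M → (∀ t, 0 ≤ t → t ≤ 1 → ‖f t‖ ≤ M * Real.exp (k * t)) →
      ∀ s, 0 ≤ s → s ≤ 1 →
      ‖f s - (f 0 * Complex.cos (β * s) + f' 0 * (Complex.sin (β * s) / β))‖ ≤
        1 / ‖β‖ * K * M * Real.exp (k * s) := by
    intro M hM hfM s hs0 hs1
    rw [(hf.variation_of_constants hQ hβ s).1, add_sub_cancel_left]
    refine norm_integral_kernel_le hs0 hs1 (by positivity) hM (fun t _ hts => ?_) hK
      fun t ht0 hts => hfM t ht0 (hts.trans hs1)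
    rw [norm_div, div_eq_mul_one_div, mul_comm]
    gcongr
    exact norm_sin_kernel_le β hts
  have hlead : ∀ s : ℝ, 0 ≤ s →
      ‖f 0 * Complex.cos (β * s) + f' 0 * (Complex.sin (β * s) / β)‖ ≤ A * Real.exp (k * s) := by
    intro s hs0
    have h1 := norm_cos_kernel_le β hs0
    have h2 := norm_sin_kernel_le β hs0
    simp only [Complex.ofReal_zero, sub_zero] at h1 h2
    calc _ ≤ ‖f 0‖ * ‖Complex.cos (β * s)‖ + ‖f' 0‖ * (‖Complex.sin (β * s)‖ / ‖β‖) := by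
          refine (norm_add_le _ _).trans ?_
          rw [norm_mul, norm_mul, norm_div]
      _ ≤ ‖f 0‖ * Real.exp (k * s) + ‖f' 0‖ * (Real.exp (k * s) / ‖β‖) := by gcongr
      _ = (‖f 0‖ + ‖f' 0‖ / ‖β‖) * Real.exp (k * s) := by ring
      _ ≤ _ := by gcongr
  obtain ⟨s₀, hs₀, hmax⟩ := (isCompact_Icc (a := (0 : ℝ)) (b := 1)).exists_isMaxOn
    (Set.nonempty_Icc.2 zero_le_one)
    (f := fun t => ‖f t‖ * Real.exp (-(k * t))) (by fun_prop)
  set M := ‖f s₀‖ * Real.exp (-(k * s₀)) with hM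
  have hfM : ∀ t, 0 ≤ t → t ≤ 1 → ‖f t‖ ≤ M * Real.exp (k * t) := fun t h0 h1 => by
    have h2 : ‖f t‖ * Real.exp (-(k * t)) ≤ M := hmax ⟨h0, h1⟩
    rw [Real.exp_neg, ← div_eq_mul_inv, div_le_iff₀ (Real.exp_pos _)] at h2
    exact h2
  have hM0 : 0 ≤ M := by positivity
  have hM2 : M ≤ 2 * A := by
    have h1 := hrem M hM0 hfM s₀ hs₀.1 hs₀.2
    have h2 := hlead s₀ hs₀.1
    have h3 : ‖f s₀‖ ≤ (A + 1 / ‖β‖ * K * M) * Real.exp (k * s₀) := by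
      have := norm_le_norm_add_norm_sub
        (f 0 * Complex.cos (β * s₀) + f' 0 * (Complex.sin (β * s₀) / β)) (f s₀)
      rw [norm_sub_rev] at this
      linarith
    have h4 : M ≤ A + 1 / ‖β‖ * K * M := by
      rw [hM, Real.exp_neg, ← div_eq_mul_inv, div_le_iff₀ (Real.exp_pos _)]
      rwa [hM, Real.exp_neg, ← div_eq_mul_inv] at h3
    have h5 : 1 / ‖β‖ * K ≤ 1 / 2 := by
      rw [one_div_mul_eq_div, div_le_div_iff₀ hβ0 two_pos]
      linarith
    nlinarith
  have hA0 : 0 ≤ 2 * A := hM0.trans hM2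
  have hfA : ∀ s, 0 ≤ s → s ≤ 1 → ‖f s‖ ≤ 2 * A * Real.exp (k * s) := fun s h0 h1 =>
    (hfM s h0 h1).trans (by gcongr)
  refine ⟨hfA, fun s h0 h1 => (hrem _ hA0 hfA s h0 h1).trans_eq ?_⟩
  ring

/-- Asymptotics of the trace of the monodromy of `f'' = (Q - β²) f`. -/
theorem IsFundamentalSystem.norm_trace_sub_le {K : ℝ} {v v' : ℝ → ℂ} (hQ : Continuous Q)
    (hK : ∀ t, 0 ≤ t → t ≤ 1 → ‖Q t‖ ≤ K) (hβ : β ≠ 0) (hKβ : 2 * K ≤ ‖β‖)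
    (h : IsFundamentalSystem (fun x => Q x - β ^ 2) f f' v v') :
    ‖f 1 + v' 1 - (2 * Complex.cos β + Complex.sin β / β * ∫ t in (0 : ℝ)..1, Q t)‖ ≤
      4 * K ^ 2 / ‖β‖ ^ 2 * Real.exp |β.im| := by
  obtain ⟨⟨hf, hf0, hf'0⟩, ⟨hv, hv0, hv'0⟩⟩ := h
  have hβ0 : 0 < ‖β‖ := norm_pos_iff.2 hβ
  have hK0 : 0 ≤ K := (norm_nonneg _).trans (hK 0 le_rfl zero_le_one)
  have hfc : Continuous f := continuous_iff_continuousAt.2 fun t => (hf t).1.continuousAt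
  have hvc : Continuous v := continuous_iff_continuousAt.2 fun t => (hv t).1.continuousAt
  have h1 := (hf.norm_le hQ hK hβ hKβ (A := 1) (by simp [hf0, hf'0])).2
  have h2 := (hv.norm_le hQ hK hβ hKβ (A := 1 / ‖β‖) (by simp [hv0, hv'0])).2
  have e1 := (hf.variation_of_constants hQ hβ 1).1
  have e2 := (hv.variation_of_constants hQ hβ 1).2
  simp only [hf0, hf'0, hv0, hv'0, one_mul, zero_mul, add_zero, zero_add, mul_one, mul_zero,
    neg_zero, Complex.ofReal_one] at h1 h2 e1 e2
  have b1 := norm_integral_kernel_le (Q := Q) zero_le_one le_rfl (A := 1 / ‖β‖) (by positivity)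
    (by positivity)
    (κ := fun t => Complex.sin (β * (1 - t)) / β)
    (g := fun t => f t - Complex.cos (β * t)) (k := |β.im|)
    (fun t _ ht => by
      have := norm_sin_kernel_le β ht
      rw [Complex.ofReal_one] at this
      rw [norm_div, div_eq_mul_one_div, mul_comm]
      gcongr) hK h1
  have b2 := norm_integral_kernel_le (Q := Q) zero_le_one le_rfl (A := 1) (by positivity)
    (by positivity)
    (κ := fun t => Complex.cos (β * (1 - t)))
    (g := fun t => v t - Complex.sin (β * t) / β) (k := |β.im|)
    (fun t _ ht => by
      have := norm_cos_kernel_le β ht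
      rw [Complex.ofReal_one] at this
      rwa [one_mul]) hK h2
  -- When the free solutions are put into the integrals, the addition formula collapses the
  -- first-order terms to `(sin β / β) ∫ Q`. Only second-order terms remain.
  have hsum : f 1 + v' 1 - (2 * Complex.cos β + Complex.sin β / β * ∫ t in (0 : ℝ)..1, Q t) =
      (∫ t in (0 : ℝ)..1, Complex.sin (β * (1 - t)) / β * (Q t * (f t - Complex.cos (β * t)))) +
      ∫ t in (0 : ℝ)..1, Complex.cos (β * (1 - t)) * (Q t * (v t - Complex.sin (β * t) / β)) := by
    have h3 : (∫ t in (0 : ℝ)..1, Complex.sin (β * (1 - t)) / β * (Q t * f t)) +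
        (∫ t in (0 : ℝ)..1, Complex.cos (β * (1 - t)) * (Q t * v t)) -
        (∫ t in (0 : ℝ)..1, Complex.sin β / β * Q t) =
      (∫ t in (0 : ℝ)..1, Complex.sin (β * (1 - t)) / β * (Q t * (f t - Complex.cos (β * t)))) +
      ∫ t in (0 : ℝ)..1, Complex.cos (β * (1 - t)) *
        (Q t * (v t - Complex.sin (β * t) / β)) := by
      rw [← intervalIntegral.integral_add (Continuous.intervalIntegrable (by fun_prop) _ _)
          (Continuous.intervalIntegrable (by fun_prop) _ _),
        ← intervalIntegral.integral_sub (Continuous.intervalIntegrable (by fun_prop) _ _)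
          (Continuous.intervalIntegrable (by fun_prop) _ _),
        ← intervalIntegral.integral_add (Continuous.intervalIntegrable (by fun_prop) _ _)
          (Continuous.intervalIntegrable (by fun_prop) _ _)]
      refine intervalIntegral.integral_congr fun t _ => ?_
      have h4 : Complex.sin β = Complex.sin (β * (1 - t)) * Complex.cos (β * t) +
          Complex.cos (β * (1 - t)) * Complex.sin (β * t) := by
        rw [← Complex.sin_add]
        ring_nf
      rw [h4]
      ring
    rw [← h3, intervalIntegral.integral_const_mul, e1, e2]
    ring
  rw [hsum]
  refine (norm_add_le _ _).trans ((add_le_add b1 b2).trans_eq ?_)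
  rw [mul_one]
  field_simp
  ring

end Hill

/-! ### The Liouville transformation and the asymptotics of the trace. -/

theorem norm_cos_sub_one_le {w : ℂ} (hw : ‖w‖ ≤ 1) : ‖Complex.cos w - 1‖ ≤ ‖w‖ ^ 2 := by
  have h1 := Complex.norm_exp_sub_one_sub_id_le (x := w * Complex.I) (by simpa using hw)
  have h2 := Complex.norm_exp_sub_one_sub_id_le (x := -w * Complex.I) (by simpa using hw)
  rw [norm_mul, Complex.norm_I, mul_one] at h1 h2
  rw [norm_neg] at h2
  have h3 : Complex.cos w - 1 = ((Complex.exp (w * Complex.I) - 1 - w * Complex.I) +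
      (Complex.exp (-w * Complex.I) - 1 - -w * Complex.I)) / 2 := by
    rw [Complex.cos]
    ring
  rw [h3, norm_div, Complex.norm_two]
  linarith [norm_add_le (Complex.exp (w * Complex.I) - 1 - w * Complex.I)
    (Complex.exp (-w * Complex.I) - 1 - -w * Complex.I)]

theorem norm_sin_sub_self_le {w : ℂ} (hw : ‖w‖ ≤ 1) : ‖Complex.sin w - w‖ ≤ ‖w‖ ^ 2 := by
  have h1 := Complex.norm_exp_sub_one_sub_id_le (x := w * Complex.I) (by simpa using hw)
  have h2 := Complex.norm_exp_sub_one_sub_id_le (x := -w * Complex.I) (by simpa using hw)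
  rw [norm_mul, Complex.norm_I, mul_one] at h1 h2
  rw [norm_neg] at h2
  have h3 : Complex.sin w - w = ((Complex.exp (-w * Complex.I) - 1 - -w * Complex.I) -
      (Complex.exp (w * Complex.I) - 1 - w * Complex.I)) * Complex.I / 2 := by
    rw [Complex.sin]
    linear_combination -w * Complex.I_sq
  rw [h3, norm_div, Complex.norm_two, norm_mul, Complex.norm_I]
  linarith [norm_sub_le (Complex.exp (-w * Complex.I) - 1 - -w * Complex.I)
    (Complex.exp (w * Complex.I) - 1 - w * Complex.I)]

/-- Taylor expansion in the shift `q / β`. Absorbing the first-order term in the phase leaves a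
single cosine, so that differences with `cos ζ` factor. -/
theorem norm_cos_add_sin_mul_sub_cos_le {q β : ℂ} (h : ‖q‖ ≤ ‖β‖) (hβ : β ≠ 0) :
    ‖Complex.cos β + Complex.sin β * (q / β) - Complex.cos (β - q / β)‖ ≤
      2 * ‖q‖ ^ 2 / ‖β‖ ^ 2 * Real.exp |β.im| := by
  have hβ0 : 0 < ‖β‖ := norm_pos_iff.2 hβ
  have hw : ‖q / β‖ ≤ 1 := by
    rw [norm_div]
    exact div_le_one_of_le₀ h hβ0.le
  rw [Complex.cos_sub, show Complex.cos β + Complex.sin β * (q / β) -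
      (Complex.cos β * Complex.cos (q / β) + Complex.sin β * Complex.sin (q / β)) =
      -(Complex.cos β * (Complex.cos (q / β) - 1) +
        Complex.sin β * (Complex.sin (q / β) - q / β)) by ring, norm_neg]
  calc _ ≤ ‖Complex.cos β‖ * ‖Complex.cos (q / β) - 1‖ +
        ‖Complex.sin β‖ * ‖Complex.sin (q / β) - q / β‖ := by
        refine (norm_add_le _ _).trans ?_
        rw [norm_mul, norm_mul]
    _ ≤ Real.exp |β.im| * ‖q / β‖ ^ 2 + Real.exp |β.im| * ‖q / β‖ ^ 2 := by
        gcongr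
        exacts [norm_cos_le_exp_abs_im β, norm_cos_sub_one_le hw, norm_sin_le_exp_abs_im β,
          norm_sin_sub_self_le hw]
    _ = _ := by rw [norm_div, div_pow]; ring

section Liouville

variable {W : ℂ → ℂ} {σ ρ ρ' ρ'' : ℝ → ℂ} {W₀ : ℂ}

/-- The Liouville transformation of `y'' = -α² W² y` along the curve `σ`. -/
theorem IsSolution.liouville (hσ : ∀ s, HasDerivAt σ (ρ s ^ 2)⁻¹ s)
    (hρ : ∀ s, HasDerivAt ρ (ρ' s) s) (hρ' : ∀ s, HasDerivAt ρ' (ρ'' s) s) (h0 : ∀ s, ρ s ≠ 0)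
    (hWσ : ∀ s, W (σ s) = W₀ * ρ s ^ 2) {α : ℂ} {y y' : ℂ → ℂ}
    (hy : IsSolution (fun z => -α ^ 2 * W z ^ 2) y y') :
    IsSolution (fun s => ρ'' s / ρ s - (α * W₀) ^ 2) (fun s => ρ s * y (σ s))
      (fun s => ρ' s * y (σ s) + (ρ s)⁻¹ * y' (σ s)) := fun s => by
  have h1 : HasDerivAt (fun s => y (σ s)) (y' (σ s) * (ρ s ^ 2)⁻¹) s :=
    (hy (σ s)).1.comp s (hσ s)
  have h2 : HasDerivAt (fun s => y' (σ s)) (-α ^ 2 * W (σ s) ^ 2 * y (σ s) * (ρ s ^ 2)⁻¹) s :=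
    (hy (σ s)).2.comp s (hσ s)
  have h3 : HasDerivAt (fun s => (ρ s)⁻¹) (-ρ' s / ρ s ^ 2) s := (hρ s).fun_inv (h0 s)
  have h4 := h0 s
  constructor
  · refine ((hρ s).mul h1).congr_deriv ?_
    field_simp
  · refine (((hρ' s).mul h1).add (h3.mul h2)).congr_deriv ?_
    rw [hWσ]
    field_simp
    ring

/-- The Liouville transformation preserves the trace of the monodromy. -/
theorem IsFundamentalSystem.exists_liouville (hper : ∀ z : ℂ, W (z + 1) = W z)
    (hσ : ∀ s, HasDerivAt σ (ρ s ^ 2)⁻¹ s)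
    (hρ : ∀ s, HasDerivAt ρ (ρ' s) s) (hρ' : ∀ s, HasDerivAt ρ' (ρ'' s) s) (h0 : ∀ s, ρ s ≠ 0)
    (hWσ : ∀ s, W (σ s) = W₀ * ρ s ^ 2) (hσ1 : ∀ s, σ (s + 1) = σ s + 1)
    (hρ1 : ∀ s, ρ (s + 1) = ρ s) {α : ℂ} {y₁ y₁' y₂ y₂' : ℂ → ℂ}
    (hy : IsFundamentalSystem (fun z => -α ^ 2 * W z ^ 2) y₁ y₁' y₂ y₂') :
    ∃ f f' v v' : ℝ → ℂ,
      IsFundamentalSystem (fun s => ρ'' s / ρ s - (α * W₀) ^ 2) f f' v v' ∧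
      f 1 + v' 1 = y₁ 1 + y₂' 1 := by
  set u₁ : ℝ → ℂ := fun s => ρ s * y₁ (σ s) with hu₁
  set u₁' : ℝ → ℂ := fun s => ρ' s * y₁ (σ s) + (ρ s)⁻¹ * y₁' (σ s) with hu₁'
  set u₂ : ℝ → ℂ := fun s => ρ s * y₂ (σ s) with hu₂
  set u₂' : ℝ → ℂ := fun s => ρ' s * y₂ (σ s) + (ρ s)⁻¹ * y₂' (σ s) with hu₂'
  have s₁ : IsSolution _ u₁ u₁' := hy.1.1.liouville hσ hρ hρ' h0 hWσ
  have s₂ : IsSolution _ u₂ u₂' := hy.2.1.liouville hσ hρ hρ' h0 hWσ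
  have hdet : u₁ 0 * u₂' 0 - u₁' 0 * u₂ 0 = 1 := by
    rw [← hy.wronskian_eq_one (σ 0), hu₁, hu₁', hu₂, hu₂']
    have := h0 0
    field_simp
    ring
  have hσ10 : σ 1 = σ 0 + 1 := by simpa using hσ1 0
  have hρ10 : ρ 1 = ρ 0 := by simpa using hρ1 0
  have hρ'10 : ρ' 1 = ρ' 0 := by
    have h2 := (hρ (0 + 1)).comp_add_const 0 1
    simp only [hρ1, zero_add] at h2
    exact h2.unique (hρ 0)
  have hb : ∀ z : ℂ, -α ^ 2 * W (z + 1) ^ 2 = -α ^ 2 * W z ^ 2 := fun z => by rw [hper]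
  obtain ⟨⟨m₁, m₁'⟩, ⟨m₂, m₂'⟩⟩ := hy.shift_eq hb (σ 0)
  have e₁ : u₁ 1 = y₁ 1 * u₁ 0 + y₁' 1 * u₂ 0 := by
    simp only [hu₁, hu₂, hσ10, hρ10, m₁]
    ring
  have e₁' : u₁' 1 = y₁ 1 * u₁' 0 + y₁' 1 * u₂' 0 := by
    simp only [hu₁', hu₂', hσ10, hρ10, hρ'10, m₁, m₁']
    ring
  have e₂ : u₂ 1 = y₂ 1 * u₁ 0 + y₂' 1 * u₂ 0 := by
    simp only [hu₁, hu₂, hσ10, hρ10, m₂]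
    ring
  have e₂' : u₂' 1 = y₂ 1 * u₁' 0 + y₂' 1 * u₂' 0 := by
    simp only [hu₁', hu₂', hσ10, hρ10, hρ'10, m₂, m₂']
    ring
  have hlin : ∀ p q : ℂ, IsSolution (fun s => ρ'' s / ρ s - (α * W₀) ^ 2)
      (fun s => p * u₁ s + q * u₂ s) (fun s => p * u₁' s + q * u₂' s) := fun p q s =>
    ⟨((s₁ s).1.const_mul p).add ((s₂ s).1.const_mul q),
      (((s₁ s).2.const_mul p).add ((s₂ s).2.const_mul q)).congr_deriv (by ring)⟩
  -- The transported pair has Wronskian one but other initial data. Normalizing it conjugates the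
  -- monodromy and keeps the trace.
  refine ⟨_, _, _, _, ⟨⟨hlin (u₂' 0) (-u₁' 0), ?_, ?_⟩, ⟨hlin (-u₂ 0) (u₁ 0), ?_, ?_⟩⟩, ?_⟩
  · linear_combination hdet
  · ring
  · ring
  · linear_combination hdet
  · simp only [e₁, e₁', e₂, e₂']
    linear_combination (y₁ 1 + y₂' 1) * hdet

end Liouville

/-- In presence of a Stokes loop, the half-trace of the monodromy of `y'' = -(β / W₀)² W² y` is
close to `cos (β - q / β)` for a constant `q`. -/
theorem IsStokesLoop.exists_isNearCos {W : ℂ → ℂ} (hW : Differentiable ℂ W)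
    (hper : ∀ z : ℂ, W (z + 1) = W z) (hW₀ : meanValue W ≠ 0) {γ : ℝ → ℂ}
    (h : IsStokesLoop W γ) :
    ∃ (T : ℂ → ℂ) (q : ℂ) (C₀ R₀ : ℝ), IsNearCos T q C₀ R₀ ∧ ∀ α ζ : ℂ,
      (∃ u ∈ kerP W ζ α, u ≠ 0) ↔ T (α * meanValue W) = Complex.cos ζ := by
  obtain ⟨σ, ρ, ρ', ρ'', hσ, hρ, hρ', hρ''c, h0, hWσ, hσ1, hρ1⟩ :=
    h.exists_liouville hW hper hW₀
  have ha : Differentiable ℂ fun z => W z ^ 2 := hW.pow 2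
  obtain ⟨y₁, y₁', hy₁, hy₁', hy₁0, hy₁d⟩ := exists_entire_solution (p := 1) (s := 0) ha
  obtain ⟨y₂, y₂', hy₂, hy₂', hy₂0, hy₂d⟩ := exists_entire_solution (p := 0) (s := 1) ha
  have hfund : ∀ α : ℂ, IsFundamentalSystem (fun z => -α ^ 2 * W z ^ 2)
      (y₁ (-α ^ 2)) (y₁' (-α ^ 2)) (y₂ (-α ^ 2)) (y₂' (-α ^ 2)) := fun α =>
    ⟨⟨fun z => ⟨hy₁ _ z, hy₁' _ z⟩, hy₁0 _⟩, ⟨fun z => ⟨hy₂ _ z, hy₂' _ z⟩, hy₂0 _⟩⟩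
  have hρc : Continuous ρ := continuous_iff_continuousAt.2 fun s => (hρ s).continuousAt
  have hQ : Continuous fun s => ρ'' s / ρ s := hρ''c.div hρc h0
  obtain ⟨K, hK⟩ := (isCompact_Icc (a := (0 : ℝ)) (b := 1)).exists_bound_of_continuousOn
    hQ.continuousOn
  have hK' : ∀ t, 0 ≤ t → t ≤ 1 → ‖ρ'' t / ρ t‖ ≤ K := fun t h1 h2 => hK t ⟨h1, h2⟩
  -- The factor `1 / 2` comes from passing to the half-trace.
  set q : ℂ := (∫ t in (0 : ℝ)..1, ρ'' t / ρ t) / 2 with hq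
  refine ⟨fun β => (y₁ (-(β / meanValue W) ^ 2) 1 + y₂' (-(β / meanValue W) ^ 2) 1) / 2, q,
    2 * K ^ 2 + 2 * ‖q‖ ^ 2, max 1 (max (2 * K) ‖q‖),
    ⟨?_, by positivity, le_max_left _ _, fun β hβ => ?_⟩, fun α ζ => ?_⟩
  · have h1 : Differentiable ℂ fun β : ℂ => -(β / meanValue W) ^ 2 := by fun_prop
    exact (((hy₁d 1).1.comp h1).add ((hy₂d 1).2.comp h1)).div_const 2
  · rw [max_le_iff, max_le_iff] at hβ
    have hβ0 : β ≠ 0 := norm_pos_iff.1 (zero_lt_one.trans_le hβ.1)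
    obtain ⟨f, f', v, v', hf, htr⟩ := (hfund (β / meanValue W)).exists_liouville hper hσ hρ hρ'
      h0 hWσ hσ1 hρ1
    rw [div_mul_cancel₀ _ hW₀] at hf
    have h1 := hf.norm_trace_sub_le hQ hK' hβ0 hβ.2.1
    have h2 := norm_cos_add_sin_mul_sub_cos_le hβ.2.2 hβ0
    rw [htr, show (∫ t in (0 : ℝ)..1, ρ'' t / ρ t) = 2 * q by rw [hq]; ring] at h1
    set A := y₁ (-(β / meanValue W) ^ 2) 1 + y₂' (-(β / meanValue W) ^ 2) 1
    rw [show A / 2 - Complex.cos (β - q / β) =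
      (A - (2 * Complex.cos β + Complex.sin β / β * (2 * q))) / 2 +
        (Complex.cos β + Complex.sin β * (q / β) - Complex.cos (β - q / β)) by ring]
    refine (norm_add_le _ _).trans ?_
    rw [norm_div, Complex.norm_two]
    refine (add_le_add (div_le_div_of_nonneg_right h1 zero_le_two) h2).trans_eq ?_
    ring
  · rw [exists_mem_kerP_ne_zero_iff hW hper (hfund α)]
    simp only [mul_div_cancel_right₀ _ hW₀]
    rw [div_eq_iff two_ne_zero, mul_comm]

theorem theorem3 (W : ℂ → ℂ) (hW : Differentiable ℂ W) (hper : ∀ z : ℂ, W (z + 1) = W z)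
    (hW₀ : meanValue W ≠ 0) (hloop : ∃ γ : ℝ → ℂ, IsStokesLoop W γ) :
    ∃ (C R : ℝ) (αplus αminus : ℤ → ℂ → ℂ),
      (∀ (n : ℤ) (ζ : ℂ), |ζ.re| ≤ Real.pi →
        ‖αplus n ζ - (meanValue W)⁻¹ * (2 * Real.pi * n + ζ)‖ ≤ C / (1 + ‖αplus n ζ‖) ∧
        ‖αminus n ζ - (meanValue W)⁻¹ * (2 * Real.pi * n - ζ)‖ ≤ C / (1 + ‖αminus n ζ‖)) ∧
      ∀ α ζ : ℂ, R ≤ ‖α‖ → |ζ.re| ≤ Real.pi →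
        ((∃ u ∈ kerP W ζ α, u ≠ 0) ↔ ∃ n : ℤ, α = αplus n ζ ∨ α = αminus n ζ) := by
  obtain ⟨γ, hγ⟩ := hloop
  obtain ⟨T, q, C₀, R₀, hT, hker⟩ := hγ.exists_isNearCos hW hper hW₀
  obtain ⟨C, R, βp, βm, hβ, hiff⟩ := hT.exists_labelling
  have hw : 0 < ‖meanValue W‖ := norm_pos_iff.2 hW₀
  -- Passing from `β` to `α = β / W₀` rescales both the error and the weight, each at the cost of
  -- one factor `1 + |W₀|⁻¹`.
  have hscale : ∀ b c : ℂ, ‖b - c‖ ≤ C / (1 + ‖b‖) →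
      ‖(meanValue W)⁻¹ * b - (meanValue W)⁻¹ * c‖ ≤
        C * (1 + ‖meanValue W‖⁻¹) ^ 2 / (1 + ‖(meanValue W)⁻¹ * b‖) := by
    intro b c hbc
    have hx : 0 < ‖meanValue W‖⁻¹ := inv_pos.2 hw
    have hb := norm_nonneg b
    rw [← mul_sub, norm_mul, norm_mul, norm_inv]
    rw [le_div_iff₀ (by positivity)] at hbc ⊢
    have hC : 0 ≤ C := le_trans (by positivity) hbc
    generalize ‖meanValue W‖⁻¹ = x at *
    calc x * ‖b - c‖ * (1 + x * ‖b‖)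
        ≤ (1 + x) * ‖b - c‖ * ((1 + x) * (1 + ‖b‖)) := by
          gcongr
          · linarith
          · nlinarith
      _ = ‖b - c‖ * (1 + ‖b‖) * (1 + x) ^ 2 := by ring
      _ ≤ _ := by gcongr
  refine ⟨C * (1 + ‖meanValue W‖⁻¹) ^ 2, R / ‖meanValue W‖,
    fun n ζ => (meanValue W)⁻¹ * βp n ζ, fun n ζ => (meanValue W)⁻¹ * βm n ζ,
    fun n ζ _ => ⟨hscale _ _ (hβ n ζ).1, hscale _ _ (hβ n ζ).2⟩, fun α ζ hα _ => ?_⟩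
  rw [div_le_iff₀ hw, ← norm_mul] at hα
  rw [hker, hiff _ _ hα]
  simp only [eq_inv_mul_iff_mul_eq₀ hW₀, mul_comm (meanValue W) α]
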